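/- Let $\lambda$ be an uncountable regular cardinal, identified with the set of ordinals below it. Let $\mathscr O=\bigcup_{k\ge1}\lambda^{\lambda^k}$. A clone is a subset of $\mathscr O$ that contains all projections and is closed under composition; $\langle A\rangle$ is the clone generated by $A$. Let $\mathscr C_{\max}$ be the set of all $f\in\mathscr O$ with $f(\vec x)\le\max\vec x$ for all $\vec x$. For unbounded $A\subseteq\lambda$ let $h_A(x)=\min\{y\in A:y>x\}$, and for a family $U$ of unbounded sets let $\mathscr C_U=\langle\mathscr C_{\max}\cup\{h_A:A\in U\}\rangle$. **Trees.** A planar tree is a nonempty set with a partial order $\trianglelefteq$ (strict part $\vartriangleleft$) in which every set $\{\eta:\eta\trianglelefteq\nu\}$ is well-ordered, and an irreflexive partial order $<$, such that two distinct nodes are $<$-comparable iff they are $\trianglelefteq$-incomparable, and such that $\eta\trianglelefteq\eta'$, $\nu\trianglelefteq\nu'$, $\eta<\nu$ imply $\eta'<\nu'$. A branch is a maximal $\trianglelefteq$-chain; a front is a set of nodes that meets each branch exactly once; the roots are the $\trianglelefteq$-minimal nodes; $\mathrm{Succ}(\eta)$ is the set of direct successors of $\eta$; leaves are the nodes without direct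 successor, and the other nodes are internal. For a set $H$ of nodes, $S^H$ is the set of nodes $\trianglerighteq$ some element of $H$, and $S^\eta=S^{\{\eta\}}$. **Creatures.** Let $\Lambda=\lambda\cup\{(i,j)\in\lambda\times\lambda:i<j\}$, $\alpha(i)=\beta(i)=i$, $\alpha(i,j)=i$, $\beta(i,j)=j$; for $\eta\ne\nu$ in $\Lambda$ put $\eta<\nu$ iff $\beta(\eta)\le\alpha(\nu)$, and $\eta\vartriangleleft\nu$ iff $\alpha(\eta)\le\alpha(\nu)$ and $\beta(\eta)>\beta(\nu)$. A (concrete) creature is a set $S\subseteq\Lambda$ which with these relations is a planar tree without infinite $\trianglelefteq$-chains, whose leaves lie in $\lambda$ and whose internal nodes are pairs, together with, for each internal $\eta$, an ultrafilter $D^S_\eta$ on $\mathrm{Succ}_S(\eta)$, such that $\mathrm{Succ}_S(\eta)$ has no $<$-last element, all sets $\{\nu'\in\mathrm{Succ}_S(\eta):\nu<\nu'\}$ with $\nu\in\mathrm{Succ}_S(\eta)$ are in $D^S_\eta$, $\alpha(\eta)\le\min_S[\eta]$ and $\beta(\eta)=\sup_S[\eta]$. Here $\min_S[\eta]$ and $\sup_S[\eta]$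 are the minimum and the supremum of the set of leaves of $S^\eta$. A creature is large if it has $\lambda$ roots. **Relations between creatures.** - $T\le_{\rm thin}S$: $T\subseteq S$ contains all roots of $S$; $\mathrm{Succ}_T(\eta)\subseteq \mathrm{Succ}_S(\eta)$ and $\mathrm{Succ}_T(\eta)\in D^S_\eta$ for every $\eta\in T$ internal in $S$; and $D^T_\eta$ is the trace of $D^S_\eta$ on $\mathrm{Succ}_T(\eta)$. - $T\le_{\rm short}S$: $T=S^{H}$ (with the same ultrafilters), where $H=\{\gamma':\gamma'\text{ a root of }S,\ \gamma<\gamma'\}$ for some root $\gamma$ of $S$. - $T\le S$: there is a front $F$ of $T$ consisting of roots of $S$ with $T^\gamma\le_{\rm thin}S^\gamma$ for all $\gamma\in F$. - For large $S,S'$: $S\approx S'$ iff there are large $T,T_1,T_2$ with $T\le_{\rm short}T_1\le_{\rm thin}S$ and $T\le_{\rm short}T_2\le_{\rm thin}S'$; and $T\le^*S$ iff $T\approx T'\le S$ for some large $T'$. **Comparing operations.** Let $f\in\mathscr O$. A leaf is $f$-weak. An internal node $\eta$ of $S$ is $f$-weak if $f(\vec y)\ge\sup_S[\eta]$ for some $\vec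 y\le\min_S[\eta]$, and $f$-strong if $f(\vec y)<\sup_S[\eta]$ for all $\vec y<\sup_S[\eta]$. A front $F$ of $S$ gauges $f$ if its elements are internal and $f$-strong and all nodes strictly above an element of $F$ are $f$-weak. Write $f<_Sg$ (respectively $f\sim_Sg$) if there are fronts $F,G$ of $S$ gauging $f$ and $g$ such that, for every leaf $\nu$, the elements $\eta\in F$, $\mu\in G$ below $\nu$ satisfy $\mu\vartriangleleft\eta$ (respectively $\mu=\eta$). Write $f<^*_Sg$ if $f<_{S'}g$ for some large $S'\approx S$, and similarly $f\sim^*_Sg$. For large $S$ let $D_S$ be the family of all $A\subseteq\lambda$ that contain all leaves of some large $S'\approx S$, and let $\mathscr C_S=\mathscr C_{D_S}$. A sequence $(S_i:i<\lambda^+)$ of large creatures is *sufficiently generic* if $S_j\le^*S_i$ for all $i<j$, and for all $f,g\in\mathscr O$ there is $i$ with $f<_{S_i}g$ or $f\sim_{S_i}g$ or $g<_{S_i}f$. **Theorem.** If $2^\lambda=\lambda^+$, then a sufficiently generic sequence exists. Let $(S_i:i<\lambda^+)$ be any sufficiently generic sequence, and put $\mathscr C_\infty=\bigcup_i\mathscr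 C_{S_i}$ and $U=\bigcup_iD_{S_i}$; let $f<_\infty g$ iff $f<_{S_i}g$ for some $i$, and $f\sim_\infty g$ iff $f\sim_{S_i}g$ for some $i$. Then: 1. $U$ is a filter on $\lambda$ all of whose members are unbounded; $(\mathscr C_{S_i})_i$ is an increasing sequence of clones; $\mathscr C_\infty$ is a clone, and $\mathscr C_\infty=\mathscr C_U$. 2. $f<_\infty g$ iff $f<^*_{S_i}g$ for some $i$, and $f\sim_\infty g$ iff $f\sim^*_{S_i}g$ for some $i$. 3. (a) If $f<_\infty g$, then $f\in\langle\mathscr C_\infty\cup\{g\}\rangle$. (b') If $f<_\infty g$, then $g\notin\langle\mathscr C_\infty\cup\{f\}\rangle$. (c') If $f<_\infty g$ or $f\sim_\infty g$, then $\max(f,g)\sim_\infty g$. Here $\max$ is the pointwise maximum after $f$ and $g$ are brought to any common arity by adding dummy variables at the end. 4. There are a complete linear order $L$ and a map $\rho:\mathscr O\to L$ with $$(*)\qquad f<_\infty g\iff\rho(f)<\rho(g),\qquad f\sim_\infty g\iff\rho(f)=\rho(g).$$ 5. Whenever $L$ is a linear order in which all nonempty bounded sets have suprema and infima and $\rho:\mathscr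 O\to L$ satisfies $(*)$: for every $d\in L$ each of the sets $\{f:\rho(f)<d\}$ and $\{f:\rho(f)\le d\}$ is a clone unless it is empty; and for every clone $\mathscr D$ with $\mathscr C_\infty\subseteq\mathscr D\ne\mathscr O$ there is $d\in L$ with $\{f:\rho(f)<d\}\subseteq\mathscr D\subseteq\{f:\rho(f)\le d\}$. 6. For every $f\in\mathscr O$ there is $g\in\mathscr O$ with $f<_\infty g$. The sets $\mathscr D_{\le f}=\{h:h<_\infty f\text{ or }h\sim_\infty f\}$, $f\in\mathscr O$, are clones with $\mathscr C_\infty\subseteq\mathscr D_{\le f}\ne\mathscr O$; they are linearly ordered by inclusion; every clone $\mathscr D$ with $\mathscr C_\infty\subseteq\mathscr D\ne\mathscr O$ is contained in some $\mathscr D_{\le f}$; and for every $f$ there is $g$ with $\mathscr D_{\le f}\subsetneq\mathscr D_{\le g}$. 7. $\mathscr C_\infty\ne\mathscr O$, and the interval $[\mathscr C_\infty,\mathscr O]$ of the clone lattice has no coatom. -/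

import Mathlib

universe u v

namespace CreatureClone

open Cardinal

/-! ### Operations and clones -/

/-- The finitary operations of positive arity on `X`: `⟨n, f⟩` is the `(n+1)`-ary operation `f`. -/
abbrev Operation (X : Type u) : Type u := Σ n : ℕ, ((Fin (n + 1) → X) → X)

/-- A clone: a set of operations which contains all projections and is closed under composition. -/
structure IsClone {X : Type u} (C : Set (Operation X)) : Prop where
  proj_mem : ∀ (n : ℕ) (i : Fin (n + 1)), (⟨n, fun x => x i⟩ : Operation X) ∈ C
  comp_mem : ∀ (n m : ℕ) (f : (Fin (n + 1) → X) → X) (g : Fin (n + 1) → (Fin (m + 1) → X) → X),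
    (⟨n, f⟩ : Operation X) ∈ C → (∀ i, (⟨m, g i⟩ : Operation X) ∈ C) →
      (⟨m, fun x => f (fun i => g i x)⟩ : Operation X) ∈ C

/-- The clone generated by a set of operations. -/
def cloneGen {X : Type u} (A : Set (Operation X)) : Set (Operation X) :=
  ⋂₀ {C | IsClone C ∧ A ⊆ C}

/-- The interval `[C, O]` in the lattice of clones on `X`. -/
def cloneInterval {X : Type u} (C : Set (Operation X)) : Set (Set (Operation X)) :=
  {D | IsClone D ∧ C ⊆ D}

/-- The pointwise maximum of `f` and `g`, both regarded as `(k+1)`-ary operations by adding dummy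
variables at the end. (For `f`, `g` of the same arity `k+1` it is the plain pointwise maximum.) -/
def maxOp {X : Type u} [LinearOrder X] (f g : Operation X) (k : ℕ) (hf : f.1 ≤ k) (hg : g.1 ≤ k) :
    Operation X :=
  ⟨k, fun x => max (f.2 fun i => x (Fin.castLE (Nat.succ_le_succ hf) i))
    (g.2 fun i => x (Fin.castLE (Nat.succ_le_succ hg) i))⟩

/-- `C_max`: the operations `f` with `f (x₁, …, xₖ) ≤ max (x₁, …, xₖ)`. -/
def cmax (X : Type u) [LinearOrder X] : Set (Operation X) :=
  {f | ∀ x, ∃ i, f.2 x ≤ x i}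

open Classical in
/-- `h_A x = min {y ∈ A : y > x}`; meant for unbounded `A` (the value is `x` if there is no
such `y`). -/
noncomputable def nextIn {X : Type u} [LinearOrder X] [WellFoundedLT X] (A : Set X) (x : X) : X :=
  if h : {y | y ∈ A ∧ x < y}.Nonempty then
    (wellFounded_lt : WellFounded ((· < ·) : X → X → Prop)).min {y | y ∈ A ∧ x < y} h
  else x

/-- `h_A` as a unary operation. -/
noncomputable def hOp {X : Type u} [LinearOrder X] [WellFoundedLT X] (A : Set X) : Operation X :=
  ⟨0, fun x => nextIn A (x 0)⟩

/-- `C_U`: the clone generated by `C_max` and the functions `h_A`, `A ∈ U`. -/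
def filterClone {X : Type u} [LinearOrder X] [WellFoundedLT X] (U : Set (Set X)) :
    Set (Operation X) :=
  cloneGen (cmax X ∪ {h | ∃ A ∈ U, h = hOp A})

/-! ### Planar trees -/

/-- A planar tree on the type `T`, with tree order `tle` and lexicographic order `lt`. -/
structure IsPlanarTree {T : Type u} (tle lt : T → T → Prop) : Prop where
  nonempty : Nonempty T
  tle_refl : ∀ x, tle x x
  tle_trans : ∀ x y z, tle x y → tle y z → tle x z
  tle_antisymm : ∀ x y, tle x y → tle y x → x = y
  below_total : ∀ z x y, tle x z → tle y z → tle x y ∨ tle y x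
  below_wf : ∀ z, {x | tle x z}.WellFoundedOn (fun x y => tle x y ∧ x ≠ y)
  lt_irrefl : ∀ x, ¬ lt x x
  lt_trans : ∀ x y z, lt x y → lt y z → lt x z
  comparable_iff : ∀ x y, x ≠ y → ((lt x y ∨ lt y x) ↔ ¬ (tle x y ∨ tle y x))
  lt_of_tle : ∀ x x' y y', tle x x' → tle y y' → lt x y → lt x' y'

/-- The set `Λ`: elements of the base set `X`, and pairs `(i, j)` with `i < j`. -/
inductive Node (X : Type u) [LinearOrder X] : Type u
  | pt (i : X) : Node X
  | pair (i j : X) (h : i < j) : Node X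

namespace Node

variable {X : Type u} [LinearOrder X]

/-- First coordinate. -/
def α : Node X → X
  | pt i => i
  | pair i _ _ => i

/-- Second coordinate. -/
def β : Node X → X
  | pt i => i
  | pair _ j _ => j

/-- The lexicographic order `<` of `Λ`. -/
def Lex (η ν : Node X) : Prop := η ≠ ν ∧ β η ≤ α ν

/-- The strict tree order of `Λ`. -/
def TLT (η ν : Node X) : Prop := η ≠ ν ∧ α η ≤ α ν ∧ β ν < β η

/-- The reflexive tree order of `Λ`. -/
def TLE (η ν : Node X) : Prop := η = ν ∨ TLT η ν

end Node

/-! ### Creatures -/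

/-- The data of a concrete creature: a set of nodes `S ⊆ Λ`, and ultrafilters `D_η`.  Only the
`D_η` with `η` internal matter; an ultrafilter on `Succ_S(η)` is represented by the ultrafilter on
`Λ` which it generates, i.e. by an ultrafilter on `Λ` that contains `Succ_S(η)`. -/
structure PreCreature (X : Type u) [LinearOrder X] : Type u where
  nodes : Set (Node X)
  D : Node X → Ultrafilter (Node X)

namespace PreCreature

variable {X : Type u} [LinearOrder X]

/-- `Succ_S(η)`: the nodes `ν` such that `η` is the largest node strictly below `ν`. -/
def succs (S : PreCreature X) (η : Node X) : Set (Node X) :=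
  {ν | ν ∈ S.nodes ∧ (η ∈ S.nodes ∧ η.TLT ν) ∧ ∀ ν' ∈ S.nodes, ν'.TLT ν → ν'.TLE η}

/-- External nodes. -/
def leaves (S : PreCreature X) : Set (Node X) := {η | η ∈ S.nodes ∧ S.succs η = ∅}

/-- Internal nodes. -/
def internal (S : PreCreature X) : Set (Node X) := S.nodes \ S.leaves

/-- Minimal nodes. -/
def roots (S : PreCreature X) : Set (Node X) := {η | η ∈ S.nodes ∧ ∀ ν ∈ S.nodes, ¬ ν.TLT η}

/-- `S^H`, the part of `S` lying above the set `H` of nodes. -/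
def above (S : PreCreature X) (H : Set (Node X)) : PreCreature X where
  nodes := {η | η ∈ S.nodes ∧ ∃ γ ∈ H, γ.TLE η}
  D := S.D

/-- The external nodes of `S`, as a subset of the base set. -/
def leafSet (S : PreCreature X) : Set X := {i | Node.pt i ∈ S.leaves}

/-- The external nodes of `S^η`, as a subset of the base set; its minimum is `min_S[η]` and its
supremum is `sup_S[η]`. -/
def leafSetAbove (S : PreCreature X) (η : Node X) : Set X := (S.above {η}).leafSet

/-- `S` is a (concrete) creature. -/
structure IsCreature (S : PreCreature X) : Prop where
  planar : IsPlanarTree (T := S.nodes) (fun η ν => η.1.TLE ν.1) (fun η ν => η.1.Lex ν.1)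
  wellFounded : ∀ c ⊆ S.nodes, IsChain Node.TLE c → c.Finite
  succs_noMax : ∀ η ∈ S.internal, ∀ ν ∈ S.succs η, ∃ ν' ∈ S.succs η, ν.Lex ν'
  succs_mem : ∀ η ∈ S.internal, S.succs η ∈ S.D η
  converges : ∀ η ∈ S.internal, ∀ ν ∈ S.succs η, {ν' | ν' ∈ S.succs η ∧ ν.Lex ν'} ∈ S.D η
  internal_pair : ∀ η ∈ S.internal, ∃ i j h, η = Node.pair i j h
  leaf_pt : ∀ η ∈ S.leaves, ∃ i, η = Node.pt i
  α_le : ∀ η ∈ S.internal, ∀ i ∈ S.leafSetAbove η, η.α ≤ i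
  β_isLUB : ∀ η ∈ S.internal, IsLUB (S.leafSetAbove η) η.β

/-- A creature is large if its set of roots is as large as the base set. -/
def IsLarge (S : PreCreature X) : Prop := #S.roots = #X

/-- A maximal linearly ordered set of nodes. -/
def IsBranch (S : PreCreature X) (b : Set (Node X)) : Prop :=
  b ⊆ S.nodes ∧ IsChain Node.TLE b ∧
    ∀ c ⊆ S.nodes, IsChain Node.TLE c → b ⊆ c → c = b

/-- A set of nodes which meets each branch exactly once. -/
def IsFront (S : PreCreature X) (F : Set (Node X)) : Prop :=
  F ⊆ S.nodes ∧ ∀ b, S.IsBranch b → ∃! η, η ∈ F ∧ η ∈ b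

/-- `T ≤_thin S`. -/
def Thin (T S : PreCreature X) : Prop :=
  T.nodes ⊆ S.nodes ∧ S.roots ⊆ T.nodes ∧
    (∀ η ∈ T.nodes ∩ S.internal, T.succs η ⊆ S.succs η ∧ T.succs η ∈ S.D η) ∧
    ∀ η ∈ T.internal, T.D η = S.D η

/-- `T ≤_short S`: `T` is the part of `S` above the roots lying strictly to the right of some
root. -/
def Short (T S : PreCreature X) : Prop :=
  ∃ γ ∈ S.roots, T.nodes = (S.above {γ' | γ' ∈ S.roots ∧ γ.Lex γ'}).nodes ∧
    ∀ η ∈ T.internal, T.D η = S.D η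

/-- The relation `T ≤ S` between creatures. -/
def LE (T S : PreCreature X) : Prop :=
  ∃ F, T.IsFront F ∧ F ⊆ S.roots ∧ ∀ γ ∈ F, (T.above {γ}).Thin (S.above {γ})

/-- `η` is `f`-weak in `S`. -/
def Weak (S : PreCreature X) (f : Operation X) (η : Node X) : Prop :=
  η ∈ S.leaves ∨ (η ∈ S.internal ∧ ∃ m s, IsLeast (S.leafSetAbove η) m ∧
    IsLUB (S.leafSetAbove η) s ∧ ∃ y, (∀ i, y i ≤ m) ∧ s ≤ f.2 y)

/-- `η` is `f`-strong in `S`. -/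
def Strong (S : PreCreature X) (f : Operation X) (η : Node X) : Prop :=
  η ∈ S.internal ∧ ∃ s, IsLUB (S.leafSetAbove η) s ∧ ∀ y, (∀ i, y i < s) → f.2 y < s

/-- The front `F` gauges `f` in `S`. -/
def Gauges (S : PreCreature X) (F : Set (Node X)) (f : Operation X) : Prop :=
  S.IsFront F ∧ (∀ η ∈ F, S.Strong f η) ∧
    ∀ η ∈ F, ∀ ν ∈ S.nodes, η.TLT ν → S.Weak f ν

/-- `f <_S g`: on each branch the front gauging `g` lies strictly below the front gauging `f`. -/
def Lt (S : PreCreature X) (f g : Operation X) : Prop :=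
  ∃ F G, S.Gauges F f ∧ S.Gauges G g ∧
    ∀ ν ∈ S.leaves, ∃ η ∈ F, ∃ μ ∈ G, η.TLE ν ∧ μ.TLE ν ∧ μ.TLT η

/-- `f ∼_S g`: on each branch the fronts gauging `f` and `g` agree. -/
def Sim (S : PreCreature X) (f g : Operation X) : Prop :=
  ∃ F G, S.Gauges F f ∧ S.Gauges G g ∧
    ∀ ν ∈ S.leaves, ∃ η ∈ F, ∃ μ ∈ G, η.TLE ν ∧ μ.TLE ν ∧ η = μ

end PreCreature

/-! ### Large creatures -/

/-- Large concrete creatures. -/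
abbrev LargeCreature (X : Type u) [LinearOrder X] : Type u :=
  {S : PreCreature X // S.IsCreature ∧ S.IsLarge}

namespace LargeCreature

variable {X : Type u} [LinearOrder X]

/-- `T ≤_thin/short S`. -/
def ThinShort (T S : LargeCreature X) : Prop :=
  ∃ T' : LargeCreature X, T.1.Short T'.1 ∧ T'.1.Thin S.1

/-- `S ≈ S'`. -/
def Approx (S S' : LargeCreature X) : Prop :=
  ∃ T : LargeCreature X, ThinShort T S ∧ ThinShort T S'

/-- `T ≤* S`. -/
def LEStar (T S : LargeCreature X) : Prop :=
  ∃ T' : LargeCreature X, Approx T T' ∧ T'.1.LE S.1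

/-- `f <*_S g`. -/
def LtStar (S : LargeCreature X) (f g : Operation X) : Prop :=
  ∃ S' : LargeCreature X, Approx S' S ∧ S'.1.Lt f g

/-- `f ∼*_S g`. -/
def SimStar (S : LargeCreature X) (f g : Operation X) : Prop :=
  ∃ S' : LargeCreature X, Approx S' S ∧ S'.1.Sim f g

/-- The filter `D_S`, as a family of sets. -/
def filterSets (S : LargeCreature X) : Set (Set X) :=
  {A | ∃ S' : LargeCreature X, Approx S' S ∧ S'.1.leafSet ⊆ A}

/-- The clone `C_S`. -/
def clone [WellFoundedLT X] (S : LargeCreature X) : Set (Operation X) :=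
  filterClone S.filterSets

end LargeCreature

/-! ### Sufficiently generic sequences -/

section Generic

variable {X : Type u} [LinearOrder X] {I : Type u}

/-- A `≤*`-decreasing sequence of large creatures which compares any two operations. -/
def SufficientlyGeneric [LinearOrder I] (S : I → LargeCreature X) : Prop :=
  (∀ i j, i < j → (S j).LEStar (S i)) ∧
    ∀ f g : Operation X, ∃ i, (S i).1.Lt f g ∨ (S i).1.Sim f g ∨ (S i).1.Lt g f

/-- `f <_∞ g`. -/
def LtInf (S : I → LargeCreature X) (f g : Operation X) : Prop := ∃ i, (S i).1.Lt f g

/-- `f ∼_∞ g`. -/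
def SimInf (S : I → LargeCreature X) (f g : Operation X) : Prop := ∃ i, (S i).1.Sim f g

/-- `C_∞`, the union of the clones `C_{S_i}`. -/
def cInf [WellFoundedLT X] (S : I → LargeCreature X) : Set (Operation X) := ⋃ i, (S i).clone

/-- `ρ` induces the relations `<_∞` and `∼_∞`. -/
def Represents (S : I → LargeCreature X) {Q : Type v} [LinearOrder Q] (ρ : Operation X → Q) :
    Prop :=
  ∀ f g, (LtInf S f g ↔ ρ f < ρ g) ∧ (SimInf S f g ↔ ρ f = ρ g)

end Generic

end CreatureClone

open CreatureClone

/-!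
In a creature `S`, no node is both `f`-weak and `f`-strong. Hence at most one front of `S` gauges
a given operation `f` (`PreCreature.Gauges.unique`), and the front which gauges `f` is inherited
by all creatures below `S` (`PreCreature.Gauges.restrict`). So the three relations `f <_S g`,
`f ∼_S g` and `g <_S f` exclude each other and, once decided, are never changed again. A sufficiently
generic sequence decides all of them. It generates a filter on the set of large creatures
(`genericFilter`), and `f <_∞ g` holds iff `f <_T g` for almost all `T` (`ltInf_iff`), and
similarly for `∼_∞`; membership in the union of the filters `D_{S_i}` is also a statement about
almost all `T`. Finitely many such statements can be verified in one and the same `T`.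

The comparison with clones rests on the fact that a node `η` is `f`-strong iff it is a pair and
`f` preserves the set of ordinals below `β η`. This property is preserved under composition, and
it holds for all operations in `C_max` and for `h_A` if `A` contains all leaves of the creature.
If `f <_S g`, the nodes gauging `f` are `g`-weak: an operation generated by `f` and `C_∞`
preserves their initial segments, but `g` does not (`LtInf.notMem_cloneGen`). Conversely, at such
a node `η`, `g` maps some tuple below any leaf above `η` to a value above all values of `f` at
arguments below that leaf, and such a leaf is found by means of `h_A`; so `f` is bounded by an
operation generated by `g`, and clones above `C_max` are closed under passing to smaller
operations (`LtInf.mem_cloneGen`). All nodes on or below the front gauging `f` are `f`-strong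
(`PreCreature.Gauges.isStrong_of_tle`), which shows that initial segments of the order are clones
and that the order has no last element. Everything about the interval above `C_∞` follows.

A sufficiently generic sequence is constructed by a recursion of length `λ⁺`, which has two kinds
of steps. First, below every large creature there is one which decides how `f` and `g` compare
(`PreCreature.IsCreature.exists_le_decides`). The trees are glued into blocks which end at closure
points of `f` and `g`, so that all new roots are strong for `f` and `g`; the creature is thinned
out until the last strong nodes form fronts; and it is thinned out again until the relative
position of the two fronts is constant on each tree. Secondly, a decreasing sequence of length
less than `λ⁺` has a lower bound (`LargeCreature.exists_lowerBound`). If its cofinality is `λ`, a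
diagonal choice of trees from the members works. If the cofinality is smaller, each new root gets
as successors roots of trees which come from a cofinal family of members, and its ultrafilter
concentrates on the late ones. In both cases the trees can be corrected afterwards, above all
nodes of a front at once (`LargeCreature.leStar_of_front`).
-/

namespace CreatureClone
open Cardinal

/-! ### The two orders on nodes -/

namespace Node
variable {X : Type u} [LinearOrder X] {η ν μ η' ν' : Node X}

theorem α_le_β (η : Node X) : η.α ≤ η.β := by
  cases η with
  | pt i => exact le_rfl
  | pair i j h => exact h.le

theorem eq_pt (h : η.β ≤ η.α) : η = pt η.α := by
  cases η with
  | pt i => rfl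
  | pair i j h' => exact absurd h (not_le.2 h')

theorem eq_pair (h : η.α < η.β) : η = pair η.α η.β h := by
  cases η with
  | pt i => exact absurd h (lt_irrefl _)
  | pair i j h' => rfl

theorem ext_αβ (h : η.α = ν.α) (h' : η.β = ν.β) : η = ν := by
  rcases η with i | ⟨i, j, hij⟩ <;> rcases ν with k | ⟨k, l, hkl⟩
  · exact congrArg pt h
  · exact absurd hkl (not_lt.2 (h'.symm.trans h).le)
  · exact absurd hij (not_lt.2 (h'.trans h.symm).le)
  · obtain rfl : i = k := h
    obtain rfl : j = l := h'
    rfl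

theorem tlt_iff : η.TLT ν ↔ η.α ≤ ν.α ∧ ν.β < η.β :=
  ⟨fun h => h.2, fun h => ⟨fun e => lt_irrefl _ (e ▸ h.2), h⟩⟩

theorem TLT.α_le (h : η.TLT ν) : η.α ≤ ν.α := h.2.1
theorem TLT.β_lt (h : η.TLT ν) : ν.β < η.β := h.2.2
theorem TLT.tle (h : η.TLT ν) : η.TLE ν := Or.inr h
theorem TLE.refl (η : Node X) : η.TLE η := Or.inl rfl

theorem TLE.α_le (h : η.TLE ν) : η.α ≤ ν.α := by
  rcases h with rfl | h
  · exact le_rfl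
  · exact h.α_le

theorem TLE.β_le (h : η.TLE ν) : ν.β ≤ η.β := by
  rcases h with rfl | h
  · exact le_rfl
  · exact h.β_lt.le

theorem TLT.irrefl (η : Node X) : ¬ η.TLT η := fun h => h.1 rfl

theorem TLT.α_lt_β (h : η.TLT ν) : η.α < η.β :=
  h.α_le.trans_lt (ν.α_le_β.trans_lt h.β_lt)

theorem TLE.trans_tlt (h : η.TLE ν) (h' : ν.TLT μ) : η.TLT μ :=
  tlt_iff.2 ⟨h.α_le.trans h'.α_le, h'.β_lt.trans_le h.β_le⟩

theorem TLT.trans_tle (h : η.TLT ν) (h' : ν.TLE μ) : η.TLT μ :=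
  tlt_iff.2 ⟨h.α_le.trans h'.α_le, h'.β_le.trans_lt h.β_lt⟩

theorem TLE.trans (h : η.TLE ν) (h' : ν.TLE μ) : η.TLE μ := by
  rcases h' with rfl | h'
  · exact h
  · exact (h.trans_tlt h').tle

theorem TLT.not_tle (h : η.TLT ν) : ¬ ν.TLE η := fun h' => TLT.irrefl _ (h.trans_tle h')

theorem TLE.antisymm (h : η.TLE ν) (h' : ν.TLE η) : η = ν := by
  rcases h with rfl | h
  · rfl
  · exact absurd h' h.not_tle

theorem TLE.tlt_of_ne (h : η.TLE ν) (h' : η ≠ ν) : η.TLT ν := h.resolve_left h'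

theorem not_pt_tlt (i : X) : ¬ (pt i).TLT ν := fun h => lt_irrefl _ h.α_lt_β

theorem TLE.eq_of_pt {i : X} (h : (pt i).TLE ν) : pt i = ν := h.resolve_right (not_pt_tlt i)

theorem Lex.β_le_α (h : η.Lex ν) : η.β ≤ ν.α := h.2
theorem Lex.α_le_α (h : η.Lex ν) : η.α ≤ ν.α := η.α_le_β.trans h.2
theorem Lex.β_le_β (h : η.Lex ν) : η.β ≤ ν.β := h.2.trans ν.α_le_β
theorem Lex.irrefl (η : Node X) : ¬ η.Lex η := fun h => h.1 rfl

theorem Lex.not_tlt (h : η.Lex ν) : ¬ η.TLT ν := fun h' => absurd h'.β_lt (not_lt.2 h.β_le_β)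

theorem Lex.asymm (h : η.Lex ν) : ¬ ν.Lex η := fun h' => by
  have h1 : η.β ≤ η.α := h.2.trans (ν.α_le_β.trans h'.2)
  have h2 : ν.β ≤ ν.α := h'.2.trans (η.α_le_β.trans h.2)
  exact h.1 (ext_αβ (le_antisymm h.α_le_α h'.α_le_α) (le_antisymm h.β_le_β h'.β_le_β))

theorem Lex.trans (h : η.Lex ν) (h' : ν.Lex μ) : η.Lex μ :=
  ⟨fun e => by subst e; exact h.asymm h', h.2.trans h'.α_le_α⟩

/-- The only way in which two nodes can be comparable both in the tree order and in the
lexicographic order. -/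
theorem Lex.eq_of_tle (h : η.Lex ν) (h' : ν.TLE η) :
    η = pt ν.α ∧ ν.α < ν.β := by
  have h'' := h'.tlt_of_ne h.1.symm
  have h1 : η.β ≤ η.α := h.2.trans h''.α_le
  refine ⟨?_, h''.α_lt_β⟩
  rw [eq_pt h1, le_antisymm h.α_le_α h''.α_le]

end Node

/-! ### Elementary properties of creatures -/

namespace PreCreature
variable {X : Type u} [LinearOrder X] {S T R : PreCreature X} {η ν μ x y z : Node X} {i : X}

theorem mem_succs_iff : ν ∈ S.succs η ↔ ν ∈ S.nodes ∧ (η ∈ S.nodes ∧ η.TLT ν) ∧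
    ∀ ν' ∈ S.nodes, ν'.TLT ν → ν'.TLE η := Iff.rfl

theorem mem_of_mem_succs (h : ν ∈ S.succs η) : ν ∈ S.nodes := h.1
theorem left_mem_of_mem_succs (h : ν ∈ S.succs η) : η ∈ S.nodes := h.2.1.1
theorem tlt_of_mem_succs (h : ν ∈ S.succs η) : η.TLT ν := h.2.1.2
theorem tle_of_mem_succs (h : ν ∈ S.succs η) (hx : x ∈ S.nodes) (h' : x.TLT ν) : x.TLE η :=
  h.2.2 x hx h'

theorem eq_of_mem_succs (h : ν ∈ S.succs η) (h' : ν ∈ S.succs μ) : η = μ :=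
  (tle_of_mem_succs h' (left_mem_of_mem_succs h) (tlt_of_mem_succs h)).antisymm
    (tle_of_mem_succs h (left_mem_of_mem_succs h') (tlt_of_mem_succs h'))

/-- A sufficient condition for a set of nodes to be a planar tree: since most of the axioms hold
for all of `Λ`, only comparability and the exclusion of `i` together with `(i, j)` remain. -/
theorem isPlanarTree_of (hne : S.nodes.Nonempty)
    (htot : ∀ x ∈ S.nodes, ∀ y ∈ S.nodes, x.TLE y ∨ y.TLE x ∨ x.Lex y ∨ y.Lex x)
    (hpt : ∀ i j h, Node.pt i ∈ S.nodes → Node.pair i j h ∉ S.nodes)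
    (hfin : ∀ c ⊆ S.nodes, IsChain Node.TLE c → c.Finite) :
    IsPlanarTree (T := S.nodes) (fun η ν => η.1.TLE ν.1) (fun η ν => η.1.Lex ν.1) := by
  have key : ∀ x ∈ S.nodes, ∀ y ∈ S.nodes, x.Lex y → ¬ x.TLE y ∧ ¬ y.TLE x := by
    intro x hx y hy h
    refine ⟨fun h' => h.not_tlt (h'.tlt_of_ne h.1), fun h' => ?_⟩
    obtain ⟨h1, h2⟩ := h.eq_of_tle h'
    rw [h1] at hx
    rw [Node.eq_pair h2] at hy
    exact hpt _ _ _ hx hy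
  have hlex : ∀ x ∈ S.nodes, ∀ x' ∈ S.nodes, ∀ y ∈ S.nodes, ∀ y' ∈ S.nodes, x.TLE x' → y.TLE y' →
      x.Lex y → x'.Lex y' := by
    intro x hx x' hx' y hy y' hy' h h' hl
    refine ⟨?_, h.β_le.trans (hl.2.trans h'.α_le)⟩
    rintro rfl
    have h1 : x'.β ≤ x'.α := h.β_le.trans (hl.2.trans h'.α_le)
    have h2 : x'.β = x.β := by
      refine le_antisymm h.β_le (hl.2.trans (h'.α_le.trans x'.α_le_β))
    have h3 : x = x' := by
      by_contra hne
      exact absurd (h.tlt_of_ne hne).β_lt (h2 ▸ lt_irrefl _)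
    subst h3
    exact (key _ hx _ hy hl).2 h'
  have hbt : ∀ z ∈ S.nodes, ∀ x ∈ S.nodes, ∀ y ∈ S.nodes, x.TLE z → y.TLE z →
      x.TLE y ∨ y.TLE x := by
    intro z hz x hx y hy h h'
    rcases htot x hx y hy with h1 | h1 | h1 | h1
    · exact Or.inl h1
    · exact Or.inr h1
    · exact absurd (hlex x hx z hz y hy z hz h h' h1) (Node.Lex.irrefl _)
    · exact absurd (hlex y hy z hz x hx z hz h' h h1) (Node.Lex.irrefl _)
  refine ⟨hne.to_subtype, fun x => Node.TLE.refl _, fun x y z h h' => h.trans h',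
    fun x y h h' => Subtype.ext (h.antisymm h'),
    fun z x y => hbt z z.2 x x.2 y y.2, ?_, fun x => Node.Lex.irrefl _,
    fun x y z h h' => h.trans h', ?_,
    fun x x' y y' h h' => hlex x x.2 x' x'.2 y y.2 y' y'.2 h h'⟩
  · intro z
    have hf : ({x : S.nodes | x.1.TLE z.1}).Finite := by
      have : (Subtype.val '' {x : S.nodes | x.1.TLE z.1}).Finite := by
        refine hfin _ (by rintro _ ⟨x, -, rfl⟩; exact x.2) ?_
        rintro _ ⟨x, hx, rfl⟩ _ ⟨y, hy, rfl⟩ -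
        exact hbt z z.2 x x.2 y y.2 hx hy
      exact this.of_finite_image Subtype.val_injective.injOn
    have : IsStrictOrder S.nodes (fun x y => x.1.TLE y.1 ∧ x ≠ y) :=
      { irrefl := fun x h => h.2 rfl
        trans := fun x y z h h' => ⟨h.1.trans h'.1, fun e => by
          subst e
          exact h.2 (Subtype.ext (h.1.antisymm h'.1))⟩ }
    exact hf.wellFoundedOn
  · intro x y hne'
    constructor
    · rintro (h | h) (h' | h')
      · exact (key _ x.2 _ y.2 h).1 h'
      · exact (key _ x.2 _ y.2 h).2 h'
      · exact (key _ y.2 _ x.2 h).2 h'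
      · exact (key _ y.2 _ x.2 h).1 h'
    · intro h
      rcases htot x x.2 y y.2 with h1 | h1 | h1 | h1
      · exact absurd (Or.inl h1) h
      · exact absurd (Or.inr h1) h
      · exact Or.inl h1
      · exact Or.inr h1

theorem mem_leafSetAbove_iff_mem_leaves : i ∈ S.leafSetAbove η ↔
    Node.pt i ∈ (S.above {η}).leaves := Iff.rfl

theorem mem_above_nodes : x ∈ (S.above {η}).nodes ↔ x ∈ S.nodes ∧ η.TLE x := by
  simp [above]

namespace IsCreature

theorem nonempty (hS : S.IsCreature) : S.nodes.Nonempty :=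
  Set.nonempty_coe_sort.1 hS.planar.nonempty

theorem not_tle_of_lex (hS : S.IsCreature) (hx : x ∈ S.nodes) (hy : y ∈ S.nodes) (h : x.Lex y) :
    ¬ x.TLE y ∧ ¬ y.TLE x := by
  have := (hS.planar.comparable_iff ⟨x, hx⟩ ⟨y, hy⟩ (fun e => h.1 (congrArg Subtype.val e))).1
    (Or.inl h)
  exact not_or.1 this

theorem total (hS : S.IsCreature) (hx : x ∈ S.nodes) (hy : y ∈ S.nodes) :
    x.TLE y ∨ y.TLE x ∨ x.Lex y ∨ y.Lex x := by
  by_cases h : x = y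
  · exact Or.inl (Or.inl h)
  have := hS.planar.comparable_iff ⟨x, hx⟩ ⟨y, hy⟩ (fun e => h (congrArg Subtype.val e))
  simp only at this
  tauto

theorem below_total (hS : S.IsCreature) (hx : x ∈ S.nodes) (hy : y ∈ S.nodes) (hz : z ∈ S.nodes)
    (h : x.TLE z) (h' : y.TLE z) : x.TLE y ∨ y.TLE x :=
  hS.planar.below_total ⟨z, hz⟩ ⟨x, hx⟩ ⟨y, hy⟩ h h'

theorem lex_of_tle (hS : S.IsCreature) {x' y' : Node X} (hx : x ∈ S.nodes) (hy : y ∈ S.nodes)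
    (hx' : x' ∈ S.nodes) (hy' : y' ∈ S.nodes) (h : x.TLE x') (h' : y.TLE y') (hl : x.Lex y) :
    x'.Lex y' :=
  hS.planar.lt_of_tle ⟨x, hx⟩ ⟨x', hx'⟩ ⟨y, hy⟩ ⟨y', hy'⟩ h h' hl

theorem below_finite (hS : S.IsCreature) (hz : z ∈ S.nodes) :
    {x | x ∈ S.nodes ∧ x.TLE z}.Finite :=
  hS.wellFounded _ (fun _ h => h.1) fun _ h _ h' _ => hS.below_total h.1 h'.1 hz h.2 h'.2

theorem mem_leaves_iff (hS : S.IsCreature) : η ∈ S.leaves ↔ η ∈ S.nodes ∧ η.β ≤ η.α := by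
  constructor
  · intro h
    obtain ⟨i, rfl⟩ := hS.leaf_pt η h
    exact ⟨h.1, le_rfl⟩
  · rintro ⟨h, h'⟩
    by_contra hn
    obtain ⟨i, j, hij, rfl⟩ := hS.internal_pair η ⟨h, hn⟩
    exact absurd h' (not_le.2 hij)

theorem mem_internal_iff (hS : S.IsCreature) : η ∈ S.internal ↔ η ∈ S.nodes ∧ η.α < η.β := by
  rw [internal, Set.mem_sdiff, hS.mem_leaves_iff]
  constructor
  · rintro ⟨h, h'⟩
    exact ⟨h, not_le.1 fun h1 => h' ⟨h, h1⟩⟩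
  · rintro ⟨h, h'⟩
    exact ⟨h, fun h1 => absurd h1.2 (not_le.2 h')⟩

theorem mem_leafSet_iff (hS : S.IsCreature) : i ∈ S.leafSet ↔ Node.pt i ∈ S.nodes := by
  rw [leafSet, Set.mem_ofPred_eq, hS.mem_leaves_iff]
  exact ⟨fun h => h.1, fun h => ⟨h, le_rfl⟩⟩

/-- The direct successor of `η` in the direction of a node `ν` above `η`. It exists because there
are no infinite chains. -/
theorem exists_succ_tle (hS : S.IsCreature) (hη : η ∈ S.nodes) (hν : ν ∈ S.nodes)
    (h : η.TLT ν) : ∃ ν' ∈ S.succs η, ν'.TLE ν := by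
  have hf : {x | x ∈ S.nodes ∧ η.TLT x ∧ x.TLE ν}.Finite :=
    (hS.below_finite hν).subset fun x hx => ⟨hx.1, hx.2.2⟩
  obtain ⟨x, hx, hmax⟩ := Set.exists_max_image _ Node.β hf ⟨ν, hν, h, Node.TLE.refl _⟩
  refine ⟨x, ⟨hx.1, ⟨hη, hx.2.1⟩, fun y hy hyx => ?_⟩, hx.2.2⟩
  rcases hS.below_total hη hy hν h.tle (hyx.tle.trans hx.2.2) with h1 | h1
  · rcases h1 with rfl | h1
    · exact Node.TLE.refl _
    · exact absurd (hmax y ⟨hy, h1, hyx.tle.trans hx.2.2⟩) (not_le.2 hyx.β_lt)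
  · exact h1

theorem exists_root (hS : S.IsCreature) (hη : η ∈ S.nodes) : ∃ r ∈ S.roots, r.TLE η := by
  obtain ⟨x, hx, hmax⟩ := Set.exists_max_image _ Node.β (hS.below_finite hη)
    ⟨η, hη, Node.TLE.refl _⟩
  exact ⟨x, ⟨hx.1, fun y hy hyx => absurd (hmax y ⟨hy, hyx.tle.trans hx.2⟩)
    (not_le.2 hyx.β_lt)⟩, hx.2⟩

theorem succs_nonempty (hS : S.IsCreature) (hη : η ∈ S.nodes) (h : η.α < η.β) :
    (S.succs η).Nonempty :=
  Ultrafilter.nonempty_of_mem (hS.succs_mem η (hS.mem_internal_iff.2 ⟨hη, h⟩))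

theorem root_eq (hS : S.IsCreature) {r r' : Node X} (hr : r ∈ S.roots) (hr' : r' ∈ S.roots)
    (hη : η ∈ S.nodes) (h : r.TLE η) (h' : r'.TLE η) : r = r' := by
  rcases hS.below_total hr.1 hr'.1 hη h h' with h1 | h1
  · exact h1.resolve_right (hr'.2 _ hr.1)
  · exact (h1.resolve_right (hr.2 _ hr'.1)).symm

theorem roots_total (hS : S.IsCreature) {r r' : Node X} (hr : r ∈ S.roots) (hr' : r' ∈ S.roots) :
    r = r' ∨ r.Lex r' ∨ r'.Lex r := by
  rcases hS.total hr.1 hr'.1 with h | h | h | h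
  · exact Or.inl (h.resolve_right (hr'.2 _ hr.1))
  · exact Or.inl (h.resolve_right (hr.2 _ hr'.1)).symm
  · exact Or.inr (Or.inl h)
  · exact Or.inr (Or.inr h)

theorem root_tle_of_tle (hS : S.IsCreature) {r : Node X} (hr : r ∈ S.roots) (hη : η ∈ S.nodes)
    (hν : ν ∈ S.nodes) (h : r.TLE ν) (h' : η.TLE ν) : r.TLE η := by
  rcases hS.below_total hr.1 hη hν h h' with h1 | h1
  · exact h1
  · exact Or.inl (h1.resolve_right (hr.2 _ hη)).symm

theorem succs_above (hS : S.IsCreature) (hx : x.TLE η) (hxS : x ∈ S.nodes) :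
    (S.above {x}).succs η = S.succs η := by
  ext ν
  rw [mem_succs_iff, mem_succs_iff, mem_above_nodes, mem_above_nodes]
  constructor
  · rintro ⟨⟨h1, h2⟩, ⟨h3, h4⟩, h5⟩
    refine ⟨h1, ⟨h3.1, h4⟩, fun ν' hν' h6 => ?_⟩
    rcases hS.below_total hxS hν' h1 h2 h6.tle with h7 | h7
    · exact h5 ν' (mem_above_nodes.2 ⟨hν', h7⟩) h6
    · exact h7.trans hx
  · rintro ⟨h1, ⟨h3, h4⟩, h5⟩
    exact ⟨⟨h1, hx.trans h4.tle⟩, ⟨⟨h3, hx⟩, h4⟩, fun ν' hν' h6 =>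
      h5 ν' (mem_above_nodes.1 hν').1 h6⟩

theorem mem_leafSetAbove_iff (hS : S.IsCreature) (hη : η ∈ S.nodes) :
    i ∈ S.leafSetAbove η ↔ Node.pt i ∈ S.nodes ∧ η.TLE (Node.pt i) := by
  rw [mem_leafSetAbove_iff_mem_leaves, leaves, Set.mem_ofPred_eq, mem_above_nodes]
  constructor
  · exact fun h => h.1
  · rintro ⟨h, h'⟩
    refine ⟨⟨h, h'⟩, ?_⟩
    rw [hS.succs_above h' hη]
    exact (hS.mem_leaves_iff.2 ⟨h, le_rfl⟩).2

theorem exists_leaf [WellFoundedLT X] (hS : S.IsCreature) (hη : η ∈ S.nodes) :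
    ∃ i, Node.pt i ∈ S.nodes ∧ η.TLE (Node.pt i) := by
  induction hb : η.β using WellFoundedLT.induction generalizing η with
  | ind b ih =>
    by_cases h : η.α < η.β
    · obtain ⟨ν, hν⟩ := hS.succs_nonempty hη h
      have ht := tlt_of_mem_succs hν
      obtain ⟨i, hi, hi'⟩ := ih ν.β (hb ▸ ht.β_lt) (mem_of_mem_succs hν) rfl
      exact ⟨i, hi, ht.tle.trans hi'⟩
    · have := Node.eq_pt (not_lt.1 h)
      exact ⟨η.α, this ▸ hη, this ▸ Node.TLE.refl _⟩

theorem isLUB_iff (hS : S.IsCreature) (hη : η ∈ S.nodes) (h : η.α < η.β) {s : X} :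
    IsLUB (S.leafSetAbove η) s ↔ s = η.β :=
  ⟨fun h' => h'.unique (hS.β_isLUB η (hS.mem_internal_iff.2 ⟨hη, h⟩)),
    fun h' => h' ▸ hS.β_isLUB η (hS.mem_internal_iff.2 ⟨hη, h⟩)⟩

theorem exists_leaf_gt (hS : S.IsCreature) (hη : η ∈ S.nodes) (h : η.α < η.β) {z : X}
    (hz : z < η.β) : ∃ i, Node.pt i ∈ S.nodes ∧ η.TLE (Node.pt i) ∧ z < i := by
  obtain ⟨i, hi, hi'⟩ := (lt_isLUB_iff (hS.β_isLUB η (hS.mem_internal_iff.2 ⟨hη, h⟩))).1 hz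
  rw [hS.mem_leafSetAbove_iff hη] at hi
  exact ⟨i, hi.1, hi.2, hi'⟩

/-- Distinct roots have distinct first coordinates. -/
theorem α_injOn_roots (hS : S.IsCreature) : Set.InjOn Node.α S.roots := by
  intro r hr r' hr' h
  have key : ∀ r ∈ S.roots, ∀ r' ∈ S.roots, r.α = r'.α → ¬ r.Lex r' := by
    intro r hr r' hr' h hl
    have h1 : r.β ≤ r.α := hl.2.trans h.ge
    have h2 : r'.TLE r := by
      by_contra hn
      have h3 : r.β < r'.β := by
        refine lt_of_le_of_ne hl.β_le_β fun e => hl.1 (Node.ext_αβ h e)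
      exact hn (Or.inr (Node.tlt_iff.2 ⟨h.ge, h3⟩))
    exact (hS.not_tle_of_lex hr.1 hr'.1 hl).2 h2
  rcases hS.roots_total hr hr' with h1 | h1 | h1
  · exact h1
  · exact absurd h1 (key r hr r' hr' h)
  · exact absurd h1 (key r' hr' r hr h.symm)

theorem roots_lex_of_α_lt (hS : S.IsCreature) {r r' : Node X} (hr : r ∈ S.roots)
    (hr' : r' ∈ S.roots) (h : r.α < r'.α) : r.Lex r' := by
  rcases hS.roots_total hr hr' with h1 | h1 | h1
  · exact absurd (h1 ▸ h) (lt_irrefl _)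
  · exact h1
  · exact absurd h1.α_le_α (not_le.2 h)

/-- Lexicographic comparison with a root is inherited by all nodes of the same tree. -/
theorem root_lex_iff (hS : S.IsCreature) {r : Node X} (hr : r ∈ S.roots) (hη : η ∈ S.nodes)
    (hν : ν ∈ S.nodes) (h : η.TLE ν) : r.Lex ν ↔ r.Lex η := by
  constructor
  · intro hl
    rcases hS.total hr.1 hη with h1 | h1 | h1 | h1
    · exact absurd (h1.trans h) (hS.not_tle_of_lex hr.1 hν hl).1
    · rcases h1 with rfl | h1
      · exact absurd h (hS.not_tle_of_lex hr.1 hν hl).1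
      · exact absurd h1 (hr.2 _ hη)
    · exact h1
    · exact absurd (hS.lex_of_tle hη hr.1 hν hr.1 h (Node.TLE.refl _) h1) hl.asymm
  · exact fun hl => hS.lex_of_tle hr.1 hη hr.1 hν (Node.TLE.refl _) h hl

end IsCreature

/-! ### Fronts -/

theorem IsCreature.isBranch_leaf (hS : S.IsCreature) (hi : Node.pt i ∈ S.nodes) :
    S.IsBranch {x | x ∈ S.nodes ∧ x.TLE (Node.pt i)} := by
  refine ⟨fun _ h => h.1, fun _ h _ h' _ => hS.below_total h.1 h'.1 hi h.2 h'.2,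
    fun c hc hch hsub => Set.Subset.antisymm (fun y hy => ⟨hc hy, ?_⟩) hsub⟩
  by_cases e : y = Node.pt i
  · exact e ▸ Node.TLE.refl _
  · rcases hch hy (hsub ⟨hi, Node.TLE.refl _⟩) e with h | h
    · exact h
    · exact absurd h.eq_of_pt.symm e

/-- The branches of a creature are the sets of nodes below a leaf. -/
theorem IsCreature.exists_leaf_of_isBranch (hS : S.IsCreature) {b : Set (Node X)}
    (hb : S.IsBranch b) :
    ∃ i, Node.pt i ∈ S.nodes ∧ b = {x | x ∈ S.nodes ∧ x.TLE (Node.pt i)} := by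
  obtain ⟨hb1, hb2, hb3⟩ := hb
  have hne : b.Nonempty := by
    by_contra h
    rw [Set.not_nonempty_iff_eq_empty] at h
    obtain ⟨x, hx⟩ := hS.nonempty
    have := hb3 {x} (Set.singleton_subset_iff.2 hx) (Set.subsingleton_singleton.isChain)
      (h ▸ Set.empty_subset _)
    exact absurd (this.trans h) (Set.singleton_ne_empty _)
  obtain ⟨t, ht, hmin⟩ := Set.exists_min_image b Node.β (hS.wellFounded b hb1 hb2) hne
  -- the node `t` with the least second coordinate is the last one, hence a leaf by maximality
  have hbt : ∀ x ∈ b, x.TLE t := by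
    intro x hx
    by_cases e : x = t
    · exact Or.inl e
    rcases hb2 hx ht e with h | h
    · exact h
    · exact absurd (hmin x hx) (not_le.2 (h.tlt_of_ne (Ne.symm e)).β_lt)
  have hlt : ¬ t.α < t.β := by
    intro h
    obtain ⟨ν, hν⟩ := hS.succs_nonempty (hb1 ht) h
    have hts := tlt_of_mem_succs hν
    have : insert ν b = b := by
      refine hb3 _ (Set.insert_subset (mem_of_mem_succs hν) hb1) ?_ (Set.subset_insert _ _)
      refine hb2.insert fun x hx _ => Or.inr ((hbt x hx).trans hts.tle)
    exact (hts.not_tle) (hbt ν (this ▸ Set.mem_insert _ _))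
  have hpt := Node.eq_pt (not_lt.1 hlt)
  refine ⟨t.α, hpt ▸ hb1 ht, ?_⟩
  rw [← hpt]
  exact (hb3 {x | x ∈ S.nodes ∧ x.TLE t} (fun _ h => h.1)
    (fun _ h _ h' _ => hS.below_total h.1 h'.1 (hb1 ht) h.2 h'.2)
    (fun x hx => ⟨hb1 hx, hbt x hx⟩)).symm

/-- Fronts in terms of leaves instead of branches. -/
theorem IsCreature.isFront_iff (hS : S.IsCreature) {F : Set (Node X)} :
    S.IsFront F ↔ F ⊆ S.nodes ∧
      ∀ i, Node.pt i ∈ S.nodes → ∃! η, η ∈ F ∧ η.TLE (Node.pt i) := by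
  constructor
  · rintro ⟨h1, h2⟩
    refine ⟨h1, fun i hi => ?_⟩
    obtain ⟨η, ⟨h3, h4⟩, h5⟩ := h2 _ (hS.isBranch_leaf hi)
    exact ⟨η, ⟨h3, h4.2⟩, fun ν hν => h5 ν ⟨hν.1, h1 hν.1, hν.2⟩⟩
  · rintro ⟨h1, h2⟩
    refine ⟨h1, fun b hb => ?_⟩
    obtain ⟨i, hi, rfl⟩ := hS.exists_leaf_of_isBranch hb
    obtain ⟨η, ⟨h3, h4⟩, h5⟩ := h2 i hi
    exact ⟨η, ⟨h3, h1 h3, h4⟩, fun ν hν => h5 ν ⟨hν.1, hν.2.2⟩⟩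

theorem IsFront.exists_tle (hS : S.IsCreature) {F : Set (Node X)} (hF : S.IsFront F)
    (hi : Node.pt i ∈ S.nodes) : ∃ η ∈ F, η.TLE (Node.pt i) := by
  obtain ⟨η, h, -⟩ := (hS.isFront_iff.1 hF).2 i hi
  exact ⟨η, h⟩

theorem IsFront.eq_of_tle [WellFoundedLT X] (hS : S.IsCreature) {F : Set (Node X)}
    (hF : S.IsFront F) (hη : η ∈ F) (hν : ν ∈ F) (hx : x ∈ S.nodes) (h : η.TLE x)
    (h' : ν.TLE x) : η = ν := by
  obtain ⟨i, hi, hi'⟩ := hS.exists_leaf hx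
  exact ((hS.isFront_iff.1 hF).2 i hi).unique ⟨hη, h.trans hi'⟩ ⟨hν, h'.trans hi'⟩

theorem IsCreature.isFront_roots (hS : S.IsCreature) : S.IsFront S.roots := by
  refine hS.isFront_iff.2 ⟨fun _ h => h.1, fun i hi => ?_⟩
  obtain ⟨r, hr, hr'⟩ := hS.exists_root hi
  exact ⟨r, ⟨hr, hr'⟩, fun r' h => hS.root_eq h.1 hr hi h.2 hr'⟩

end PreCreature

namespace PreCreature
variable {X : Type u} [LinearOrder X] {S T R : PreCreature X} {η ν μ x y z γ : Node X} {i : X}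

/-! ### Building creatures -/

/-- Every node lies below a leaf, since second coordinates decrease strictly along the tree. -/
theorem exists_leaf_of_succs_nonempty [WellFoundedLT X]
    (h : ∀ η ∈ S.nodes, η.α < η.β → (S.succs η).Nonempty) (hη : η ∈ S.nodes) :
    ∃ i, Node.pt i ∈ S.nodes ∧ η.TLE (Node.pt i) := by
  induction hb : η.β using WellFoundedLT.induction generalizing η with
  | ind b ih =>
    by_cases h' : η.α < η.β
    · obtain ⟨ν, hν⟩ := h η hη h'
      have ht := tlt_of_mem_succs hν
      obtain ⟨i, hi, hi'⟩ := ih ν.β (hb ▸ ht.β_lt) (mem_of_mem_succs hν) rfl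
      exact ⟨i, hi, ht.tle.trans hi'⟩
    · have := Node.eq_pt (not_lt.1 h')
      exact ⟨η.α, this ▸ hη, this ▸ Node.TLE.refl _⟩

/-- A reduced list of axioms for creatures. The last condition, that the successors of a pair `η`
converge to `β η`, replaces the conditions on leaves and on suprema. -/
theorem isCreature_of [WellFoundedLT X] (hne : S.nodes.Nonempty)
    (htot : ∀ x ∈ S.nodes, ∀ y ∈ S.nodes, x.TLE y ∨ y.TLE x ∨ x.Lex y ∨ y.Lex x)
    (hpt : ∀ i j h, Node.pt i ∈ S.nodes → Node.pair i j h ∉ S.nodes)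
    (hfin : ∀ c ⊆ S.nodes, IsChain Node.TLE c → c.Finite)
    (hconv : ∀ η ∈ S.nodes, η.α < η.β → ∀ z < η.β, {ν | ν ∈ S.succs η ∧ z < ν.α} ∈ S.D η) :
    S.IsCreature := by
  have hsucc : ∀ η ∈ S.nodes, η.α < η.β → S.succs η ∈ S.D η := fun η hη h =>
    Filter.mem_of_superset (hconv η hη h η.α h) fun _ h => h.1
  have hint : ∀ η ∈ S.internal, η ∈ S.nodes ∧ η.α < η.β := by
    rintro η ⟨h, h'⟩
    refine ⟨h, ?_⟩
    have : (S.succs η).Nonempty := by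
      rw [Set.nonempty_iff_ne_empty]
      exact fun e => h' ⟨h, e⟩
    obtain ⟨ν, hν⟩ := this
    exact (tlt_of_mem_succs hν).α_lt_β
  refine ⟨isPlanarTree_of hne htot hpt hfin, hfin, ?_, ?_, ?_, ?_, ?_, ?_, ?_⟩
  · intro η hη ν hν
    obtain ⟨h1, h2⟩ := hint η hη
    obtain ⟨ν', hν', hlt⟩ :=
      Ultrafilter.nonempty_of_mem (hconv η h1 h2 ν.β (tlt_of_mem_succs hν).β_lt)
    exact ⟨ν', hν', fun e => absurd (e ▸ hlt) (not_lt.2 ν'.α_le_β), hlt.le⟩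
  · exact fun η hη => hsucc η (hint η hη).1 (hint η hη).2
  · intro η hη ν hν
    obtain ⟨h1, h2⟩ := hint η hη
    refine Filter.mem_of_superset (hconv η h1 h2 ν.β (tlt_of_mem_succs hν).β_lt) ?_
    rintro ν' ⟨hν', hlt⟩
    exact ⟨hν', fun e => absurd (e ▸ hlt) (not_lt.2 ν'.α_le_β), hlt.le⟩
  · exact fun η hη => ⟨η.α, η.β, (hint η hη).2, Node.eq_pair _⟩
  · intro η hη
    refine ⟨η.α, Node.eq_pt (not_lt.1 fun h => ?_)⟩
    have := Ultrafilter.nonempty_of_mem (hsucc η hη.1 h)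
    rw [hη.2] at this
    exact Set.not_nonempty_empty this
  · rintro η - i hi
    exact (mem_above_nodes.1 hi.1).2.α_le
  · intro η hη
    obtain ⟨h1, h2⟩ := hint η hη
    refine ⟨fun i hi => (mem_above_nodes.1 hi.1).2.β_le, fun b hb => not_lt.1 fun hlt => ?_⟩
    obtain ⟨ν, hν, hν'⟩ := Ultrafilter.nonempty_of_mem (hconv η h1 h2 b hlt)
    obtain ⟨i, hi, hi'⟩ := exists_leaf_of_succs_nonempty
      (fun η hη h => Ultrafilter.nonempty_of_mem (hsucc η hη h)) (mem_of_mem_succs hν)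
    have : i ∈ S.leafSetAbove η := by
      refine ⟨mem_above_nodes.2 ⟨hi, (tlt_of_mem_succs hν).tle.trans hi'⟩, ?_⟩
      exact Set.eq_empty_of_forall_notMem fun μ hμ => Node.not_pt_tlt _ (tlt_of_mem_succs hμ)
    exact absurd (hb this) (not_le.2 (hν'.trans_le hi'.α_le))

theorem IsCreature.pair_notMem (hS : S.IsCreature) (i j : X) (h : i < j)
    (hi : Node.pt i ∈ S.nodes) : Node.pair i j h ∉ S.nodes := fun hj =>
  (hS.not_tle_of_lex hi hj ⟨nofun, le_rfl⟩).2
    (Or.inr (Node.tlt_iff.2 ⟨le_rfl, h⟩))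

theorem IsCreature.converges_to [WellFoundedLT X] (hS : S.IsCreature) (hη : η ∈ S.nodes)
    (h : η.α < η.β) {z : X} (hz : z < η.β) : {ν | ν ∈ S.succs η ∧ z < ν.α} ∈ S.D η := by
  obtain ⟨i, hi, hi', hzi⟩ := hS.exists_leaf_gt hη h hz
  have hne : η ≠ Node.pt i := by
    rintro rfl
    exact lt_irrefl _ h
  obtain ⟨ν, hν, hνi⟩ := hS.exists_succ_tle hη hi (hi'.tlt_of_ne hne)
  refine Filter.mem_of_superset (hS.converges η (hS.mem_internal_iff.2 ⟨hη, h⟩) ν hν) ?_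
  rintro ν' ⟨hν', hl⟩
  exact ⟨hν', hzi.trans_le (hνi.β_le.trans hl.β_le_α)⟩

/-- The part of a creature that consists of the nodes in `N`. -/
def restrict (S : PreCreature X) (N : Set (Node X)) : PreCreature X where
  nodes := {η | η ∈ S.nodes ∧ η ∈ N}
  D := S.D

/-- The sets `N` of nodes which cut out a subcreature: closed downwards, and at each of their
nodes containing almost all successors. -/
structure IsThinning (S : PreCreature X) (N : Set (Node X)) : Prop where
  nonempty : ∃ η ∈ S.nodes, η ∈ N
  down : ∀ x ∈ S.nodes, ∀ ν ∈ S.nodes, ν ∈ N → x.TLE ν → x ∈ N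
  mem : ∀ η ∈ S.nodes, η ∈ N → η.α < η.β → {ν | ν ∈ S.succs η ∧ ν ∈ N} ∈ S.D η

variable {N : Set (Node X)}

theorem IsThinning.succs_restrict (hN : S.IsThinning N) :
    (S.restrict N).succs η = {ν | ν ∈ S.succs η ∧ ν ∈ N} := by
  ext ν
  constructor
  · rintro ⟨⟨h1, h2⟩, ⟨⟨h3, h4⟩, h5⟩, h6⟩
    exact ⟨⟨h1, ⟨h3, h5⟩, fun x hx hxν => h6 x ⟨hx, hN.down x hx ν h1 h2 hxν.tle⟩ hxν⟩, h2⟩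
  · rintro ⟨⟨h1, ⟨h2, h3⟩, h4⟩, h5⟩
    exact ⟨⟨h1, h5⟩, ⟨⟨h2, hN.down η h2 ν h1 h5 h3.tle⟩, h3⟩, fun x hx => h4 x hx.1⟩

theorem IsThinning.roots_restrict (hN : S.IsThinning N) :
    (S.restrict N).roots = {r | r ∈ S.roots ∧ r ∈ N} := by
  ext r
  constructor
  · rintro ⟨⟨h1, h2⟩, h3⟩
    exact ⟨⟨h1, fun x hx hxr => h3 x ⟨hx, hN.down x hx r h1 h2 hxr.tle⟩ hxr⟩, h2⟩
  · rintro ⟨⟨h1, h2⟩, h3⟩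
    exact ⟨⟨h1, h3⟩, fun x hx => h2 x hx.1⟩

theorem IsThinning.isCreature [WellFoundedLT X] (hS : S.IsCreature) (hN : S.IsThinning N) :
    (S.restrict N).IsCreature := by
  refine isCreature_of hN.nonempty (fun x hx y hy => hS.total hx.1 hy.1)
    (fun i j h hi hj => hS.pair_notMem i j h hi.1 hj.1)
    (fun c hc => hS.wellFounded c fun x hx => (hc hx).1) ?_
  rintro η ⟨h1, h2⟩ h3 z hz
  rw [hN.succs_restrict]
  filter_upwards [hN.mem η h1 h2 h3, hS.converges_to h1 h3 hz] with ν hν hν'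
  exact ⟨hν, hν'.2⟩

/-! ### Reformulations of the relations between creatures -/

/-- At the node `η`, the creature `T` is a thinned-out version of `S`. (If `η` is internal in the
creature `T`, then `Succ_T(η) ∈ D^T_η = D^S_η` holds automatically.) -/
def SubAt (T S : PreCreature X) (η : Node X) : Prop := T.succs η ⊆ S.succs η ∧ T.D η = S.D η

/-- At all nodes above `γ`, the creature `T` is a thinned-out version of `S`. -/
def SubAbove (T S : PreCreature X) (γ : Node X) : Prop :=
  ∀ η ∈ T.nodes, γ.TLE η → η ∈ S.nodes ∧ (η.α < η.β → SubAt T S η)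

theorem SubAt.trans (h : SubAt T S η) (h' : SubAt S R η) : SubAt T R η :=
  ⟨h.1.trans h'.1, h.2.trans h'.2⟩

/-- Above `γ`, the nodes of `T` are closed downwards among those of `S`: the last node of `T` below
`x` has a direct successor in `T` towards `ν`, which is also a direct successor in `S`. -/
theorem SubAbove.mem_nodes (hT : T.IsCreature) (hS : S.IsCreature) [WellFoundedLT X]
    (h : SubAbove T S γ) (hγ : γ ∈ T.nodes) (hν : ν ∈ T.nodes) (hx : x ∈ S.nodes) (hγx : γ.TLE x)
    (hxν : x.TLE ν) : x ∈ T.nodes := by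
  obtain ⟨y, hy, hmin⟩ := Set.exists_min_image {y | y ∈ T.nodes ∧ γ.TLE y ∧ y.TLE x} Node.β
    ((hT.below_finite hν).subset fun y hy => ⟨hy.1, hy.2.2.trans hxν⟩)
    ⟨γ, hγ, Node.TLE.refl _, hγx⟩
  obtain ⟨hyT, hγy, hyx⟩ := hy
  rcases hyx with rfl | hyx
  · exact hyT
  exfalso
  obtain ⟨w, hw, hwν⟩ := hT.exists_succ_tle hyT hν (hyx.trans_tle hxν)
  have hyw := tlt_of_mem_succs hw
  have hwS := ((h y hyT hγy).2 hyx.α_lt_β).1 hw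
  have hνS := (h ν hν (hγx.trans hxν)).1
  rcases hS.below_total hx (mem_of_mem_succs hwS) hνS hxν hwν with h1 | h1
  · by_cases e : x = w
    · subst e
      exact absurd (hmin _ ⟨mem_of_mem_succs hw, hγy.trans hyw.tle, Node.TLE.refl _⟩)
        (not_le.2 hyw.β_lt)
    · exact hyx.not_tle (tle_of_mem_succs hwS hx (h1.tlt_of_ne e))
  · exact absurd (hmin _ ⟨mem_of_mem_succs hw, hγy.trans hyw.tle, h1⟩) (not_le.2 hyw.β_lt)

theorem thin_iff (hT : T.IsCreature) (hS : S.IsCreature) :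
    T.Thin S ↔ T.nodes ⊆ S.nodes ∧ S.roots ⊆ T.nodes ∧
      ∀ η ∈ T.nodes, η.α < η.β → SubAt T S η := by
  constructor
  · rintro ⟨h1, h2, h3, h4⟩
    exact ⟨h1, h2, fun η hη h => ⟨(h3 η ⟨hη, hS.mem_internal_iff.2 ⟨h1 hη, h⟩⟩).1,
      h4 η (hT.mem_internal_iff.2 ⟨hη, h⟩)⟩⟩
  · rintro ⟨h1, h2, h3⟩
    refine ⟨h1, h2, fun η hη => ?_, fun η hη => ?_⟩
    · have h := (hS.mem_internal_iff.1 hη.2).2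
      refine ⟨(h3 η hη.1 h).1, ?_⟩
      rw [← (h3 η hη.1 h).2]
      exact hT.succs_mem η (hT.mem_internal_iff.2 ⟨hη.1, h⟩)
    · obtain ⟨h, h'⟩ := hT.mem_internal_iff.1 hη
      exact (h3 η h h').2

theorem IsCreature.mem_internal_above (hS : S.IsCreature) (hγ : γ ∈ S.nodes) :
    η ∈ (S.above {γ}).internal ↔ η ∈ S.nodes ∧ γ.TLE η ∧ η.α < η.β := by
  rw [internal, leaves, Set.mem_sdiff, mem_above_nodes]
  constructor
  · rintro ⟨⟨h1, h2⟩, h3⟩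
    refine ⟨h1, h2, ?_⟩
    by_contra h
    refine h3 ⟨mem_above_nodes.2 ⟨h1, h2⟩, ?_⟩
    rw [hS.succs_above h2 hγ]
    exact (hS.mem_leaves_iff.2 ⟨h1, not_lt.1 h⟩).2
  · rintro ⟨h1, h2, h3⟩
    refine ⟨⟨h1, h2⟩, fun h => ?_⟩
    have h4 := h.2
    rw [hS.succs_above h2 hγ] at h4
    exact absurd (hS.mem_leaves_iff.1 ⟨h1, h4⟩).2 (not_le.2 h3)

theorem le_iff (hT : T.IsCreature) (hS : S.IsCreature) :
    T.LE S ↔ ∃ F, T.IsFront F ∧ F ⊆ S.roots ∧ ∀ γ ∈ F, SubAbove T S γ := by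
  constructor
  · rintro ⟨F, hF, hFS, h⟩
    refine ⟨F, hF, hFS, fun γ hγ η hη hγη => ?_⟩
    obtain ⟨h1, h2, h3, h4⟩ := h γ hγ
    have hηS : η ∈ S.nodes := (h1 (mem_above_nodes.2 ⟨hη, hγη⟩)).1
    refine ⟨hηS, fun hlt => ⟨?_, h4 η ((hT.mem_internal_above (hF.1 hγ)).2 ⟨hη, hγη, hlt⟩)⟩⟩
    have := (h3 η ⟨mem_above_nodes.2 ⟨hη, hγη⟩,
      (hS.mem_internal_above (hFS hγ).1).2 ⟨hηS, hγη, hlt⟩⟩).1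
    rwa [hT.succs_above hγη (hF.1 hγ), hS.succs_above hγη (hFS hγ).1] at this
  · rintro ⟨F, hF, hFS, h⟩
    refine ⟨F, hF, hFS, fun γ hγ => ⟨?_, ?_, ?_, ?_⟩⟩
    · intro η hη
      rw [mem_above_nodes] at hη ⊢
      exact ⟨(h γ hγ η hη.1 hη.2).1, hη.2⟩
    · rintro r ⟨hr, hr'⟩
      have h1 := (mem_above_nodes.1 hr).2
      have h2 : γ = r := h1.resolve_right
        (hr' γ (mem_above_nodes.2 ⟨(hFS hγ).1, Node.TLE.refl _⟩))
      exact mem_above_nodes.2 ⟨h2 ▸ hF.1 hγ, h1⟩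
    · rintro η ⟨hη, hη'⟩
      rw [mem_above_nodes] at hη
      have hlt := ((hS.mem_internal_above (hFS hγ).1).1 hη').2.2
      have h1 := (h γ hγ η hη.1 hη.2).2 hlt
      rw [hT.succs_above hη.2 (hF.1 hγ), hS.succs_above hη.2 (hFS hγ).1]
      refine ⟨h1.1, ?_⟩
      change _ ∈ S.D η
      rw [← h1.2]
      exact hT.succs_mem η (hT.mem_internal_iff.2 ⟨hη.1, hlt⟩)
    · intro η hη
      obtain ⟨h1, h2, h3⟩ := (hT.mem_internal_above (hF.1 hγ)).1 hη
      exact ((h γ hγ η h1 h2).2 h3).2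

/-- If, above each node of a front, `T` is a thinned-out version of a creature `Z ≤ R` with that
node as a root, then `T ≤ R`. -/
theorem le_of_local [WellFoundedLT X] (hT : T.IsCreature) (hR : R.IsCreature) {Φ : Set (Node X)}
    (hΦ : T.IsFront Φ) (h : ∀ γ ∈ Φ, ∃ Z : PreCreature X, Z.IsCreature ∧ γ ∈ Z.roots ∧
      SubAbove T Z γ ∧ Z.LE R) : T.LE R := by
  -- the required front of `T` consists of fronts witnessing `Z γ ≤ R`
  have : Nonempty (PreCreature X) := ⟨T⟩
  choose! Z hZ hγZ hTZ hZR using h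
  have hex : ∀ γ ∈ Φ, ∃ F, (Z γ).IsFront F ∧ F ⊆ R.roots ∧ ∀ x ∈ F, SubAbove (Z γ) R x :=
    fun γ hγ => (le_iff (hZ γ hγ) hR).1 (hZR γ hγ)
  choose! F hF hFR hFs using hex
  refine (le_iff hT hR).2 ⟨{x | x ∈ T.nodes ∧ ∃ γ ∈ Φ, γ.TLE x ∧ x ∈ F γ}, ?_, ?_, ?_⟩
  · refine hT.isFront_iff.2 ⟨fun x hx => hx.1, fun i hi => ?_⟩
    obtain ⟨γ, hγ, hγi⟩ := hΦ.exists_tle hT hi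
    have hiZ := (hTZ γ hγ _ hi hγi).1
    obtain ⟨x, hx, hxi⟩ := (hF γ hγ).exists_tle (hZ γ hγ) hiZ
    have hxZ := (hF γ hγ).1 hx
    have hγx := (hZ γ hγ).root_tle_of_tle (hγZ γ hγ) hxZ hiZ hγi hxi
    refine ⟨x, ⟨⟨(hTZ γ hγ).mem_nodes hT (hZ γ hγ) (hΦ.1 hγ) hi hxZ hγx hxi, γ, hγ, hγx, hx⟩,
      hxi⟩, ?_⟩
    rintro x' ⟨⟨-, γ', hγ', hγx', hx'⟩, hxi'⟩
    obtain rfl := hΦ.eq_of_tle hT hγ hγ' hi hγi (hγx'.trans hxi')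
    exact (hF γ hγ).eq_of_tle (hZ γ hγ) hx' hx hiZ hxi' hxi
  · rintro x ⟨-, γ, hγ, -, hx⟩
    exact hFR γ hγ hx
  · rintro x ⟨-, γ, hγ, hγx, hx⟩ η hη hxη
    obtain ⟨h1, h2⟩ := hTZ γ hγ η hη (hγx.trans hxη)
    obtain ⟨h3, h4⟩ := hFs γ hγ x hx η h1 hxη
    exact ⟨h3, fun hlt => (h2 hlt).trans (h4 hlt)⟩

/-- `T` can be thinned out simultaneously above all nodes `γ` of a front `Φ`, following given
thinned-out versions `Z γ` of creatures `Q γ` which `T` refines above `γ`. Both kinds of thinning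
keep a set of successors which is large for the same ultrafilter. -/
theorem exists_thin_local [WellFoundedLT X] (hT : T.IsCreature) {Φ : Set (Node X)}
    (hΦ : T.IsFront Φ) (Q Z : Node X → PreCreature X)
    (hQ : ∀ γ ∈ Φ, (Q γ).IsCreature) (hZ : ∀ γ ∈ Φ, (Z γ).IsCreature)
    (hTQ : ∀ γ ∈ Φ, SubAbove T (Q γ) γ) (hZQ : ∀ γ ∈ Φ, SubAbove (Z γ) (Q γ) γ)
    (hγZ : ∀ γ ∈ Φ, γ ∈ (Z γ).nodes) :
    ∃ T' : PreCreature X, T'.IsCreature ∧ T'.Thin T ∧ T'.IsFront Φ ∧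
      ∀ γ ∈ Φ, SubAbove T' (Z γ) γ := by
  set N : Set (Node X) := {η | ∀ γ ∈ Φ, γ.TLE η → η ∈ (Z γ).nodes} with hNdef
  have hΦN : ∀ γ ∈ Φ, γ ∈ N := by
    intro γ hγ γ' hγ' h
    obtain rfl := hΦ.eq_of_tle hT hγ hγ' (hΦ.1 hγ) (Node.TLE.refl _) h
    exact hγZ γ hγ
  have hrN : ∀ r ∈ T.roots, r ∈ N := by
    intro r hr γ hγ h
    obtain rfl := h.resolve_right (hr.2 _ (hΦ.1 hγ))
    exact hγZ γ hγ
  have hN : T.IsThinning N := by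
    refine ⟨?_, ?_, ?_⟩
    · obtain ⟨x, hx⟩ := hT.nonempty
      obtain ⟨r, hr, -⟩ := hT.exists_root hx
      exact ⟨r, hr.1, hrN r hr⟩
    · intro x hx ν hν hνN hxν γ hγ hγx
      exact (hZQ γ hγ).mem_nodes (hZ γ hγ) (hQ γ hγ) (hγZ γ hγ) (hνN γ hγ (hγx.trans hxν))
        (hTQ γ hγ x hx hγx).1 hγx hxν
    · intro η hη hηN hlt
      by_cases h : ∃ γ ∈ Φ, γ.TLE η
      · obtain ⟨γ, hγ, hγη⟩ := h
        have h1 := hT.succs_mem η (hT.mem_internal_iff.2 ⟨hη, hlt⟩)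
        have h2 := (hZ γ hγ).succs_mem η
          ((hZ γ hγ).mem_internal_iff.2 ⟨hηN γ hγ hγη, hlt⟩)
        rw [((hZQ γ hγ η (hηN γ hγ hγη) hγη).2 hlt).2, ← ((hTQ γ hγ η hη hγη).2 hlt).2] at h2
        filter_upwards [h1, h2] with ν hν hν'
        refine ⟨hν, fun γ' hγ' h3 => ?_⟩
        obtain rfl := hΦ.eq_of_tle hT hγ hγ' (mem_of_mem_succs hν)
          (hγη.trans (tlt_of_mem_succs hν).tle) h3
        exact mem_of_mem_succs hν'
      · refine Filter.mem_of_superset (hT.succs_mem η (hT.mem_internal_iff.2 ⟨hη, hlt⟩))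
          fun ν hν => ⟨hν, fun γ hγ hγν => ?_⟩
        rcases hγν with rfl | hγν
        · exact hγZ γ hγ
        · exact absurd ⟨γ, hγ, tle_of_mem_succs hν (hΦ.1 hγ) hγν⟩ h
  have hC := hN.isCreature hT
  refine ⟨T.restrict N, hC, ?_, ?_, ?_⟩
  · refine (thin_iff hC hT).2 ⟨fun x hx => hx.1, fun r hr => ⟨hr.1, hrN r hr⟩,
      fun η hη hlt => ⟨?_, rfl⟩⟩
    rw [hN.succs_restrict]
    exact fun ν hν => hν.1
  · refine hC.isFront_iff.2 ⟨fun γ hγ => ⟨hΦ.1 hγ, hΦN γ hγ⟩, fun i hi => ?_⟩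
    exact (hT.isFront_iff.1 hΦ).2 i hi.1
  · rintro γ hγ η ⟨hη, hηN⟩ hγη
    refine ⟨hηN γ hγ hγη, fun hlt => ⟨?_, ?_⟩⟩
    · rw [hN.succs_restrict]
      rintro ν ⟨hν, hνN⟩
      have hγν := hγη.trans (tlt_of_mem_succs hν).tle
      have hνQ := ((hTQ γ hγ η hη hγη).2 hlt).1 hν
      refine ⟨hνN γ hγ hγν, ⟨hηN γ hγ hγη, tlt_of_mem_succs hν⟩, fun x hx hxν => ?_⟩
      rcases (hZ γ hγ).below_total (hγZ γ hγ) hx (hνN γ hγ hγν) hγν hxν.tle with h1 | h1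
      · exact tle_of_mem_succs hνQ (hZQ γ hγ x hx h1).1 hxν
      · exact h1.trans hγη
    · exact ((hTQ γ hγ η hη hγη).2 hlt).2.trans ((hZQ γ hγ η (hηN γ hγ hγη) hγη).2 hlt).2.symm

theorem LE.trans [WellFoundedLT X] (hT : T.IsCreature) (hS : S.IsCreature) (hR : R.IsCreature)
    (h : T.LE S) (h' : S.LE R) : T.LE R := by
  obtain ⟨F, hF, hFS, h⟩ := (le_iff hT hS).1 h
  exact le_of_local hT hR hF fun γ hγ => ⟨S, hS, hFS hγ, h γ hγ, h'⟩

/-- A creature whose roots are roots of `S`, and which is a thinned-out version of `S` at all of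
its nodes, refines `S`. -/
theorem le_of_sub (hT : T.IsCreature) (hS : S.IsCreature) (hr : T.roots ⊆ S.roots)
    (hn : T.nodes ⊆ S.nodes) (h : ∀ η ∈ T.nodes, η.α < η.β → SubAt T S η) : T.LE S :=
  (le_iff hT hS).2 ⟨T.roots, hT.isFront_roots, hr, fun _ _ η hη _ => ⟨hn hη, h η hη⟩⟩

theorem IsThinning.le [WellFoundedLT X] (hS : S.IsCreature) (hN : S.IsThinning N) :
    (S.restrict N).LE S := by
  refine le_of_sub (hN.isCreature hS) hS ?_ (fun _ h => h.1) fun η hη _ => ⟨?_, rfl⟩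
  · rw [hN.roots_restrict]
    exact fun _ h => h.1
  · rw [hN.succs_restrict]
    exact fun _ h => h.1

/-- Restricting a front of `S` to the nodes of `T ≤ S`. -/
theorem IsFront.restrict [WellFoundedLT X] (hT : T.IsCreature) (hS : S.IsCreature) (h : T.LE S)
    {F : Set (Node X)} (hF : S.IsFront F) :
    T.IsFront {x | x ∈ F ∧ x ∈ T.nodes} ∧
      (∀ x ∈ F, x ∈ T.nodes → SubAbove T S x) ∧
      ∀ i, Node.pt i ∈ T.nodes → Node.pt i ∈ S.nodes := by
  obtain ⟨Φ, hΦ, hΦS, hΦs⟩ := (le_iff hT hS).1 h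
  have hpt : ∀ i, Node.pt i ∈ T.nodes → Node.pt i ∈ S.nodes := by
    intro i hi
    obtain ⟨γ, hγ, hγi⟩ := hΦ.exists_tle hT hi
    exact (hΦs γ hγ _ hi hγi).1
  refine ⟨?_, ?_, hpt⟩
  · refine hT.isFront_iff.2 ⟨fun x hx => hx.2, fun i hi => ?_⟩
    have hiS := hpt i hi
    obtain ⟨γ, hγ, hγi⟩ := hΦ.exists_tle hT hi
    obtain ⟨x, hx, hxi⟩ := hF.exists_tle hS hiS
    have hγx := hS.root_tle_of_tle (hΦS hγ) (hF.1 hx) hiS hγi hxi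
    refine ⟨x, ⟨⟨hx, (hΦs γ hγ).mem_nodes hT hS (hΦ.1 hγ) hi (hF.1 hx) hγx hxi⟩, hxi⟩, ?_⟩
    rintro y ⟨hy, hyi⟩
    exact hF.eq_of_tle hS hy.1 hx hiS hyi hxi
  · intro x hx hxT η hη hxη
    obtain ⟨i, hi, hi'⟩ := hT.exists_leaf hη
    obtain ⟨γ, hγ, hγi⟩ := hΦ.exists_tle hT hi
    have hγx := hS.root_tle_of_tle (hΦS hγ) (hF.1 hx) (hpt i hi) hγi (hxη.trans hi')
    exact hΦs γ hγ η hη (hγx.trans hxη)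

/-! ### Weak and strong nodes, gauging fronts -/

/-- The node `η` is a pair, and `f` maps tuples below `β η` to values below `β η`. In a creature,
these are the `f`-strong nodes. -/
def _root_.CreatureClone.Node.IsStrong (f : Operation X) (η : Node X) : Prop :=
  η.α < η.β ∧ ∀ y, (∀ i, y i < η.β) → f.2 y < η.β

variable {f g h : Operation X} {F G : Set (Node X)}

theorem IsCreature.strong_iff (hS : S.IsCreature) :
    S.Strong f η ↔ η ∈ S.nodes ∧ η.IsStrong f := by
  rw [Strong, hS.mem_internal_iff]
  constructor
  · rintro ⟨⟨h1, h2⟩, s, h3, h4⟩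
    rw [hS.isLUB_iff h1 h2] at h3
    subst h3
    exact ⟨h1, h2, h4⟩
  · rintro ⟨h1, h2, h3⟩
    exact ⟨⟨h1, h2⟩, η.β, (hS.isLUB_iff h1 h2).2 rfl, h3⟩

theorem IsCreature.weak_iff (hS : S.IsCreature) [WellFoundedLT X] :
    S.Weak f η ↔ η ∈ S.nodes ∧ (η.α < η.β → ∃ y, (∀ i, Node.pt i ∈ S.nodes →
      η.TLE (Node.pt i) → ∀ j, y j ≤ i) ∧ η.β ≤ f.2 y) := by
  rw [Weak, hS.mem_leaves_iff, hS.mem_internal_iff]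
  constructor
  · rintro (⟨h1, h2⟩ | ⟨⟨h1, h2⟩, m, s, h3, h4, y, h5, h6⟩)
    · exact ⟨h1, fun h => absurd h2 (not_le.2 h)⟩
    · rw [hS.isLUB_iff h1 h2] at h4
      subst h4
      exact ⟨h1, fun _ => ⟨y, fun i hi hi' j =>
        (h5 j).trans (h3.2 ((hS.mem_leafSetAbove_iff h1).2 ⟨hi, hi'⟩)), h6⟩⟩
  · rintro ⟨h1, h2⟩
    by_cases h3 : η.α < η.β
    · right
      obtain ⟨y, h4, h5⟩ := h2 h3
      have hne : (S.leafSetAbove η).Nonempty := by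
        obtain ⟨i, hi, hi'⟩ := hS.exists_leaf h1
        exact ⟨i, (hS.mem_leafSetAbove_iff h1).2 ⟨hi, hi'⟩⟩
      obtain ⟨m, hm⟩ : ∃ m, IsLeast (S.leafSetAbove η) m :=
        ⟨_, wellFounded_lt.min_mem _ hne, fun a ha => wellFounded_lt.min_le ha⟩
      have hm' := (hS.mem_leafSetAbove_iff h1).1 hm.1
      exact ⟨⟨h1, h3⟩, m, η.β, hm, (hS.isLUB_iff h1 h3).2 rfl, y, h4 m hm'.1 hm'.2, h5⟩
    · exact Or.inl ⟨h1, not_lt.1 h3⟩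

theorem IsCreature.not_weak_of_isStrong (hS : S.IsCreature) [WellFoundedLT X]
    (h : η.IsStrong f) : ¬ S.Weak f η := by
  intro hw
  obtain ⟨h1, h2⟩ := hS.weak_iff.1 hw
  obtain ⟨y, h3, h4⟩ := h2 h.1
  obtain ⟨i, hi, hi'⟩ := hS.exists_leaf h1
  refine absurd h4 (not_le.2 (h.2 y fun j => (h3 i hi hi' j).trans_lt ?_))
  refine (hi'.tlt_of_ne ?_).β_lt
  rintro rfl
  exact lt_irrefl _ h.1

theorem IsCreature.weak_of_subAbove (hT : T.IsCreature) (hS : S.IsCreature) [WellFoundedLT X]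
    (hη : η ∈ T.nodes) (h : ∀ i, Node.pt i ∈ T.nodes → Node.pt i ∈ S.nodes) (hw : S.Weak f η) :
    T.Weak f η := by
  obtain ⟨h1, h2⟩ := hS.weak_iff.1 hw
  refine hT.weak_iff.2 ⟨hη, fun hlt => ?_⟩
  obtain ⟨y, h3, h4⟩ := h2 hlt
  exact ⟨y, fun i hi => h3 i (h i hi), h4⟩

theorem Gauges.isStrong (hS : S.IsCreature) (h : S.Gauges F f) (hη : η ∈ F) : η.IsStrong f :=
  (hS.strong_iff.1 (h.2.1 η hη)).2

theorem Gauges.weak (h : S.Gauges F f) (hη : η ∈ F) (hν : ν ∈ S.nodes) (hην : η.TLT ν) :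
    S.Weak f ν := h.2.2 η hη ν hν hην

/-- The front which gauges an operation is unique, since no node is both weak and strong. -/
theorem Gauges.unique [WellFoundedLT X] (hS : S.IsCreature) (h : S.Gauges F f)
    (h' : S.Gauges G f) : F = G := by
  have key : ∀ {F G : Set (Node X)}, S.Gauges F f → S.Gauges G f → F ⊆ G := by
    intro F G h h' η hη
    obtain ⟨i, hi, hi'⟩ := hS.exists_leaf (h.1.1 hη)
    obtain ⟨μ, hμ, hμi⟩ := h'.1.exists_tle hS hi
    rcases hS.below_total (h.1.1 hη) (h'.1.1 hμ) hi hi' hμi with h1 | h1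
    · rcases h1 with rfl | h1
      · exact hμ
      · exact absurd (h.weak hη (h'.1.1 hμ) h1)
          (hS.not_weak_of_isStrong (h'.isStrong hS hμ))
    · rcases h1 with rfl | h1
      · exact hμ
      · exact absurd (h'.weak hμ (h.1.1 hη) h1)
          (hS.not_weak_of_isStrong (h.isStrong hS hη))
  exact (key h h').antisymm (key h' h)

/-- Gauging fronts are inherited by smaller creatures: being strong only depends on the node, and
weak nodes remain weak because `min[ν]` can only increase while `sup[ν]` does not change. -/
theorem Gauges.restrict [WellFoundedLT X] (hT : T.IsCreature) (hS : S.IsCreature) (h : T.LE S)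
    (hF : S.Gauges F f) : T.Gauges {x | x ∈ F ∧ x ∈ T.nodes} f := by
  obtain ⟨h1, h2, h3⟩ := hF.1.restrict hT hS h
  refine ⟨h1, fun η hη => hT.strong_iff.2 ⟨hη.2, hF.isStrong hS hη.1⟩, ?_⟩
  rintro η ⟨hη, hηT⟩ ν hν hην
  exact hT.weak_of_subAbove hS hν h3 (hF.weak hη (h2 η hη hηT ν hν hην.tle).1 hην)

/-- If the members of the fronts gauging `f` and `g` in `S` are related by `r` below each leaf of
`T ≤ S`, then the same holds for the fronts gauging `f` and `g` in `T`. -/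
theorem restrict_rel [WellFoundedLT X] {r : Node X → Node X → Prop} (hT : T.IsCreature)
    (hS : S.IsCreature) (h : T.LE S) (hF : S.Gauges F f) (hG : S.Gauges G g)
    (hr : ∀ i, Node.pt i ∈ T.nodes →
      ∃ η ∈ F, ∃ μ ∈ G, η.TLE (Node.pt i) ∧ μ.TLE (Node.pt i) ∧ r μ η) :
    ∃ F G, T.Gauges F f ∧ T.Gauges G g ∧
      ∀ ν ∈ T.leaves, ∃ η ∈ F, ∃ μ ∈ G, η.TLE ν ∧ μ.TLE ν ∧ r μ η := by
  have hF' := hF.restrict hT hS h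
  have hG' := hG.restrict hT hS h
  refine ⟨_, _, hF', hG', fun ν hν => ?_⟩
  obtain ⟨i, rfl⟩ := hT.leaf_pt ν hν
  have hi := (hT.mem_leaves_iff.1 hν).1
  have hiS := (hF.1.restrict hT hS h).2.2 i hi
  obtain ⟨η, hη, μ, hμ, h1, h2, h3⟩ := hr i hi
  obtain ⟨η', hη', h4⟩ := hF'.1.exists_tle hT hi
  obtain ⟨μ', hμ', h5⟩ := hG'.1.exists_tle hT hi
  obtain rfl := hF.1.eq_of_tle hS hη hη'.1 hiS h1 h4
  obtain rfl := hG.1.eq_of_tle hS hμ hμ'.1 hiS h2 h5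
  exact ⟨η, hη', μ, hμ', h1, h2, h3⟩

theorem Lt.restrict [WellFoundedLT X] (hT : T.IsCreature) (hS : S.IsCreature) (h : T.LE S)
    (hS' : S.Lt f g) : T.Lt f g := by
  obtain ⟨F, G, hF, hG, hr⟩ := hS'
  exact restrict_rel (r := fun μ η => μ.TLT η) hT hS h hF hG fun i hi =>
    hr _ (hS.mem_leaves_iff.2 ⟨(hF.1.restrict hT hS h).2.2 i hi, le_rfl⟩)

theorem Sim.restrict [WellFoundedLT X] (hT : T.IsCreature) (hS : S.IsCreature) (h : T.LE S)
    (hS' : S.Sim f g) : T.Sim f g := by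
  obtain ⟨F, G, hF, hG, hr⟩ := hS'
  exact restrict_rel (r := fun μ η => η = μ) hT hS h hF hG fun i hi =>
    hr _ (hS.mem_leaves_iff.2 ⟨(hF.1.restrict hT hS h).2.2 i hi, le_rfl⟩)

/-- The relation between two gauging fronts does not depend on the choice of witnesses. -/
theorem rel_of_gauges [WellFoundedLT X] {r : Node X → Node X → Prop} (hS : S.IsCreature)
    (hF : S.Gauges F f) (hG : S.Gauges G g)
    (h : ∃ F G, S.Gauges F f ∧ S.Gauges G g ∧
      ∀ ν ∈ S.leaves, ∃ η ∈ F, ∃ μ ∈ G, η.TLE ν ∧ μ.TLE ν ∧ r μ η)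
    {η μ : Node X} (hi : Node.pt i ∈ S.nodes) (hη : η ∈ F) (hμ : μ ∈ G) (hηi : η.TLE (Node.pt i))
    (hμi : μ.TLE (Node.pt i)) : r μ η := by
  obtain ⟨F', G', hF', hG', h⟩ := h
  obtain rfl := hF.unique hS hF'
  obtain rfl := hG.unique hS hG'
  obtain ⟨η', hη', μ', hμ', h1, h2, h3⟩ := h _ (hS.mem_leaves_iff.2 ⟨hi, le_rfl⟩)
  obtain rfl := hF.1.eq_of_tle hS hη hη' hi hηi h1
  obtain rfl := hG.1.eq_of_tle hS hμ hμ' hi hμi h2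
  exact h3

theorem Lt.tlt [WellFoundedLT X] (hS : S.IsCreature) (hF : S.Gauges F f) (hG : S.Gauges G g)
    (h : S.Lt f g) {η μ : Node X} (hi : Node.pt i ∈ S.nodes) (hη : η ∈ F) (hμ : μ ∈ G)
    (hηi : η.TLE (Node.pt i)) (hμi : μ.TLE (Node.pt i)) : μ.TLT η :=
  rel_of_gauges (r := fun μ η => μ.TLT η) hS hF hG h hi hη hμ hηi hμi

theorem Sim.eq [WellFoundedLT X] (hS : S.IsCreature) (hF : S.Gauges F f) (hG : S.Gauges G g)
    (h : S.Sim f g) {η μ : Node X} (hi : Node.pt i ∈ S.nodes) (hη : η ∈ F) (hμ : μ ∈ G)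
    (hηi : η.TLE (Node.pt i)) (hμi : μ.TLE (Node.pt i)) : η = μ :=
  rel_of_gauges (r := fun μ η => η = μ) hS hF hG h hi hη hμ hηi hμi

theorem IsCreature.exists_pt [WellFoundedLT X] (hS : S.IsCreature) : ∃ i, Node.pt i ∈ S.nodes := by
  obtain ⟨x, hx⟩ := hS.nonempty
  obtain ⟨i, hi, -⟩ := hS.exists_leaf hx
  exact ⟨i, hi⟩

theorem Lt.exists_data [WellFoundedLT X] (hS : S.IsCreature) (h : S.Lt f g) :
    ∃ F G, S.Gauges F f ∧ S.Gauges G g ∧ ∀ i, Node.pt i ∈ S.nodes → ∃ η ∈ F, ∃ μ ∈ G,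
      η.TLE (Node.pt i) ∧ μ.TLE (Node.pt i) ∧ μ.TLT η := by
  obtain ⟨F, G, hF, hG, h⟩ := h
  exact ⟨F, G, hF, hG, fun i hi => h _ (hS.mem_leaves_iff.2 ⟨hi, le_rfl⟩)⟩

theorem Sim.exists_data [WellFoundedLT X] (hS : S.IsCreature) (h : S.Sim f g) :
    ∃ F, S.Gauges F f ∧ S.Gauges F g := by
  have h0 := h
  obtain ⟨F, G, hF, hG, -⟩ := h
  refine ⟨F, hF, ?_⟩
  suffices F = G by rwa [this]
  have key : ∀ i, Node.pt i ∈ S.nodes → ∀ η ∈ F, ∀ μ ∈ G, η.TLE (Node.pt i) →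
    μ.TLE (Node.pt i) → η = μ := fun i hi η hη μ hμ h1 h2 => h0.eq hS hF hG hi hη hμ h1 h2
  refine Set.Subset.antisymm (fun η hη => ?_) fun μ hμ => ?_
  · obtain ⟨i, hi, hi'⟩ := hS.exists_leaf (hF.1.1 hη)
    obtain ⟨μ, hμ, hμi⟩ := hG.1.exists_tle hS hi
    exact key i hi η hη μ hμ hi' hμi ▸ hμ
  · obtain ⟨i, hi, hi'⟩ := hS.exists_leaf (hG.1.1 hμ)
    obtain ⟨η, hη, hηi⟩ := hF.1.exists_tle hS hi
    exact key i hi η hη μ hμ hηi hi' ▸ hη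

theorem sim_of_gauges (hS : S.IsCreature) (hF : S.Gauges F f) (hG : S.Gauges F g) :
    S.Sim f g := by
  refine ⟨F, F, hF, hG, fun ν hν => ?_⟩
  obtain ⟨i, rfl⟩ := hS.leaf_pt ν hν
  obtain ⟨η, hη, h⟩ := hF.1.exists_tle hS hν.1
  exact ⟨η, hη, η, hη, h, h, rfl⟩

theorem Sim.symm [WellFoundedLT X] (hS : S.IsCreature) (h : S.Sim f g) : S.Sim g f := by
  obtain ⟨F, hF, hG⟩ := h.exists_data hS
  exact sim_of_gauges hS hG hF

theorem Lt.not_sim [WellFoundedLT X] (hS : S.IsCreature) (h : S.Lt f g) : ¬ S.Sim f g := by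
  intro h'
  obtain ⟨F, G, hF, hG, h1⟩ := h.exists_data hS
  obtain ⟨i, hi⟩ := hS.exists_pt
  obtain ⟨η, hη, μ, hμ, h2, h3, h4⟩ := h1 i hi
  exact h4.1 (h'.eq hS hF hG hi hη hμ h2 h3).symm

theorem Lt.asymm [WellFoundedLT X] (hS : S.IsCreature) (h : S.Lt f g) : ¬ S.Lt g f := by
  intro h'
  obtain ⟨F, G, hF, hG, h1⟩ := h.exists_data hS
  obtain ⟨i, hi⟩ := hS.exists_pt
  obtain ⟨η, hη, μ, hμ, h2, h3, h4⟩ := h1 i hi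
  exact h4.not_tle (h'.tlt hS hG hF hi hμ hη h3 h2).tle

theorem Lt.trans [WellFoundedLT X] (hS : S.IsCreature) (hfg : S.Lt f g) (hgh : S.Lt g h) :
    S.Lt f h := by
  obtain ⟨F, G, hF, hG, h1⟩ := hfg.exists_data hS
  obtain ⟨G', H, hG', hH, h2⟩ := hgh.exists_data hS
  refine ⟨F, H, hF, hH, fun ν hν => ?_⟩
  obtain ⟨i, rfl⟩ := hS.leaf_pt ν hν
  obtain ⟨η, hη, μ, hμ, h3, h4, h5⟩ := h1 i hν.1
  obtain ⟨μ', hμ', ρ, hρ, h6, h7, h8⟩ := h2 i hν.1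
  obtain rfl := hG.unique hS hG'
  obtain rfl := hG.1.eq_of_tle hS hμ hμ' hν.1 h4 h6
  exact ⟨η, hη, ρ, hρ, h3, h7, h8.tle.trans_tlt h5⟩

theorem Sim.trans_lt [WellFoundedLT X] (hS : S.IsCreature) (hfg : S.Sim f g) (hgh : S.Lt g h) :
    S.Lt f h := by
  obtain ⟨F, hF, hG⟩ := hfg.exists_data hS
  obtain ⟨G, H, hG', hH, h1⟩ := hgh
  obtain rfl := hG.unique hS hG'
  exact ⟨F, H, hF, hH, h1⟩

theorem Lt.trans_sim [WellFoundedLT X] (hS : S.IsCreature) (hfg : S.Lt f g) (hgh : S.Sim g h) :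
    S.Lt f h := by
  obtain ⟨F, hF, hG⟩ := hgh.exists_data hS
  obtain ⟨G, H, hG', hH, h1⟩ := hfg
  obtain rfl := hF.unique hS hH
  exact ⟨G, F, hG', hG, h1⟩

/-- All nodes on or below the front which gauges `f` are `f`-strong: the suprema of the members of
the front are cofinal in the supremum of such a node. -/
theorem Gauges.isStrong_of_tle [WellFoundedLT X] (hS : S.IsCreature) (hF : S.Gauges F f)
    (hμ : μ ∈ S.nodes) (hη : η ∈ F) (h : μ.TLE η) : μ.IsStrong f := by
  rcases h with rfl | h
  · exact hF.isStrong hS hη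
  refine ⟨h.α_lt_β, fun y hy => ?_⟩
  obtain ⟨z, hz, hyz⟩ : ∃ z < μ.β, ∀ i, y i ≤ z := by
    obtain ⟨i, hi⟩ := Finite.exists_max y
    exact ⟨y i, hy i, hi⟩
  obtain ⟨i, hi, hμi, hzi⟩ := hS.exists_leaf_gt hμ h.α_lt_β hz
  obtain ⟨η', hη', hηi⟩ := hF.1.exists_tle hS hi
  have hs := hF.isStrong hS hη'
  have hμη : μ.TLE η' := by
    rcases hS.below_total hμ (hF.1.1 hη') hi hμi hηi with h1 | h1
    · exact h1
    · rw [hF.1.eq_of_tle hS hη hη' (hF.1.1 hη) (Node.TLE.refl _) (h1.trans h.tle)] at h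
      exact absurd h1 h.not_tle
  exact (hs.2 y fun j => (hyz j).trans_lt (hzi.trans_le hηi.β_le)).trans_le hμη.β_le

/-- If `f` is at most `g`, then the front gauging `g` lies on or below the one gauging `f`, so that
its members are `f`-strong. -/
theorem Lt.isStrong_left [WellFoundedLT X] (hS : S.IsCreature) (hG : S.Gauges G g)
    (h : S.Lt f g ∨ S.Sim f g) (hμ : μ ∈ G) : μ.IsStrong f := by
  obtain ⟨i, hi, hi'⟩ := hS.exists_leaf (hG.1.1 hμ)
  rcases h with h | h
  · obtain ⟨F, G', hF, hG', h1⟩ := h.exists_data hS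
    obtain rfl := hG.unique hS hG'
    obtain ⟨η, hη, μ', hμ', h2, h3, h4⟩ := h1 i hi
    obtain rfl := hG.1.eq_of_tle hS hμ hμ' hi hi' h3
    exact hF.isStrong_of_tle hS (hG.1.1 hμ) hη h4.tle
  · obtain ⟨F, hF, hG'⟩ := h.exists_data hS
    obtain rfl := hG.unique hS hG'
    exact hF.isStrong hS hμ

end PreCreature

/-! ### Large creatures and the relations modulo initial parts -/

/-- What is needed from a regular uncountable cardinal, considered as a linear order. -/
structure IsRegularOrder (X : Type u) [LinearOrder X] : Prop where
  uncountable : ℵ₀ < #X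
  mk_Iic_lt : ∀ x : X, #(Set.Iic x) < #X
  exists_gt : ∀ s : Set X, #s < #X → ∃ b, ∀ x ∈ s, x < b

namespace IsRegularOrder
variable {X : Type u} [LinearOrder X]

theorem nonempty (hX : IsRegularOrder X) : Nonempty X :=
  mk_ne_zero_iff.1 (pos_of_gt hX.uncountable).ne'

theorem exists_gt_range (hX : IsRegularOrder X) {ι : Type u} (f : ι → X) (h : #ι < #X) :
    ∃ b, ∀ i, f i < b := by
  obtain ⟨b, hb⟩ := hX.exists_gt (Set.range f) (mk_range_le.trans_lt h)
  exact ⟨b, fun i => hb _ ⟨i, rfl⟩⟩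

theorem exists_gt_finite (hX : IsRegularOrder X) {s : Set X} (h : s.Finite) :
    ∃ b, ∀ x ∈ s, x < b :=
  hX.exists_gt s ((lt_aleph0_iff_set_finite.2 h).trans hX.uncountable)

theorem exists_gt' (hX : IsRegularOrder X) (x : X) : ∃ b, x < b := by
  obtain ⟨b, hb⟩ := hX.exists_gt_finite (Set.finite_singleton x)
  exact ⟨b, hb x rfl⟩

theorem mk_eq_iff (hX : IsRegularOrder X) {s : Set X} :
    #s = #X ↔ ∀ x, ∃ y ∈ s, x ≤ y := by
  constructor
  · intro h x
    by_contra! hn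
    have : s ⊆ Set.Iic x := fun y hy => (hn y hy).le
    exact absurd ((mk_le_mk_of_subset this).trans_lt (hX.mk_Iic_lt x))
      (by rw [h]; exact lt_irrefl _)
  · intro h
    refine le_antisymm (mk_set_le s) (not_lt.1 fun hlt => ?_)
    obtain ⟨b, hb⟩ := hX.exists_gt s hlt
    obtain ⟨y, hy, hby⟩ := h b
    exact absurd (hb y hy) (not_lt.2 hby)

end IsRegularOrder

namespace PreCreature
variable {X : Type u} [LinearOrder X] {S T R : PreCreature X} {η ν μ x y z γ : Node X} {i : X}

theorem IsCreature.isLarge_iff (hX : IsRegularOrder X) (hS : S.IsCreature) :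
    S.IsLarge ↔ ∀ x, ∃ r ∈ S.roots, x ≤ r.α := by
  rw [IsLarge, ← mk_image_eq_of_injOn _ _ hS.α_injOn_roots, hX.mk_eq_iff]
  simp

/-- A root lying strictly to the right of `x`. -/
theorem IsCreature.exists_root_gt (hX : IsRegularOrder X) (hS : S.IsCreature) (hL : S.IsLarge)
    (x : X) : ∃ r ∈ S.roots, x < r.α := by
  obtain ⟨b, hb⟩ := hX.exists_gt' x
  obtain ⟨r, hr, h⟩ := (hS.isLarge_iff hX).1 hL b
  exact ⟨r, hr, hb.trans_le h⟩

/-- `T` is a thinned-out version of the part of `S` to the right of some root. -/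
def SubRight (T S : PreCreature X) : Prop :=
  T.nodes ⊆ S.nodes ∧ (∃ γ ∈ S.roots, T.roots = {r | r ∈ S.roots ∧ γ.Lex r}) ∧
    ∀ η ∈ T.nodes, η.α < η.β → SubAt T S η

theorem SubRight.le (hT : T.IsCreature) (hS : S.IsCreature) (h : T.SubRight S) : T.LE S := by
  obtain ⟨h1, ⟨γ, hγ, h2⟩, h3⟩ := h
  exact le_of_sub hT hS (h2 ▸ fun _ h => h.1) h1 h3

theorem SubRight.trans (h : T.SubRight S)
    (h' : S.SubRight R) : T.SubRight R := by
  obtain ⟨h1, ⟨γ, hγ, h2⟩, h3⟩ := h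
  obtain ⟨h4, ⟨δ, hδ, h5⟩, h6⟩ := h'
  refine ⟨h1.trans h4, ⟨γ, ?_, ?_⟩, fun η hη hlt => (h3 η hη hlt).trans (h6 η (h1 hη) hlt)⟩
  · rw [h5] at hγ
    exact hγ.1
  · rw [h2, h5]
    rw [h5] at hγ
    ext r
    exact ⟨fun h => ⟨h.1.1, h.2⟩, fun h => ⟨⟨h.1, hγ.2.trans h.2⟩, h.2⟩⟩

theorem Thin.roots_eq (hT : T.IsCreature) (hS : S.IsCreature) (h : T.Thin S) :
    T.roots = S.roots := by
  obtain ⟨h1, h2, h3⟩ := (thin_iff hT hS).1 h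
  have key : S.roots ⊆ T.roots := fun r hr => ⟨h2 hr, fun x hx => hr.2 x (h1 hx)⟩
  refine Set.Subset.antisymm (fun r hr => ?_) key
  obtain ⟨s, hs, hsr⟩ := hS.exists_root (h1 hr.1)
  obtain rfl := hsr.resolve_right (hr.2 _ (h2 hs))
  exact hs

theorem SubRight.isLarge (hX : IsRegularOrder X) (hT : T.IsCreature) (hS : S.IsCreature)
    (hL : S.IsLarge) (h : T.SubRight S) : T.IsLarge := by
  obtain ⟨h1, ⟨γ, hγ, h2⟩, h3⟩ := h
  rw [hT.isLarge_iff hX, h2]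
  intro x
  obtain ⟨r, hr, h⟩ := hS.exists_root_gt hX hL (max x γ.α)
  exact ⟨r, ⟨hr, hS.roots_lex_of_α_lt hγ hr ((le_max_right _ _).trans_lt h)⟩,
    ((le_max_left _ _).trans_lt h).le⟩

theorem Short.subRight (hT : T.IsCreature) (hS : S.IsCreature) (h : T.Short S) :
    T.SubRight S := by
  obtain ⟨γ, hγ, h1, h2⟩ := h
  have hn : ∀ η, η ∈ T.nodes ↔ η ∈ S.nodes ∧ ∃ r, (r ∈ S.roots ∧ γ.Lex r) ∧ r.TLE η := by
    intro η
    rw [h1]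
    rfl
  refine ⟨fun η hη => ((hn η).1 hη).1, ⟨γ, hγ, ?_⟩, fun η hη hlt => ⟨?_, ?_⟩⟩
  · ext r
    constructor
    · rintro ⟨hr, hr'⟩
      obtain ⟨h3, s, hs, hsr⟩ := (hn r).1 hr
      obtain rfl := hsr.resolve_right (hr' s ((hn s).2 ⟨hs.1.1, s, hs, Node.TLE.refl _⟩))
      exact hs
    · rintro ⟨hr, hr'⟩
      exact ⟨(hn r).2 ⟨hr.1, r, ⟨hr, hr'⟩, Node.TLE.refl _⟩, fun x hx =>
        hr.2 x ((hn x).1 hx).1⟩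
  · rintro ν hν
    obtain ⟨h3, s, hs, hsη⟩ := (hn η).1 hη
    refine ⟨((hn ν).1 (mem_of_mem_succs hν)).1, ⟨h3, tlt_of_mem_succs hν⟩, fun x hx hxν => ?_⟩
    have hνS := ((hn ν).1 (mem_of_mem_succs hν)).1
    have hsx := hS.root_tle_of_tle hs.1 hx hνS (hsη.trans (tlt_of_mem_succs hν).tle) hxν.tle
    exact tle_of_mem_succs hν ((hn x).2 ⟨hx, s, hs, hsx⟩) hxν
  · exact h2 η (hT.mem_internal_iff.2 ⟨hη, hlt⟩)

theorem Thin.subRight_of_short {T' : PreCreature X} (hT : T.IsCreature) (hT' : T'.IsCreature)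
    (hS : S.IsCreature) (h : T.Short T') (h' : T'.Thin S) : T.SubRight S := by
  obtain ⟨h1, ⟨γ, hγ, h2⟩, h3⟩ := h.subRight hT hT'
  obtain ⟨h4, h5, h6⟩ := (thin_iff hT' hS).1 h'
  rw [h'.roots_eq hT' hS] at hγ h2
  exact ⟨h1.trans h4, ⟨γ, hγ, h2⟩, fun η hη hlt => (h3 η hη hlt).trans (h6 η (h1 hη) hlt)⟩

/-- A creature which is a subset of `S` with roots among those of `S` is closed downwards. -/
theorem IsCreature.mem_of_tle [WellFoundedLT X] (hT : T.IsCreature) (hS : S.IsCreature)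
    (h1 : T.nodes ⊆ S.nodes) (h2 : T.roots ⊆ S.roots)
    (h3 : ∀ η ∈ T.nodes, η.α < η.β → SubAt T S η) (hν : ν ∈ T.nodes) (hx : x ∈ S.nodes)
    (h : x.TLE ν) : x ∈ T.nodes := by
  obtain ⟨r, hr, hrν⟩ := hT.exists_root hν
  have hrx := hS.root_tle_of_tle (h2 hr) hx (h1 hν) hrν h
  exact SubAbove.mem_nodes hT hS (fun η hη _ => ⟨h1 hη, h3 η hη⟩) hr.1 hν hx hrx h

/-- A thinned-out right part of `S` is a final part of a thinned-out version of `S`, obtained by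
adding the omitted trees of `S` again. -/
theorem SubRight.exists_thin [WellFoundedLT X] (hT : T.IsCreature)
    (hS : S.IsCreature) (hL : S.IsLarge) (h : T.SubRight S) :
    ∃ T' : PreCreature X, (T'.IsCreature ∧ T'.IsLarge) ∧ T.Short T' ∧ T'.Thin S := by
  obtain ⟨h1, ⟨γ, hγ, h2⟩, h3⟩ := h
  have hdown : ∀ x ∈ S.nodes, ∀ ν ∈ T.nodes, x.TLE ν → x ∈ T.nodes := fun x hx ν hν h =>
    hT.mem_of_tle hS h1 (h2 ▸ fun _ h => h.1) h3 hν hx h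
  have hlex : ∀ x ∈ T.nodes, γ.Lex x := by
    intro x hx
    obtain ⟨r, hr, hrx⟩ := hT.exists_root hx
    have hr' := hr
    rw [h2] at hr'
    exact (hS.root_lex_iff hγ hr'.1.1 (h1 hx) hrx).2 hr'.2
  set N : Set (Node X) := {η | η ∈ T.nodes ∨ ¬ γ.Lex η} with hNdef
  have hN : S.IsThinning N := by
    refine ⟨⟨γ, hγ.1, Or.inr (Node.Lex.irrefl _)⟩, ?_, ?_⟩
    · rintro x hx ν hν (h | h) hxν
      · exact Or.inl (hdown x hx ν h hxν)
      · exact Or.inr fun hl => h ((hS.root_lex_iff hγ hx hν hxν).2 hl)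
    · rintro η hη (h | h) hlt
      · have := hT.succs_mem η (hT.mem_internal_iff.2 ⟨h, hlt⟩)
        rw [(h3 η h hlt).2] at this
        exact Filter.mem_of_superset this fun ν hν =>
          ⟨(h3 η h hlt).1 hν, Or.inl (mem_of_mem_succs hν)⟩
      · refine Filter.mem_of_superset (hS.succs_mem η (hS.mem_internal_iff.2 ⟨hη, hlt⟩))
          fun ν hν => ⟨hν, Or.inr fun hl => h ?_⟩
        exact (hS.root_lex_iff hγ hη (mem_of_mem_succs hν) (tlt_of_mem_succs hν).tle).1 hl
  have hC := hN.isCreature hS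
  have hroots : (S.restrict N).roots = S.roots := by
    rw [hN.roots_restrict]
    refine Set.Subset.antisymm (fun _ h => h.1) fun r hr => ⟨hr, ?_⟩
    by_cases h : γ.Lex r
    · have : r ∈ T.roots := h2 ▸ ⟨hr, h⟩
      exact Or.inl this.1
    · exact Or.inr h
  have hthin : (S.restrict N).Thin S := by
    refine (thin_iff hC hS).2 ⟨fun _ h => h.1, fun r hr => (hroots ▸ hr).1, fun η hη _ => ⟨?_, rfl⟩⟩
    rw [hN.succs_restrict]
    exact fun _ h => h.1
  refine ⟨S.restrict N, ⟨hC, ?_⟩, ⟨γ, hroots ▸ hγ, ?_, ?_⟩, hthin⟩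
  · rw [IsLarge, hroots]
    exact hL
  · ext η
    constructor
    · intro hη
      obtain ⟨r, hr, hrη⟩ := hT.exists_root hη
      rw [h2] at hr
      exact ⟨⟨h1 hη, Or.inl hη⟩, r, ⟨hroots ▸ hr.1, hr.2⟩, hrη⟩
    · rintro ⟨⟨hη, hηN⟩, r, ⟨hr, hγr⟩, hrη⟩
      rw [hroots] at hr
      exact hηN.resolve_right fun h => h ((hS.root_lex_iff hγ hr.1 hη hrη).2 hγr)
  · intro η hη
    obtain ⟨h4, h5⟩ := hT.mem_internal_iff.1 hη
    exact (h3 η h4 h5).2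

/-- Restricting a large creature to the right of a root. -/
theorem IsThinning.subRight [WellFoundedLT X] {N : Set (Node X)} (hN : S.IsThinning N)
    (hγ : γ ∈ S.roots) (h : ∀ r ∈ S.roots, r ∈ N ↔ γ.Lex r) : (S.restrict N).SubRight S := by
  refine ⟨fun _ h => h.1, ⟨γ, hγ, ?_⟩, fun η hη _ => ⟨?_, rfl⟩⟩
  · rw [hN.roots_restrict]
    ext r
    exact and_congr_right fun hr => h r hr
  · rw [hN.succs_restrict]
    exact fun _ h => h.1

theorem IsCreature.isThinning_right [WellFoundedLT X] (hX : IsRegularOrder X)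
    (hS : S.IsCreature) (hL : S.IsLarge) (hγ : γ ∈ S.roots) : S.IsThinning {η | γ.Lex η} := by
  refine ⟨?_, fun x hx ν hν hl hxν => (hS.root_lex_iff hγ hx hν hxν).1 hl, fun η hη hl hlt => ?_⟩
  · obtain ⟨r, hr, h⟩ := hS.exists_root_gt hX hL γ.α
    exact ⟨r, hr.1, hS.roots_lex_of_α_lt hγ hr h⟩
  · exact Filter.mem_of_superset (hS.succs_mem η (hS.mem_internal_iff.2 ⟨hη, hlt⟩)) fun ν hν =>
      ⟨hν, (hS.root_lex_iff hγ hη (mem_of_mem_succs hν) (tlt_of_mem_succs hν).tle).2 hl⟩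

theorem exists_subRight [WellFoundedLT X] (hX : IsRegularOrder X) (hS : S.IsCreature)
    (hL : S.IsLarge) (x : X) : ∃ T : PreCreature X, (T.IsCreature ∧ T.IsLarge) ∧ T.SubRight S ∧
      (∀ η ∈ T.nodes, x < η.α) ∧ T.D = S.D := by
  obtain ⟨γ, hγ, hx⟩ := hS.exists_root_gt hX hL x
  have hN := hS.isThinning_right hX hL hγ
  have hC := hN.isCreature hS
  have hs := hN.subRight hγ fun r _ => Iff.rfl
  exact ⟨_, ⟨hC, hs.isLarge hX hC hS hL⟩, hs, fun η hη =>
    hx.trans_le (γ.α_le_β.trans hη.2.β_le_α), rfl⟩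

/-- Two thinned-out right parts of a large creature have a common one. -/
theorem SubRight.inter [WellFoundedLT X] (hX : IsRegularOrder X) {T₁ T₂ : PreCreature X}
    (h₁ : T₁.IsCreature) (h₂ : T₂.IsCreature) (hS : S.IsCreature) (hL : S.IsLarge)
    (h : T₁.SubRight S) (h' : T₂.SubRight S) :
    ∃ R : PreCreature X, (R.IsCreature ∧ R.IsLarge) ∧ R.SubRight T₁ ∧ R.SubRight T₂ := by
  obtain ⟨a1, ⟨γ₁, hγ₁, a2⟩, a3⟩ := h
  obtain ⟨b1, ⟨γ₂, hγ₂, b2⟩, b3⟩ := h'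
  obtain ⟨γ, hγ, hlt⟩ := hS.exists_root_gt hX hL (max γ₁.α γ₂.α)
  have l1 := hS.roots_lex_of_α_lt hγ₁ hγ ((le_max_left _ _).trans_lt hlt)
  have l2 := hS.roots_lex_of_α_lt hγ₂ hγ ((le_max_right _ _).trans_lt hlt)
  have hr1 : T₁.roots ⊆ S.roots := a2 ▸ fun _ h => h.1
  have hr2 : T₂.roots ⊆ S.roots := b2 ▸ fun _ h => h.1
  set N : Set (Node X) := {η | (η ∈ T₁.nodes ∧ η ∈ T₂.nodes) ∧ γ.Lex η} with hNdef
  have hrN : ∀ r ∈ S.roots, r ∈ N ↔ γ.Lex r := by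
    intro r hr
    refine ⟨fun h => h.2, fun h => ⟨⟨?_, ?_⟩, h⟩⟩
    · have : r ∈ T₁.roots := a2 ▸ ⟨hr, l1.trans h⟩
      exact this.1
    · have : r ∈ T₂.roots := b2 ▸ ⟨hr, l2.trans h⟩
      exact this.1
  have hγN := hS.isThinning_right hX hL hγ
  have hN : S.IsThinning N := by
    refine ⟨?_, fun x hx ν hν hl hxν => ⟨⟨?_, ?_⟩, hγN.down x hx ν hν hl.2 hxν⟩,
      fun η hη hl hlt => ?_⟩
    · obtain ⟨r, hr, h⟩ := hS.exists_root_gt hX hL γ.α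
      exact ⟨r, hr.1, (hrN r hr).2 (hS.roots_lex_of_α_lt hγ hr h)⟩
    · exact h₁.mem_of_tle hS a1 hr1 a3 hl.1.1 hx hxν
    · exact h₂.mem_of_tle hS b1 hr2 b3 hl.1.2 hx hxν
    · have m1 := h₁.succs_mem η (h₁.mem_internal_iff.2 ⟨hl.1.1, hlt⟩)
      have m2 := h₂.succs_mem η (h₂.mem_internal_iff.2 ⟨hl.1.2, hlt⟩)
      rw [(a3 η hl.1.1 hlt).2] at m1
      rw [(b3 η hl.1.2 hlt).2] at m2
      filter_upwards [m1, m2, hγN.mem η hη hl.2 hlt] with ν n1 n2 n3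
      exact ⟨n3.1, ⟨mem_of_mem_succs n1, mem_of_mem_succs n2⟩, n3.2⟩
  have hC := hN.isCreature hS
  have hR := hN.subRight hγ hrN
  have key : ∀ {T' : PreCreature X}, T'.IsCreature → T'.nodes ⊆ S.nodes → T'.roots ⊆ S.roots →
      (∀ η ∈ T'.nodes, η.α < η.β → SubAt T' S η) → (S.restrict N).nodes ⊆ T'.nodes →
      (∀ r ∈ S.roots, γ.Lex r → r ∈ T'.roots) → γ ∈ T'.roots →
      (S.restrict N).SubRight T' := by
    intro T' hT' c1 c2 c3 c4 c5 c6
    refine ⟨c4, ⟨γ, c6, ?_⟩, fun η hη hlt => ⟨?_, ?_⟩⟩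
    · rw [hN.roots_restrict]
      ext r
      exact ⟨fun h => ⟨c5 r h.1 h.2.2, h.2.2⟩, fun h => ⟨c2 h.1, (hrN r (c2 h.1)).2 h.2⟩⟩
    · rw [hN.succs_restrict]
      rintro ν ⟨hν, hνN⟩
      exact ⟨c4 ⟨hν.1, hνN⟩, ⟨c4 hη, tlt_of_mem_succs hν⟩, fun x hx => hν.2.2 x (c1 hx)⟩
    · exact (c3 η (c4 hη) hlt).2.symm
  refine ⟨_, ⟨hC, hR.isLarge hX hC hS hL⟩, ?_, ?_⟩
  · exact key h₁ a1 hr1 a3 (fun η hη => hη.2.1.1) (fun r hr hl => a2 ▸ ⟨hr, l1.trans hl⟩)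
      (a2 ▸ ⟨hγ, l1⟩)
  · exact key h₂ b1 hr2 b3 (fun η hη => hη.2.1.2) (fun r hr hl => b2 ▸ ⟨hr, l2.trans hl⟩)
      (b2 ▸ ⟨hγ, l2⟩)

/-- If `T ≤ S` and `Z` is a thinned-out right part of `S`, then some thinned-out right part of `T`
refines `Z`. -/
theorem LE.exists_subRight_le [WellFoundedLT X] (hX : IsRegularOrder X) {Z : PreCreature X}
    (hT : T.IsCreature) (hTL : T.IsLarge) (hS : S.IsCreature) (hZ : Z.IsCreature)
    (h : T.LE S) (hZS : Z.SubRight S) :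
    ∃ T' : PreCreature X, (T'.IsCreature ∧ T'.IsLarge) ∧ T'.SubRight T ∧ T'.LE Z := by
  obtain ⟨F, hF, hFS, hFs⟩ := (le_iff hT hS).1 h
  obtain ⟨h1, ⟨γ, hγ, h2⟩, h3⟩ := hZS
  obtain ⟨T₁, ⟨hT₁, hL₁⟩, hs, hα, -⟩ := exists_subRight hX hT hTL γ.α
  obtain ⟨h4, h5, h6⟩ := hF.restrict hT₁ hT (hs.le hT₁ hT)
  set Φ := {x | x ∈ F ∧ x ∈ T₁.nodes} with hΦ
  have hΦZ : ∀ δ ∈ Φ, δ ∈ Z.roots := by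
    intro δ hδ
    rw [h2]
    exact ⟨hFS hδ.1, hS.roots_lex_of_α_lt hγ (hFS hδ.1) (hα δ hδ.2)⟩
  obtain ⟨T₂, hT₂, hthin, hfr, hsub⟩ := exists_thin_local hT₁ h4 (fun _ => S) (fun _ => Z)
    (fun _ _ => hS) (fun _ _ => hZ) (fun δ hδ η hη hδη => by
      obtain ⟨a1, a2⟩ := h5 δ hδ.1 hδ.2 η hη hδη
      obtain ⟨b1, b2⟩ := hFs δ hδ.1 η a1 hδη
      exact ⟨b1, fun hlt => (a2 hlt).trans (b2 hlt)⟩)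
    (fun δ hδ η hη _ => ⟨h1 hη, h3 η hη⟩) (fun δ hδ => (hΦZ δ hδ).1)
  have hsR : T₂.SubRight T := by
    obtain ⟨a1, ⟨δ, hδ, a2⟩, a3⟩ := hs
    obtain ⟨b1, -, b3⟩ := (thin_iff hT₂ hT₁).1 hthin
    exact ⟨b1.trans a1, ⟨δ, hδ, (hthin.roots_eq hT₂ hT₁).trans a2⟩, fun η hη hlt =>
      (b3 η hη hlt).trans (a3 η (b1 hη) hlt)⟩
  exact ⟨T₂, ⟨hT₂, hsR.isLarge hX hT₂ hT hTL⟩, hsR,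
    (le_iff hT₂ hZ).2 ⟨Φ, hfr, hΦZ, hsub⟩⟩

end PreCreature

namespace LargeCreature
open PreCreature
variable {X : Type u} [LinearOrder X] {S T R S' T' : LargeCreature X}

/-- `T ≤_thin/short S` says that `T` is a thinned-out right part of `S`. -/
theorem thinShort_iff [WellFoundedLT X] : ThinShort T S ↔ T.1.SubRight S.1 := by
  constructor
  · rintro ⟨T', h, h'⟩
    exact h'.subRight_of_short T.2.1 T'.2.1 S.2.1 h
  · intro h
    obtain ⟨T', hT', h1, h2⟩ := h.exists_thin T.2.1 S.2.1 S.2.2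
    exact ⟨⟨T', hT'⟩, h1, h2⟩

theorem approx_iff [WellFoundedLT X] :
    Approx S S' ↔ ∃ T : LargeCreature X, T.1.SubRight S.1 ∧ T.1.SubRight S'.1 := by
  simp only [Approx, thinShort_iff]

theorem Approx.symm (h : Approx S S') : Approx S' S := by
  obtain ⟨T, h, h'⟩ := h
  exact ⟨T, h', h⟩

theorem approx_of_subRight [WellFoundedLT X] (hX : IsRegularOrder X) (h : T.1.SubRight S.1) :
    Approx T S := by
  obtain ⟨γ, hγ, -⟩ := T.2.1.exists_root_gt hX T.2.2 hX.nonempty.some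
  obtain ⟨R, hR, h1, -⟩ := exists_subRight hX T.2.1 T.2.2 γ.α
  exact approx_iff.2 ⟨⟨R, hR⟩, h1, h1.trans h⟩

theorem Approx.refl [WellFoundedLT X] (hX : IsRegularOrder X) (S : LargeCreature X) :
    Approx S S := by
  obtain ⟨R, hR, h1, -⟩ := exists_subRight hX S.2.1 S.2.2 hX.nonempty.some
  exact approx_iff.2 ⟨⟨R, hR⟩, h1, h1⟩

theorem Approx.trans [WellFoundedLT X] (hX : IsRegularOrder X) (h : Approx S T)
    (h' : Approx T R) : Approx S R := by
  obtain ⟨A, h1, h2⟩ := approx_iff.1 h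
  obtain ⟨B, h3, h4⟩ := approx_iff.1 h'
  obtain ⟨C, hC, h5, h6⟩ := h2.inter hX A.2.1 B.2.1 T.2.1 T.2.2 h3
  exact approx_iff.2 ⟨⟨C, hC⟩, h5.trans h1, h6.trans h4⟩

theorem approx_of_thin [WellFoundedLT X] (hX : IsRegularOrder X) (h : T.1.Thin S.1) :
    Approx T S := by
  obtain ⟨R, hR, h1, -⟩ := exists_subRight hX T.2.1 T.2.2 hX.nonempty.some
  refine approx_iff.2 ⟨⟨R, hR⟩, h1, ?_⟩
  obtain ⟨a1, ⟨δ, hδ, a2⟩, a3⟩ := h1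
  obtain ⟨b1, -, b3⟩ := (thin_iff T.2.1 S.2.1).1 h
  rw [h.roots_eq T.2.1 S.2.1] at a2 hδ
  exact ⟨a1.trans b1, ⟨δ, hδ, a2⟩, fun η hη hlt => (a3 η hη hlt).trans (b3 η (a1 hη) hlt)⟩

theorem le_trans [WellFoundedLT X] (h : T.1.LE S.1) (h' : S.1.LE R.1) : T.1.LE R.1 :=
  h.trans T.2.1 S.2.1 R.2.1 h'

theorem le_of_subRight (h : T.1.SubRight S.1) : T.1.LE S.1 := h.le T.2.1 S.2.1

theorem le_refl (S : LargeCreature X) : S.1.LE S.1 :=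
  le_of_sub S.2.1 S.2.1 (fun _ h => h) (fun _ h => h) fun _ _ _ => ⟨fun _ h => h, rfl⟩

/-- If `T ≤ S ≈ S'`, then `T ≈ T' ≤ S'` for some `T' ≤ T`. -/
theorem exists_approx_le [WellFoundedLT X] (hX : IsRegularOrder X) (h : T.1.LE S.1)
    (h' : Approx S S') :
    ∃ T' : LargeCreature X, Approx T' T ∧ T'.1.LE T.1 ∧ T'.1.LE S'.1 := by
  obtain ⟨Z, h1, h2⟩ := approx_iff.1 h'
  obtain ⟨T', hT', h3, h4⟩ := h.exists_subRight_le hX T.2.1 T.2.2 S.2.1 Z.2.1 h1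
  exact ⟨⟨T', hT'⟩, approx_of_subRight hX h3, h3.le hT'.1 T.2.1,
    h4.trans hT'.1 Z.2.1 S'.2.1 (h2.le Z.2.1 S'.2.1)⟩

theorem LEStar.refl [WellFoundedLT X] (hX : IsRegularOrder X) (S : LargeCreature X) : LEStar S S :=
  ⟨S, Approx.refl hX S, le_refl S⟩

theorem LEStar.of_le [WellFoundedLT X] (hX : IsRegularOrder X) (h : T.1.LE S.1) : LEStar T S :=
  ⟨T, Approx.refl hX T, h⟩

/-- If `T ≤* S`, then some thinned-out right part of `T` refines `S`. -/
theorem LEStar.exists_subRight [WellFoundedLT X] (h : LEStar T S) :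
    ∃ Z : LargeCreature X, Z.1.SubRight T.1 ∧ Z.1.LE S.1 := by
  obtain ⟨T', h1, h2⟩ := h
  obtain ⟨Z, h3, h4⟩ := approx_iff.1 h1
  exact ⟨Z, h3, le_trans (le_of_subRight h4) h2⟩

theorem LEStar.trans [WellFoundedLT X] (hX : IsRegularOrder X) (h : LEStar T S) (h' : LEStar S R) :
    LEStar T R := by
  obtain ⟨T', h1, h2⟩ := h
  obtain ⟨S', h3, h4⟩ := h'
  obtain ⟨T'', h5, -, h6⟩ := exists_approx_le hX h2 h3
  exact ⟨T'', h1.trans hX h5.symm, le_trans h6 h4⟩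

/-- If `T ≤* S` and `P ≈ S`, `Q ≈ T`, then some `R ≈ T` refines both `P` and `Q`. -/
theorem LEStar.exists_le_le [WellFoundedLT X] (hX : IsRegularOrder X) {P Q : LargeCreature X}
    (h : LEStar T S) (hP : Approx P S)
    (hQ : Approx Q T) :
    ∃ R : LargeCreature X, Approx R T ∧ R.1.LE P.1 ∧ R.1.LE Q.1 := by
  obtain ⟨T', h1, h2⟩ := h
  obtain ⟨T'', h3, -, h4⟩ := exists_approx_le hX h2 hP.symm
  have h5 : Approx T'' Q := (h3.trans hX h1.symm).trans hX hQ.symm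
  obtain ⟨R, h6, h7⟩ := approx_iff.1 h5
  exact ⟨R, (approx_of_subRight hX h7).trans hX hQ, le_trans (le_of_subRight h6) h4,
    le_of_subRight h7⟩

theorem leafSet_mono [WellFoundedLT X] (h : T.1.LE S.1) : T.1.leafSet ⊆ S.1.leafSet := by
  intro i hi
  rw [T.2.1.mem_leafSet_iff] at hi
  rw [S.2.1.mem_leafSet_iff]
  exact (S.2.1.isFront_roots.restrict T.2.1 S.2.1 h).2.2 i hi

end LargeCreature

/-! ### Clones -/

section Clones
variable {X : Type u}

theorem isClone_cloneGen (A : Set (Operation X)) : IsClone (cloneGen A) :=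
  ⟨fun n i _ h => h.1.proj_mem n i, fun n m f g hf hg C h =>
    h.1.comp_mem n m f g (hf C h) fun i => hg i C h⟩

theorem subset_cloneGen (A : Set (Operation X)) : A ⊆ cloneGen A := fun _ hf _ h => h.2 hf

theorem cloneGen_subset {A C : Set (Operation X)} (hC : IsClone C) (h : A ⊆ C) :
    cloneGen A ⊆ C := fun _ hf => hf C ⟨hC, h⟩

theorem cloneGen_mono {A B : Set (Operation X)} (h : A ⊆ B) : cloneGen A ⊆ cloneGen B :=
  cloneGen_subset (isClone_cloneGen B) (h.trans (subset_cloneGen B))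

variable [LinearOrder X] {C : Set (Operation X)}

/-- A clone containing `C_max` is closed under passing to pointwise smaller operations. -/
theorem IsClone.mem_of_le (hC : IsClone C) (hmax : cmax X ⊆ C) {n : ℕ}
    {f p : (Fin (n + 1) → X) → X} (hp : (⟨n, p⟩ : Operation X) ∈ C) (h : ∀ x, f x ≤ p x) :
    (⟨n, f⟩ : Operation X) ∈ C := by
  -- the operation `K (x, w) = f x` if `f x ≤ w`, and `x₀` otherwise, lies in `C_max`
  let K : (Fin (n + 1 + 1) → X) → X := fun z =>
    if f (fun i => z i.castSucc) ≤ z (Fin.last _) then f (fun i => z i.castSucc) else z 0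
  have hK : (⟨n + 1, K⟩ : Operation X) ∈ C := by
    refine hmax fun z => ?_
    by_cases hz : f (fun i => z i.castSucc) ≤ z (Fin.last _)
    · exact ⟨Fin.last _, by simp [K, hz]⟩
    · exact ⟨0, by simp [K, hz]⟩
  have := hC.comp_mem (n + 1) n K (Fin.snoc (α := fun _ => (Fin (n + 1) → X) → X)
    (fun i x => x i) p) hK (by
      intro i
      refine Fin.lastCases ?_ (fun i => ?_) i
      · simpa using hp
      · simpa using hC.proj_mem n i)
  convert this using 2
  funext x
  simp [K, h]

/-- The maximum of all variables. -/
def maxVar (n : ℕ) : (Fin (n + 1) → X) → X := fun x => Finset.univ.sup' Finset.univ_nonempty x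

theorem le_maxVar {n : ℕ} (x : Fin (n + 1) → X) (i : Fin (n + 1)) : x i ≤ maxVar n x :=
  Finset.le_sup' x (Finset.mem_univ i)

theorem maxVar_mem_cmax (n : ℕ) : (⟨n, maxVar n⟩ : Operation X) ∈ cmax X := by
  intro x
  obtain ⟨i, -, hi⟩ := Finset.exists_mem_eq_sup' Finset.univ_nonempty x
  exact ⟨i, hi.le⟩

section NextIn
variable [WellFoundedLT X] {A : Set X} {x y : X}

theorem nextIn_mem (h : ∃ y ∈ A, x < y) : nextIn A x ∈ A ∧ x < nextIn A x := by
  have h' : {y | y ∈ A ∧ x < y}.Nonempty := h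
  rw [nextIn, dif_pos h']
  exact WellFounded.min_mem _ _ h'

theorem nextIn_le (hy : y ∈ A) (h : x < y) : nextIn A x ≤ y := by
  have h' : {y | y ∈ A ∧ x < y}.Nonempty := ⟨y, hy, h⟩
  rw [nextIn, dif_pos h']
  exact WellFounded.min_le _ (show y ∈ {y | y ∈ A ∧ x < y} from ⟨hy, h⟩)

end NextIn

theorem cmax_subset_filterClone [WellFoundedLT X] (U : Set (Set X)) : cmax X ⊆ filterClone U :=
  Set.subset_union_left.trans (subset_cloneGen _)

theorem hOp_mem_filterClone [WellFoundedLT X] {U : Set (Set X)} {A : Set X} (h : A ∈ U) :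
    hOp A ∈ filterClone U := subset_cloneGen _ (Or.inr ⟨A, h, rfl⟩)

theorem filterClone_mono [WellFoundedLT X] {U V : Set (Set X)} (h : U ⊆ V) :
    filterClone U ⊆ filterClone V :=
  cloneGen_mono (Set.union_subset_union_right _ fun _ ⟨A, hA, e⟩ => ⟨A, h hA, e⟩)

/-! ### Operations preserving the initial segment below a node -/

variable {η : Node X}

/-- Operations below the maximum preserve every initial segment. -/
theorem Node.IsStrong.of_mem_cmax {f : Operation X} (hη : η.α < η.β) (hf : f ∈ cmax X) :
    η.IsStrong f :=
  ⟨hη, fun y hy => by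
    obtain ⟨i, hi⟩ := hf y
    exact hi.trans_lt (hy i)⟩

theorem Node.IsStrong.proj (hη : η.α < η.β) (n : ℕ) (i : Fin (n + 1)) :
    η.IsStrong (⟨n, fun x => x i⟩ : Operation X) := ⟨hη, fun _ hy => hy i⟩

theorem Node.IsStrong.comp {n m : ℕ} {f : (Fin (n + 1) → X) → X}
    {g : Fin (n + 1) → (Fin (m + 1) → X) → X} (hf : η.IsStrong (⟨n, f⟩ : Operation X))
    (hg : ∀ i, η.IsStrong (⟨m, g i⟩ : Operation X)) :
    η.IsStrong (⟨m, fun x => f fun i => g i x⟩ : Operation X) :=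
  ⟨hf.1, fun y hy => hf.2 _ fun i => (hg i).2 y hy⟩

/-- Since the leaves above `η` are cofinal in `β η`, the function `h_A` preserves the initial
segment of `β η` if `A` contains all leaves. -/
theorem PreCreature.IsCreature.isStrong_hOp [WellFoundedLT X] {T : PreCreature X}
    (hT : T.IsCreature) (hηT : η ∈ T.nodes) (hη : η.α < η.β) {A : Set X} (hA : T.leafSet ⊆ A) :
    η.IsStrong (hOp A) := by
  refine ⟨hη, fun y hy => ?_⟩
  obtain ⟨i, hi, hηi, hlt⟩ := hT.exists_leaf_gt hηT hη (hy 0)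
  refine (nextIn_le (hA (hT.mem_leafSet_iff.2 hi)) hlt).trans_lt (hηi.tlt_of_ne ?_).β_lt
  rintro rfl
  exact lt_irrefl _ hη

end Clones

open PreCreature LargeCreature

/-! ### The filter generated by a sufficiently generic sequence -/

/-- A copy of the set of operations, which will carry the preorder `f ≤ g ↔ ¬ g <_∞ f` instead of
the instance for sigma types. -/
structure RankedOperation (X : Type u) : Type u where
  /-- The underlying operation. -/
  op : Operation X

section Generic
variable {X : Type u} [LinearOrder X] [WellFoundedLT X] {I : Type u} [LinearOrder I]
  {S : I → LargeCreature X}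

theorem leStar_of_le (hX : IsRegularOrder X) (hS : ∀ i j, i < j → (S j).LEStar (S i)) {i j : I}
    (h : i ≤ j) : (S j).LEStar (S i) := by
  rcases h.eq_or_lt with rfl | h
  · exact LEStar.refl hX _
  · exact hS i j h

/-- The filter on the set of large creatures which is generated by the sets `{T | T ≤ P}`, where
`P ≈ S i` for some `i`. All notions attached to the sequence are evaluated along this filter. -/
def genericFilter [Nonempty I] (hX : IsRegularOrder X)
    (hS : ∀ i j, i < j → (S j).LEStar (S i)) : Filter (LargeCreature X) where
  sets := {s | ∃ i P, Approx P (S i) ∧ ∀ T : LargeCreature X, T.1.LE P.1 → T ∈ s}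
  univ_sets := ⟨Classical.arbitrary I, _, Approx.refl hX _, fun _ _ => Set.mem_univ _⟩
  sets_of_superset := by
    rintro s t ⟨i, P, h, h'⟩ hst
    exact ⟨i, P, h, fun T hT => hst (h' T hT)⟩
  inter_sets := by
    rintro s t ⟨i, P, h1, h2⟩ ⟨j, Q, h3, h4⟩
    rcases le_total i j with hij | hij
    · obtain ⟨R, h5, h6, h7⟩ := (leStar_of_le hX hS hij).exists_le_le hX h1 h3
      exact ⟨j, R, h5, fun T hT => ⟨h2 T (le_trans hT h6), h4 T (le_trans hT h7)⟩⟩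
    · obtain ⟨R, h5, h6, h7⟩ := (leStar_of_le hX hS hij).exists_le_le hX h3 h1
      exact ⟨i, R, h5, fun T hT => ⟨h2 T (le_trans hT h7), h4 T (le_trans hT h6)⟩⟩

variable [Nonempty I] (hX : IsRegularOrder X) (hS : SufficientlyGeneric S)
include hX hS

theorem eventually_genericFilter_iff {p : LargeCreature X → Prop} :
    (∀ᶠ T in genericFilter hX hS.1, p T) ↔
      ∃ i P, Approx P (S i) ∧ ∀ T : LargeCreature X, T.1.LE P.1 → p T := Iff.rfl

theorem genericFilter_neBot : (genericFilter hX hS.1).NeBot := by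
  refine ⟨fun h => ?_⟩
  have : ∅ ∈ genericFilter hX hS.1 := h ▸ Filter.mem_bot
  obtain ⟨i, P, -, h2⟩ := this
  exact h2 P (le_refl P)

theorem eventually_of_approx {p : LargeCreature X → Prop} {i : I} {P : LargeCreature X}
    (hP : Approx P (S i)) (h : ∀ T : LargeCreature X, T.1.LE P.1 → p T) :
    ∀ᶠ T in genericFilter hX hS.1, p T := ⟨i, P, hP, h⟩

theorem eventually_of_index {p : LargeCreature X → Prop} (i : I)
    (h : ∀ T : LargeCreature X, T.1.LE (S i).1 → p T) :
    ∀ᶠ T in genericFilter hX hS.1, p T := ⟨i, S i, Approx.refl hX _, h⟩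

theorem eventually_lt_of_approx {f g : Operation X} {i : I} {P : LargeCreature X}
    (hP : Approx P (S i)) (h : P.1.Lt f g) : ∀ᶠ T in genericFilter hX hS.1, T.1.Lt f g :=
  eventually_of_approx hX hS hP fun T hT => h.restrict T.2.1 P.2.1 hT

theorem eventually_sim_of_approx {f g : Operation X} {i : I} {P : LargeCreature X}
    (hP : Approx P (S i)) (h : P.1.Sim f g) : ∀ᶠ T in genericFilter hX hS.1, T.1.Sim f g :=
  eventually_of_approx hX hS hP fun T hT => h.restrict T.2.1 P.2.1 hT

/-- The relation `<_∞` is decided by almost all creatures: the sequence compares `f` with `g`, and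
the three possible answers are inherited and exclude each other. -/
theorem ltInf_iff {f g : Operation X} :
    LtInf S f g ↔ ∀ᶠ T in genericFilter hX hS.1, T.1.Lt f g := by
  have := genericFilter_neBot hX hS
  constructor
  · rintro ⟨i, h⟩
    exact eventually_lt_of_approx hX hS (Approx.refl hX _) h
  · intro h
    obtain ⟨i, h' | h' | h'⟩ := hS.2 f g
    · exact ⟨i, h'⟩
    · obtain ⟨T, h1, h2⟩ :=
        (h.and (eventually_sim_of_approx hX hS (Approx.refl hX _) h')).exists
      exact absurd h2 (h1.not_sim T.2.1)
    · obtain ⟨T, h1, h2⟩ :=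
        (h.and (eventually_lt_of_approx hX hS (Approx.refl hX _) h')).exists
      exact absurd h2 (h1.asymm T.2.1)

theorem simInf_iff {f g : Operation X} :
    SimInf S f g ↔ ∀ᶠ T in genericFilter hX hS.1, T.1.Sim f g := by
  have := genericFilter_neBot hX hS
  constructor
  · rintro ⟨i, h⟩
    exact eventually_sim_of_approx hX hS (Approx.refl hX _) h
  · intro h
    obtain ⟨i, h' | h' | h'⟩ := hS.2 f g
    · obtain ⟨T, h1, h2⟩ :=
        (h.and (eventually_lt_of_approx hX hS (Approx.refl hX _) h')).exists
      exact absurd h1 (h2.not_sim T.2.1)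
    · exact ⟨i, h'⟩
    · obtain ⟨T, h1, h2⟩ :=
        (h.and (eventually_lt_of_approx hX hS (Approx.refl hX _) h')).exists
      exact absurd (h1.symm T.2.1) (h2.not_sim T.2.1)

theorem ltInf_iff_ltStar {f g : Operation X} : LtInf S f g ↔ ∃ i, (S i).LtStar f g :=
  ⟨fun ⟨i, h⟩ => ⟨i, S i, Approx.refl hX _, h⟩, fun ⟨_, _, h1, h2⟩ =>
    (ltInf_iff hX hS).2 (eventually_lt_of_approx hX hS h1 h2)⟩

theorem simInf_iff_simStar {f g : Operation X} : SimInf S f g ↔ ∃ i, (S i).SimStar f g :=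
  ⟨fun ⟨i, h⟩ => ⟨i, S i, Approx.refl hX _, h⟩, fun ⟨_, _, h1, h2⟩ =>
    (simInf_iff hX hS).2 (eventually_sim_of_approx hX hS h1 h2)⟩

omit [WellFoundedLT X] [Nonempty I] hX in
theorem ltInf_trichotomy (f g : Operation X) : LtInf S f g ∨ SimInf S f g ∨ LtInf S g f := by
  obtain ⟨i, h | h | h⟩ := hS.2 f g
  · exact Or.inl ⟨i, h⟩
  · exact Or.inr (Or.inl ⟨i, h⟩)
  · exact Or.inr (Or.inr ⟨i, h⟩)

theorem LtInf.asymm {f g : Operation X} (h : LtInf S f g) : ¬ LtInf S g f := by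
  have := genericFilter_neBot hX hS
  intro h'
  rw [ltInf_iff hX hS] at h h'
  obtain ⟨T, h1, h2⟩ := (h.and h').exists
  exact h1.asymm T.2.1 h2

theorem LtInf.not_simInf {f g : Operation X} (h : LtInf S f g) : ¬ SimInf S f g := by
  have := genericFilter_neBot hX hS
  intro h'
  rw [ltInf_iff hX hS] at h
  rw [simInf_iff hX hS] at h'
  obtain ⟨T, h1, h2⟩ := (h.and h').exists
  exact h1.not_sim T.2.1 h2

theorem LtInf.trans {f g h : Operation X} (h1 : LtInf S f g) (h2 : LtInf S g h) :
    LtInf S f h := by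
  rw [ltInf_iff hX hS] at *
  filter_upwards [h1, h2] with T h1 h2 using h1.trans T.2.1 h2

theorem SimInf.symm {f g : Operation X} (h : SimInf S f g) : SimInf S g f := by
  rw [simInf_iff hX hS] at *
  filter_upwards [h] with T h using h.symm T.2.1

theorem SimInf.trans_ltInf {f g h : Operation X} (h1 : SimInf S f g) (h2 : LtInf S g h) :
    LtInf S f h := by
  rw [ltInf_iff hX hS] at *
  rw [simInf_iff hX hS] at h1
  filter_upwards [h1, h2] with T h1 h2 using h1.trans_lt T.2.1 h2

theorem LtInf.trans_simInf {f g h : Operation X} (h1 : LtInf S f g) (h2 : SimInf S g h) :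
    LtInf S f h := by
  rw [ltInf_iff hX hS] at *
  rw [simInf_iff hX hS] at h2
  filter_upwards [h1, h2] with T h1 h2 using h1.trans_sim T.2.1 h2

theorem not_ltInf_iff {f g : Operation X} : ¬ LtInf S g f ↔ LtInf S f g ∨ SimInf S f g := by
  constructor
  · intro h
    rcases ltInf_trichotomy hS f g with h' | h' | h'
    · exact Or.inl h'
    · exact Or.inr h'
    · exact absurd h' h
  · rintro (h | h) h'
    · exact h.asymm hX hS h'
    · exact h'.not_simInf hX hS (h.symm hX hS)

/-! ### The filter `U` and the clone `C_∞` -/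

theorem mem_iUnion_filterSets_iff {A : Set X} :
    A ∈ ⋃ i, (S i).filterSets ↔ ∀ᶠ T in genericFilter hX hS.1, T.1.leafSet ⊆ A := by
  rw [Set.mem_iUnion, eventually_genericFilter_iff hX hS]
  constructor
  · rintro ⟨i, P, h, h'⟩
    exact ⟨i, P, h, fun T hT => (leafSet_mono hT).trans h'⟩
  · rintro ⟨i, P, h, h'⟩
    exact ⟨i, P, h, h' P (le_refl P)⟩

omit [WellFoundedLT X] [LinearOrder I] [Nonempty I] hX hS in
theorem filterSets_subset_of_forall_approx {T S : LargeCreature X}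
    (h : ∀ S' : LargeCreature X, Approx S' S →
      ∃ T' : LargeCreature X, Approx T' T ∧ T'.1.leafSet ⊆ S'.1.leafSet) :
    S.filterSets ⊆ T.filterSets := by
  rintro A ⟨S', h1, h2⟩
  obtain ⟨T', h3, h4⟩ := h S' h1
  exact ⟨T', h3, h4.trans h2⟩

omit [Nonempty I] in
theorem filterSets_mono {i j : I} (hij : i ≤ j) : (S i).filterSets ⊆ (S j).filterSets := by
  refine filterSets_subset_of_forall_approx fun P hP => ?_
  obtain ⟨R, h1, h2, -⟩ := (leStar_of_le hX hS.1 hij).exists_le_le hX hP (Approx.refl hX _)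
  exact ⟨R, h1, leafSet_mono h2⟩

omit [LinearOrder I] [Nonempty I] hS in
theorem exists_leaf_gt_of_isLarge (T : LargeCreature X) (x : X) : ∃ y ∈ T.1.leafSet, x < y := by
  obtain ⟨r, hr, h⟩ := T.2.1.exists_root_gt hX T.2.2 x
  obtain ⟨i, hi, hi'⟩ := T.2.1.exists_leaf hr.1
  exact ⟨i, T.2.1.mem_leafSet_iff.2 hi, h.trans_le hi'.α_le⟩

theorem exists_filter : ∃ U : Filter X, U.sets = ⋃ i, (S i).filterSets ∧
    ∀ A ∈ U, ¬ BddAbove A := by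
  have := genericFilter_neBot hX hS
  refine ⟨⟨⋃ i, (S i).filterSets, ?_, ?_, ?_⟩, rfl, ?_⟩
  · rw [mem_iUnion_filterSets_iff hX hS]
    exact Filter.Eventually.of_forall fun _ => Set.subset_univ _
  · intro A B hA hAB
    rw [mem_iUnion_filterSets_iff hX hS] at hA ⊢
    filter_upwards [hA] with T hT using hT.trans hAB
  · intro A B hA hB
    rw [mem_iUnion_filterSets_iff hX hS] at hA hB ⊢
    filter_upwards [hA, hB] with T hT hT' using Set.subset_inter hT hT'
  · rintro A hA ⟨b, hb⟩
    have hA' : A ∈ ⋃ i, (S i).filterSets := hA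
    rw [mem_iUnion_filterSets_iff hX hS] at hA'
    obtain ⟨T, hT⟩ := hA'.exists
    obtain ⟨y, hy, hby⟩ := exists_leaf_gt_of_isLarge hX T b
    exact absurd (hb (hT hy)) (not_le.2 hby)

omit [LinearOrder I] [Nonempty I] hX hS in
theorem isClone_clone (T : LargeCreature X) : IsClone T.clone := isClone_cloneGen _

omit [Nonempty I] in
theorem clone_mono {i j : I} (hij : i ≤ j) : (S i).clone ⊆ (S j).clone :=
  filterClone_mono (filterSets_mono hX hS hij)

theorem isClone_cInf : IsClone (cInf S) := by
  refine ⟨fun n i => Set.mem_iUnion.2 ⟨Classical.arbitrary I, (isClone_clone _).proj_mem n i⟩,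
    fun n m f g hf hg => ?_⟩
  obtain ⟨j, hj⟩ := Set.mem_iUnion.1 hf
  choose k hk using fun i => Set.mem_iUnion.1 (hg i)
  obtain ⟨l, hl⟩ := (Set.finite_range k).bddAbove
  refine Set.mem_iUnion.2 ⟨max j l, (isClone_clone _).comp_mem n m f g
    (clone_mono hX hS (le_max_left _ _) hj) fun i =>
      clone_mono hX hS ((hl ⟨i, rfl⟩).trans (le_max_right _ _)) (hk i)⟩

theorem cInf_eq : cInf S = filterClone (⋃ i, (S i).filterSets) := by
  refine Set.Subset.antisymm (Set.iUnion_subset fun i =>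
    filterClone_mono (Set.subset_iUnion (fun i => (S i).filterSets) i)) ?_
  refine cloneGen_subset (isClone_cInf hX hS) (Set.union_subset ?_ ?_)
  · exact (cmax_subset_filterClone _).trans
      (Set.subset_iUnion (fun i => (S i).clone) (Classical.arbitrary I))
  · rintro _ ⟨A, hA, rfl⟩
    obtain ⟨i, hi⟩ := Set.mem_iUnion.1 hA
    exact Set.mem_iUnion.2 ⟨i, hOp_mem_filterClone hi⟩

omit [WellFoundedLT X] [LinearOrder I] hX hS in
theorem cmax_subset_cInf [WellFoundedLT X] : cmax X ⊆ cInf S :=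
  (cmax_subset_filterClone _).trans
    (Set.subset_iUnion (fun i => (S i).clone) (Classical.arbitrary I))

/-! ### The relations and generation of clones -/

omit [LinearOrder I] hS in
/-- If `f <_∞ g`, then `g` together with `C_∞` generates `f`: a node gauging `f` is `g`-weak, so
applying `g` to small arguments overtakes all values of `f` there. -/
theorem LtInf.mem_cloneGen {f g : Operation X} (h : LtInf S f g) :
    f ∈ cloneGen (cInf S ∪ {g}) := by
  obtain ⟨i, h⟩ := h
  have hC := isClone_cloneGen (cInf S ∪ {g})
  have hsub := subset_cloneGen (cInf S ∪ {g})
  have hmax : cmax X ⊆ cloneGen (cInf S ∪ {g}) :=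
    (cmax_subset_cInf.trans Set.subset_union_left).trans hsub
  have hSi := (S i).2.1
  obtain ⟨F, G, hF, hG, hFG⟩ := h.exists_data hSi
  set A := (S i).1.leafSet with hA
  have hAmem : hOp A ∈ cloneGen (cInf S ∪ {g}) := by
    refine hsub (Or.inl (Set.mem_iUnion.2 ⟨i, hOp_mem_filterClone ?_⟩))
    exact ⟨S i, Approx.refl hX _, subset_rfl⟩
  obtain ⟨n, f⟩ := f
  obtain ⟨m, g⟩ := g
  have hbound : (⟨n, fun x => nextIn A (maxVar n x)⟩ : Operation X) ∈
      cloneGen (cInf S ∪ {⟨m, g⟩}) :=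
    hC.comp_mem 0 n (fun x => nextIn A (x 0)) (fun _ => maxVar n) hAmem
      fun _ => hmax (maxVar_mem_cmax n)
  -- Evaluate at the branch of the leaf `h_A (max x)`: the node `η` on it which gauges `f` is
  -- `f`-strong, so `f x < β η`, and `g`-weak, so `β η ≤ g y` for some `y` bounded by this leaf.
  have key : ∀ x : Fin (n + 1) → X, ∃ y : Fin (m + 1) → X,
      (∀ j, y j ≤ nextIn A (maxVar n x)) ∧ f x ≤ g y := by
    intro x
    obtain ⟨ha, hlt⟩ := nextIn_mem (exists_leaf_gt_of_isLarge hX (S i) (maxVar n x))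
    rw [hSi.mem_leafSet_iff] at ha
    obtain ⟨η, hη, μ, hμ, h1, h2, h3⟩ := hFG _ ha
    obtain ⟨h4, h5⟩ := hF.isStrong hSi hη
    obtain ⟨y, hy, hy'⟩ := ((hSi.weak_iff).1 (hG.weak hμ (hF.1.1 hη) h3)).2 h4
    exact ⟨y, hy _ ha h1, ((h5 x fun j => ((le_maxVar x j).trans_lt hlt).trans_le
      h1.β_le).trans_le hy').le⟩
  choose y hy hfy using key
  refine hC.mem_of_le hmax (p := fun x => g (y x)) ?_ hfy
  exact hC.comp_mem m n g (fun j x => y x j) (hsub (Or.inr rfl)) fun j =>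
    hC.mem_of_le hmax hbound fun x => hy x j

/-- All operations generated by `C_∞` and `f` preserve `sup[η]` for the `f`-strong nodes `η` of
almost all creatures. -/
theorem eventually_isStrong_of_mem_cloneGen {f h : Operation X}
    (hh : h ∈ cloneGen (cInf S ∪ {f})) : ∀ᶠ T in genericFilter hX hS.1,
      ∀ η ∈ T.1.nodes, η.IsStrong f → η.IsStrong h := by
  let P : Operation X → Prop := fun h => ∀ᶠ T in genericFilter hX hS.1,
    ∀ η ∈ T.1.nodes, η.IsStrong f → η.IsStrong h
  have hP : ∀ h, (∀ η : Node X, η.IsStrong f → η.IsStrong h) → P h := fun h h' =>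
    Filter.Eventually.of_forall fun T η _ => h' η
  have hC : IsClone {h | P h} := by
    refine ⟨fun n i => hP _ fun η hη => .proj hη.1 n i, fun n m f g hf hg => ?_⟩
    have hf' : P ⟨n, f⟩ := hf
    have hg' : ∀ i, P ⟨m, g i⟩ := hg
    change P _
    filter_upwards [hf', Filter.eventually_all.2 hg'] with T h1 h2 η hη hs
    exact (h1 η hη hs).comp fun i => h2 i η hη hs
  refine cloneGen_subset hC (Set.union_subset ?_ ?_) hh
  · rw [cInf_eq hX hS]
    refine cloneGen_subset hC (Set.union_subset ?_ ?_)
    · exact fun h hh => hP h fun η hη => .of_mem_cmax hη.1 hh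
    · rintro _ ⟨A, hA, rfl⟩
      rw [mem_iUnion_filterSets_iff hX hS] at hA
      change P _
      filter_upwards [hA] with T hT η hη hs
      exact T.2.1.isStrong_hOp hη hs.1 hT
  · exact Set.singleton_subset_iff.2 (hP f fun η hη => hη)

/-- If `f <_∞ g`, the nodes which gauge `f` are `f`-strong and `g`-weak, while every operation
generated by `f` together with `C_∞` preserves their initial segments. -/
theorem LtInf.notMem_cloneGen {f g : Operation X} (h : LtInf S f g) :
    g ∉ cloneGen (cInf S ∪ {f}) := by
  have := genericFilter_neBot hX hS
  intro hg
  rw [ltInf_iff hX hS] at h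
  obtain ⟨T, h1, h2⟩ := (h.and (eventually_isStrong_of_mem_cloneGen hX hS hg)).exists
  obtain ⟨F, G, hF, hG, h3⟩ := h1.exists_data T.2.1
  obtain ⟨i, hi⟩ := T.2.1.exists_pt
  obtain ⟨η, hη, μ, hμ, h4, h5, h6⟩ := h3 i hi
  exact T.2.1.not_weak_of_isStrong (h2 η (hF.1.1 hη) (hF.isStrong T.2.1 hη))
    (hG.weak hμ (hF.1.1 hη) h6)

theorem not_ltInf_of_mem_cInf {f h : Operation X} (hh : h ∈ cInf S) : ¬ LtInf S f h := fun hlt =>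
  hlt.notMem_cloneGen hX hS (subset_cloneGen _ (Or.inl hh))

omit [Nonempty I] [LinearOrder I] hX hS in
/-- If `f` is at most `g` in `T`, then the front gauging `g` also gauges `max (f, g)`. -/
theorem sim_maxOp {T : LargeCreature X} {f g : Operation X} {k : ℕ} (hf : f.1 ≤ k) (hg : g.1 ≤ k)
    (h : T.1.Lt f g ∨ T.1.Sim f g) : T.1.Sim (maxOp f g k hf hg) g := by
  have hT := T.2.1
  obtain ⟨G, hG⟩ : ∃ G, T.1.Gauges G g := by
    rcases h with ⟨_, G, -, hG, -⟩ | ⟨_, G, -, hG, -⟩ <;> exact ⟨G, hG⟩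
  refine sim_of_gauges hT ⟨hG.1, fun η hη => hT.strong_iff.2 ⟨hG.1.1 hη, ?_⟩, ?_⟩ hG
  · have h1 := hG.isStrong hT hη
    have h2 := Lt.isStrong_left hT hG h hη
    exact ⟨h1.1, fun y hy => max_lt (h2.2 _ fun i => hy _) (h1.2 _ fun i => hy _)⟩
  · intro η hη ν hν hlt
    obtain ⟨h1, h2⟩ := hT.weak_iff.1 (hG.weak hη hν hlt)
    refine hT.weak_iff.2 ⟨h1, fun h3 => ?_⟩
    obtain ⟨y, h4, h5⟩ := h2 h3
    -- extend `y` to a tuple of length `k + 1`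
    refine ⟨fun i => if h : i.1 < g.1 + 1 then y ⟨i.1, h⟩ else y 0, fun i hi hi' j => ?_, ?_⟩
    · dsimp only
      split_ifs
      · exact h4 i hi hi' _
      · exact h4 i hi hi' _
    · refine h5.trans ((le_of_eq ?_).trans (le_max_right _ _))
      exact congrArg g.2 (funext fun i => by simpa using fun h => absurd i.is_le (not_le.2 h))

/-- Composition does not lead beyond a bound `f₀`: on the front gauging `f₀`, all operations bounded
by `f₀` are strong. -/
theorem not_ltInf_comp {f₀ : Operation X} {n m : ℕ} {f : (Fin (n + 1) → X) → X}
    {g : Fin (n + 1) → (Fin (m + 1) → X) → X} (hf : ¬ LtInf S f₀ ⟨n, f⟩)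
    (hg : ∀ i, ¬ LtInf S f₀ ⟨m, g i⟩) :
    ¬ LtInf S f₀ ⟨m, fun x => f fun i => g i x⟩ := by
  have := genericFilter_neBot hX hS
  intro h
  have key : ∀ {f : Operation X}, ¬ LtInf S f₀ f →
      ∀ᶠ T in genericFilter hX hS.1, T.1.Lt f f₀ ∨ T.1.Sim f f₀ := by
    intro f h
    rw [not_ltInf_iff hX hS, ltInf_iff hX hS, simInf_iff hX hS] at h
    rcases h with h | h
    · exact h.mono fun _ => Or.inl
    · exact h.mono fun _ => Or.inr
  rw [ltInf_iff hX hS] at h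
  obtain ⟨T, h1, h2, h3⟩ :=
    (h.and ((key hf).and (Filter.eventually_all.2 fun i => key (hg i)))).exists
  have hT := T.2.1
  obtain ⟨F, H, hF, hH, h4⟩ := h1.exists_data hT
  obtain ⟨i, hi⟩ := hT.exists_pt
  obtain ⟨η, hη, μ, hμ, -, -, h5⟩ := h4 i hi
  exact hT.not_weak_of_isStrong
    ((Lt.isStrong_left hT hF h2 hη).comp fun i => Lt.isStrong_left hT hF (h3 i) hη)
    (hH.weak hμ (hF.1.1 hη) h5)

open Classical in
/-- There is no last operation: the operation which maps `α η` to `β η`, for all roots `η` of a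
creature in which `f` is gauged, is larger than `f`. -/
theorem exists_ltInf (f : Operation X) : ∃ g, LtInf S f g := by
  have := genericFilter_neBot hX hS
  obtain ⟨i, F, hF⟩ : ∃ i F, (S i).1.Gauges F f := by
    obtain ⟨i, ⟨F, -, hF, -⟩ | ⟨F, -, hF, -⟩ | ⟨F, -, hF, -⟩⟩ := hS.2 f f <;>
      exact ⟨i, F, hF⟩
  -- the roots of `P` are not `g`-strong, but all nodes on or below a front gauging `g` are
  set P := (S i).1
  have hP : P.IsCreature := (S i).2.1
  let g : Operation X := ⟨0, fun x => if h : ∃ r ∈ P.roots, r.α = x 0 then h.choose.β else x 0⟩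
  have hg : ∀ r ∈ P.roots, ¬ r.IsStrong g := by
    intro r hr hs
    have h := hs.2 (fun _ => r.α) fun _ => hs.1
    have hex : ∃ s ∈ P.roots, s.α = r.α := ⟨r, hr, rfl⟩
    have h' : g.2 (fun _ => r.α) = hex.choose.β := dif_pos hex
    rw [h', hP.α_injOn_roots hex.choose_spec.1 hr hex.choose_spec.2] at h
    exact lt_irrefl _ h
  refine ⟨g, ?_⟩
  by_contra hn
  rw [not_ltInf_iff hX hS, ltInf_iff hX hS, simInf_iff hX hS] at hn
  have hev : ∀ᶠ T in genericFilter hX hS.1, T.1.Lt g f ∨ T.1.Sim g f := by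
    rcases hn with h | h
    · exact h.mono fun _ => Or.inl
    · exact h.mono fun _ => Or.inr
  obtain ⟨T, h1, hTP⟩ := (hev.and (eventually_of_index hX hS i fun T hT => hT)).exists
  have hT := T.2.1
  have hF' := hF.restrict hT hP hTP
  obtain ⟨j, hj⟩ := hT.exists_pt
  obtain ⟨hΦ, -, hpt⟩ := hP.isFront_roots.restrict hT hP hTP
  obtain ⟨γ, hγ, hγj⟩ := hΦ.exists_tle hT hj
  obtain ⟨η, hη, hηj⟩ := hF'.1.exists_tle hT hj
  have hγη := hP.root_tle_of_tle hγ.1 (hF.1.1 hη.1) (hpt j hj) hγj hηj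
  -- the front gauging `g` lies on or above the front gauging `f`, hence above `γ`
  obtain ⟨G, hG, μ, hμ, hημ⟩ : ∃ G, T.1.Gauges G g ∧ ∃ μ ∈ G, η.TLE μ := by
    rcases h1 with h1 | h1
    · obtain ⟨G, F', hG, hF'', h2⟩ := h1.exists_data hT
      obtain rfl := hF'.unique hT hF''
      obtain ⟨μ, hμ, η', hη', h3, h4, h5⟩ := h2 j hj
      obtain rfl := hF'.1.eq_of_tle hT hη hη' hj hηj h4
      exact ⟨G, hG, μ, hμ, h5.tle⟩
    · obtain ⟨G, hG, hF''⟩ := h1.exists_data hT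
      obtain rfl := hF'.unique hT hF''
      exact ⟨_, hG, η, hη, Node.TLE.refl _⟩
  exact hg γ hγ.1 (hG.isStrong_of_tle hT hγ.2 hμ (hγη.trans hημ))

/-! ### The linear order of operations -/

/-- The order `L` consists of the initial segments of the linear order of the classes of `∼_∞`. -/
theorem exists_represents : ∃ (Q : Type u) (_ : CompleteLinearOrder Q) (ρ : Operation X → Q),
    Represents S ρ := by
  let P : Preorder (RankedOperation X) :=
    { le := fun f g => ¬ LtInf S g.op f.op
      le_refl := fun f h => h.asymm hX hS h
      le_trans := fun f g h h1 h2 h3 => by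
        rcases (not_ltInf_iff hX hS).1 h1 with h4 | h4
        · exact h2 (h3.trans hX hS h4)
        · exact h2 (h3.trans_simInf hX hS h4)
      lt := fun f g => LtInf S f.op g.op
      lt_iff_le_not_ge := fun f g => ⟨fun h => ⟨h.asymm hX hS, fun h' => h' h⟩,
        fun h => not_not.1 h.2⟩ }
  have hPle : ∀ f g : RankedOperation X, f ≤ g ↔ ¬ LtInf S g.op f.op := fun _ _ => Iff.rfl
  have htot : Std.Total (α := RankedOperation X) (· ≤ ·) := ⟨fun f g => by
    rw [hPle, hPle]
    by_contra! h
    exact h.1.asymm hX hS h.2⟩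
  classical
  let ρ : Operation X → LowerSet (Antisymmetrization (RankedOperation X) (· ≤ ·)) := fun f =>
    LowerSet.Iic (toAntisymmetrization (· ≤ ·) ⟨f⟩)
  have hle : ∀ f g, ρ f ≤ ρ g ↔ ¬ LtInf S g f := by
    intro f g
    rw [LowerSet.Iic_le]
    exact toAntisymmetrization_le_toAntisymmetrization_iff (α := RankedOperation X)
  refine ⟨LowerSet (Antisymmetrization (RankedOperation X) (· ≤ ·)), inferInstance, ρ,
    fun f g => ⟨?_, ?_⟩⟩
  · rw [← not_le, hle, not_not]
  · rw [le_antisymm_iff, hle, hle, not_ltInf_iff hX hS]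
    constructor
    · exact fun h => ⟨Or.inr h, fun h' => h'.not_simInf hX hS h⟩
    · rintro ⟨h | h, h'⟩
      · exact absurd h h'
      · exact h

variable {Q : Type v}

theorem Represents.isClone_of_down [LinearOrder Q] {ρ : Operation X → Q} (hρ : Represents S ρ)
    {D : Set Q} (hD : IsLowerSet D) (hne : {f | ρ f ∈ D}.Nonempty) : IsClone {f | ρ f ∈ D} := by
  have hle : ∀ f g, ρ f ≤ ρ g ↔ ¬ LtInf S g f := fun f g => by rw [(hρ g f).1, not_lt]
  obtain ⟨f₀, hf₀⟩ := hne
  refine ⟨fun n i => hD ((hle _ _).2 (not_ltInf_of_mem_cInf hX hS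
    ((isClone_cInf hX hS).proj_mem n i))) hf₀, fun n m f g hf hg => ?_⟩
  obtain ⟨h, h1, h2, h3⟩ : ∃ h : Operation X, ρ h ∈ D ∧ ρ ⟨n, f⟩ ≤ ρ h ∧
      ∀ i, ρ ⟨m, g i⟩ ≤ ρ h := by
    obtain ⟨i, hi⟩ := Finite.exists_max fun i => ρ ⟨m, g i⟩
    rcases le_total (ρ ⟨n, f⟩) (ρ ⟨m, g i⟩) with h | h
    · exact ⟨_, hg i, h, hi⟩
    · exact ⟨_, hf, le_rfl, fun j => (hi j).trans h⟩
  simp only [hle] at h2 h3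
  exact hD ((hle _ _).2 (not_ltInf_comp hX hS h2 h3)) h1

omit [LinearOrder I] hS in
/-- An operation outside a clone above `C_∞` bounds the clone. -/
theorem not_ltInf_of_notMem {D : Set (Operation X)} (hD : D ∈ cloneInterval (cInf S))
    {f h : Operation X} (hf : f ∉ D) (hh : h ∈ D) : ¬ LtInf S f h := fun hlt =>
  hf (cloneGen_subset hD.1 (Set.union_subset hD.2 (Set.singleton_subset_iff.2 hh))
    (hlt.mem_cloneGen hX))

omit [LinearOrder I] hS in
/-- A clone above `C_∞` is an initial segment up to the level of its supremum. -/
theorem Represents.exists_between [ConditionallyCompleteLinearOrder Q] {ρ : Operation X → Q}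
    (hρ : Represents S ρ) {D : Set (Operation X)} (hD : D ∈ cloneInterval (cInf S))
    (hne : D ≠ Set.univ) : ∃ d : Q, {f | ρ f < d} ⊆ D ∧ D ⊆ {f | ρ f ≤ d} := by
  obtain ⟨f₀, hf₀⟩ := (Set.ne_univ_iff_exists_notMem D).1 hne
  have hle : ∀ f ∉ D, ∀ h ∈ D, ρ h ≤ ρ f := fun f hf h hh => not_lt.1 fun hlt =>
    not_ltInf_of_notMem hX hD hf hh ((hρ f h).1.2 hlt)
  have hbdd : BddAbove (ρ '' D) := ⟨ρ f₀, by
    rintro _ ⟨h, hh, rfl⟩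
    exact hle f₀ hf₀ h hh⟩
  have hDne : (ρ '' D).Nonempty := ⟨_, _, hD.1.proj_mem 0 0, rfl⟩
  refine ⟨sSup (ρ '' D), fun f hf => ?_, fun f hf => le_csSup hbdd ⟨f, hf, rfl⟩⟩
  obtain ⟨_, ⟨h, hh, rfl⟩, hlt⟩ := exists_lt_of_lt_csSup hDne hf
  by_contra hn
  exact absurd (hle f hn h hh) (not_le.2 hlt)

/-- The initial segments of the relation `≤_∞` are proper clones above `C_∞`. -/
theorem initialSegment_mem (f : Operation X) :
    {h | LtInf S h f ∨ SimInf S h f} ∈ cloneInterval (cInf S) ∧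
      {h | LtInf S h f ∨ SimInf S h f} ≠ Set.univ := by
  obtain ⟨Q, _, ρ, hρ⟩ := exists_represents hX hS
  have hle : {h | LtInf S h f ∨ SimInf S h f} = {h | ρ h ∈ Set.Iic (ρ f)} := by
    ext h
    rw [Set.mem_ofPred_eq, (hρ h f).1, (hρ h f).2, ← le_iff_lt_or_eq]
    rfl
  refine ⟨⟨?_, fun h hh => (not_ltInf_iff hX hS).1 (not_ltInf_of_mem_cInf hX hS hh)⟩, ?_⟩
  · rw [hle]
    exact hρ.isClone_of_down hX hS (isLowerSet_Iic _) ⟨f, le_rfl⟩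
  · obtain ⟨g, hg⟩ := exists_ltInf hX hS f
    rw [Set.ne_univ_iff_exists_notMem]
    exact ⟨g, fun h => (not_ltInf_iff hX hS).2 h hg⟩

theorem initialSegment_ssubset {f g : Operation X} (h : LtInf S f g) :
    {h | LtInf S h f ∨ SimInf S h f} ⊂ {h | LtInf S h g ∨ SimInf S h g} := by
  refine (Set.ssubset_iff_of_subset ?_).2 ⟨g, ?_, fun h' => (not_ltInf_iff hX hS).2 h' h⟩
  · rintro e (he | he)
    · exact Or.inl (he.trans hX hS h)
    · exact Or.inl (he.trans_ltInf hX hS h)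
  · exact (not_ltInf_iff hX hS).1 fun h' => h'.asymm hX hS h'

theorem isChain_initialSegments :
    IsChain (· ⊆ ·) (Set.range fun f => {h | LtInf S h f ∨ SimInf S h f}) := by
  rintro _ ⟨f, rfl⟩ _ ⟨g, rfl⟩ -
  rcases ltInf_trichotomy hS f g with h | h | h
  · exact Or.inl (initialSegment_ssubset hX hS h).1
  · refine Or.inl ?_
    intro e he
    refine (not_ltInf_iff hX hS).1 fun h' => (not_ltInf_iff hX hS).2 he ?_
    exact h.trans_ltInf hX hS h'
  · exact Or.inr (initialSegment_ssubset hX hS h).1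

theorem subset_initialSegment {D : Set (Operation X)} (hD : D ∈ cloneInterval (cInf S))
    (hne : D ≠ Set.univ) : ∃ f, D ⊆ {h | LtInf S h f ∨ SimInf S h f} := by
  obtain ⟨f, hf⟩ := (Set.ne_univ_iff_exists_notMem D).1 hne
  exact ⟨f, fun h hh => (not_ltInf_iff hX hS).1 (not_ltInf_of_notMem hX hD hf hh)⟩

theorem cInf_ne_univ : cInf S ≠ Set.univ := by
  intro h
  obtain ⟨h1, h2⟩ := initialSegment_mem hX hS ⟨0, fun x => x 0⟩
  exact h2 (Set.univ_subset_iff.1 (h ▸ h1.2))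

/-- A coatom would lie in the initial segment of some `f`, which is properly contained in the proper
clone given by some `g` with `f <_∞ g`. -/
theorem no_coatom : ¬ ∃ M ∈ cloneInterval (cInf S), M ≠ Set.univ ∧
    ∀ D ∈ cloneInterval (cInf S), M ⊂ D → D = Set.univ := by
  rintro ⟨M, hM, hne, h⟩
  obtain ⟨f, hf⟩ := subset_initialSegment hX hS hM hne
  obtain ⟨g, hg⟩ := exists_ltInf hX hS f
  obtain ⟨h1, h2⟩ := initialSegment_mem hX hS g
  exact h2 (h _ h1 (hf.trans_ssubset (initialSegment_ssubset hX hS hg)))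

end Generic

/-! ### Thinning out: colourings and gauging fronts -/

namespace PreCreature
variable {X : Type u} [LinearOrder X] [WellFoundedLT X] {S T R : PreCreature X}
  {η ν μ x y z γ : Node X} {i : X} {f g : Operation X} {F G : Set (Node X)}

/-- A choice of a large set of successors at each node of a creature defines a thinned-out
creature. -/
theorem IsCreature.exists_thin_of_choice (hS : S.IsCreature) (c : Node X → Set (Node X))
    (hc : ∀ η ∈ S.nodes, η.α < η.β → c η ∈ S.D η) :
    ∃ T : PreCreature X, T.IsCreature ∧ T.Thin S ∧
      ∀ η ∈ T.nodes, ∀ ν ∈ T.succs η, ν ∈ c η := by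
  set N : Set (Node X) := {η | ∀ x x', x' ∈ S.succs x → x'.TLE η → x' ∈ c x} with hNdef
  have hrN : ∀ r ∈ S.roots, r ∈ N := by
    intro r hr x x' hx' h
    exact absurd ((tlt_of_mem_succs hx').trans_tle h) (hr.2 x (left_mem_of_mem_succs hx'))
  have hN : S.IsThinning N := by
    refine ⟨?_, fun x _ ν _ hν hxν y y' hy' h => hν y y' hy' (h.trans hxν),
      fun η hη hηN hlt => ?_⟩
    · obtain ⟨x, hx⟩ := hS.nonempty
      obtain ⟨r, hr, -⟩ := hS.exists_root hx
      exact ⟨r, hr.1, hrN r hr⟩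
    · filter_upwards [hS.succs_mem η (hS.mem_internal_iff.2 ⟨hη, hlt⟩), hc η hη hlt] with ν h1 h2
      refine ⟨h1, fun x x' hx' h => ?_⟩
      rcases h with rfl | h
      · exact eq_of_mem_succs h1 hx' ▸ h2
      · exact hηN x x' hx' (tle_of_mem_succs h1 (mem_of_mem_succs hx') h)
  have hC := hN.isCreature hS
  refine ⟨S.restrict N, hC, (thin_iff hC hS).2 ⟨fun _ h => h.1, fun r hr => ⟨hr.1, hrN r hr⟩,
    fun η hη _ => ⟨?_, rfl⟩⟩, fun η hη ν hν => ?_⟩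
  · rw [hN.succs_restrict]
    exact fun _ h => h.1
  · rw [hN.succs_restrict] at hν
    exact hν.2 η ν hν.1 (Node.TLE.refl _)

omit [WellFoundedLT X] in
/-- A property which passes from nodes to their direct successors passes to all nodes above. -/
theorem IsCreature.above_induction (hT : T.IsCreature) (p : Node X → Prop) (hγ : γ ∈ T.nodes)
    (h0 : p γ) (hs : ∀ η ∈ T.nodes, p η → ∀ ν ∈ T.succs η, p ν) (hη : η ∈ T.nodes)
    (h : γ.TLE η) : p η := by
  obtain ⟨x, ⟨hx, hγx, hxη, hpx⟩, hmin⟩ := Set.exists_min_image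
    {x | x ∈ T.nodes ∧ γ.TLE x ∧ x.TLE η ∧ p x} Node.β
    ((hT.below_finite hη).subset fun x hx => ⟨hx.1, hx.2.2.1⟩) ⟨γ, hγ, Node.TLE.refl _, h, h0⟩
  rcases hxη with rfl | hxη
  · exact hpx
  obtain ⟨ν, hν, hνη⟩ := hT.exists_succ_tle hx hη hxη
  have hlt := tlt_of_mem_succs hν
  exact absurd (hmin ν ⟨mem_of_mem_succs hν, hγx.trans hlt.tle, hνη, hs x hx hpx ν hν⟩)
    (not_le.2 hlt.β_lt)

/-- The nodes `η` of `S` such that, for almost all leaves above `η` in the sense of the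
ultrafilters of `S`, the leaf satisfies `p` and the internal nodes from `η` up to the leaf
satisfy `q`. -/
inductive AlmostAll (S : PreCreature X) (p : X → Prop) (q : Node X → Prop) : Node X → Prop
  | leaf (i : X) : p i → AlmostAll S p q (Node.pt i)
  | node (η : Node X) (A : Set (Node X)) : η.α < η.β → q η → A ∈ S.D η →
      (∀ ν ∈ A, ν ∈ S.succs η) → (∀ ν ∈ A, AlmostAll S p q ν) → AlmostAll S p q η

omit [WellFoundedLT X] in
theorem almostAll_pt {p : X → Prop} {q : Node X → Prop} :
    S.AlmostAll p q (Node.pt i) ↔ p i := by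
  constructor
  · intro h
    cases h with
    | leaf _ h => exact h
    | node _ A h => exact absurd h (lt_irrefl _)
  · exact AlmostAll.leaf i

omit [WellFoundedLT X] in
theorem IsCreature.almostAll_iff (hS : S.IsCreature) {p : X → Prop} {q : Node X → Prop}
    (hη : η ∈ S.nodes) (hlt : η.α < η.β) :
    S.AlmostAll p q η ↔ q η ∧ {ν | S.AlmostAll p q ν} ∈ S.D η := by
  constructor
  · intro h
    cases h with
    | leaf _ h => exact absurd hlt (lt_irrefl _)
    | node _ A h1 h2 h3 h4 h5 => exact ⟨h2, Filter.mem_of_superset h3 h5⟩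
  · rintro ⟨h1, h2⟩
    exact .node η _ hlt h1
      (Filter.inter_mem h2 (hS.succs_mem η (hS.mem_internal_iff.2 ⟨hη, hlt⟩)))
      (fun ν hν => hν.2) fun ν hν => hν.1

/-- A creature can be thinned out so that a given property of leaves is constant on each tree. -/
theorem IsCreature.exists_thin_const (hS : S.IsCreature) (p : X → Prop) :
    ∃ T : PreCreature X, T.IsCreature ∧ T.Thin S ∧ ∀ r ∈ T.roots,
      (∀ i, Node.pt i ∈ T.nodes → r.TLE (Node.pt i) → p i) ∨
      (∀ i, Node.pt i ∈ T.nodes → r.TLE (Node.pt i) → ¬ p i) := by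
  set V := S.AlmostAll p fun _ => True with hV
  obtain ⟨T, hT, hTS, hc⟩ := hS.exists_thin_of_choice (fun η => {ν | V ν ↔ V η}) (by
    intro η hη hlt
    have h := hS.almostAll_iff (p := p) (q := fun _ => True) hη hlt
    rw [true_and] at h
    by_cases h' : V η
    · exact Filter.mem_of_superset (h.1 h') fun ν hν => iff_of_true hν h'
    · have := Ultrafilter.compl_mem_iff_notMem.2 fun h'' => h' (h.2 h'')
      exact Filter.mem_of_superset this fun ν hν => iff_of_false hν h')
  refine ⟨T, hT, hTS, fun r hr => ?_⟩
  have key : ∀ i, Node.pt i ∈ T.nodes → r.TLE (Node.pt i) → (p i ↔ V r) := by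
    intro i hi hri
    rw [← almostAll_pt (S := S) (p := p) (q := fun _ => True)]
    exact hT.above_induction (fun η => V η ↔ V r) hr.1 Iff.rfl
      (fun η hη h ν hν => (hc η hη ν hν).trans h) hi hri
  by_cases h : V r
  · exact Or.inl fun i hi hri => (key i hi hri).2 h
  · exact Or.inr fun i hi hri hp => h ((key i hi hri).1 hp)

/-- If all roots of `S` are `f`-strong, then `S` can be thinned out to a creature in which some
front gauges `f`: the front consists of the nodes which are `f`-strong while almost all nodes
above them are not. -/
theorem IsCreature.exists_thin_gauges (hS : S.IsCreature) (f : Operation X)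
    (hr : ∀ r ∈ S.roots, r.IsStrong f) :
    ∃ T : PreCreature X, T.IsCreature ∧ T.Thin S ∧ ∃ F, T.Gauges F f := by
  set V := S.AlmostAll (fun _ => True) (fun η => ¬ η.IsStrong f) with hV
  have hVpt : ∀ i, V (Node.pt i) := fun i => .leaf i trivial
  have hVstrong : ∀ η, η.IsStrong f → ¬ V η := by
    rintro η hη h
    cases h with
    | leaf _ h => exact absurd hη.1 (lt_irrefl _)
    | node _ A h1 h2 => exact h2 hη
  -- At `η`, keep the successors on which `V` takes its almost constant value; if `η` is in `V`,
  -- hence not strong, keep only those to the right of arguments `y` with `β η ≤ f y`.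
  have hex : ∀ η ∈ S.nodes, η.α < η.β → ∃ c ∈ S.D η,
      (∀ ν ∈ c, V ν ↔ {ν | V ν} ∈ S.D η) ∧
      (V η → ∃ y, η.β ≤ f.2 y ∧ ∀ ν ∈ c, ∀ j, y j ≤ ν.α) := by
    intro η hη hlt
    have h1 : {ν | V ν ↔ {ν | V ν} ∈ S.D η} ∈ S.D η := by
      by_cases h : {ν | V ν} ∈ S.D η
      · exact Filter.mem_of_superset h fun ν hν => iff_of_true hν h
      · exact Filter.mem_of_superset (Ultrafilter.compl_mem_iff_notMem.2 h) fun ν hν =>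
          iff_of_false hν h
    by_cases h : V η
    · have h2 : ¬ η.IsStrong f := fun h' => hVstrong η h' h
      rw [Node.IsStrong, not_and] at h2
      have h3 := h2 hlt
      push Not at h3
      obtain ⟨y, hy, hy'⟩ := h3
      obtain ⟨j, hj⟩ := Finite.exists_max y
      refine ⟨_, Filter.inter_mem h1 (hS.converges_to hη hlt (hy j)), fun ν hν => hν.1,
        fun _ => ⟨y, hy', fun ν hν k => (hj k).trans hν.2.2.le⟩⟩
    · exact ⟨_, h1, fun ν hν => hν, fun h' => absurd h' h⟩
  choose! c hc hcV hcy using hex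
  obtain ⟨T, hT, hTS, hTc⟩ := hS.exists_thin_of_choice c hc
  obtain ⟨hTn, hTr, hTsub⟩ := (thin_iff hT hS).1 hTS
  have hV1 : ∀ η ∈ T.nodes, V η → ∀ ν ∈ T.succs η, V ν := by
    intro η hη h ν hν
    have hlt := (tlt_of_mem_succs hν).α_lt_β
    exact (hcV η (hTn hη) hlt ν (hTc η hη ν hν)).2 ((hS.almostAll_iff (hTn hη) hlt).1 h).2
  -- in `T`, the nodes in `V` are weak, and all nodes above a node in `V` are in `V`
  have hweak : ∀ η ∈ T.nodes, V η → T.Weak f η := by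
    intro η hη h
    refine hT.weak_iff.2 ⟨hη, fun hlt => ?_⟩
    obtain ⟨y, hy, hy'⟩ := hcy η (hTn hη) hlt h
    refine ⟨y, fun i hi hηi j => ?_, hy⟩
    obtain ⟨ν, hν, hνi⟩ := hT.exists_succ_tle hη hi (hηi.tlt_of_ne (by
      rintro rfl
      exact lt_irrefl _ hlt))
    exact (hy' ν (hTc η hη ν hν) j).trans hνi.α_le
  have habove : ∀ η ∈ T.nodes, V η → ∀ ν ∈ T.nodes, η.TLE ν → V ν := fun η hη h ν hν hην =>
    hT.above_induction V hη h hV1 hν hην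
  refine ⟨T, hT, hTS, {η | η ∈ T.nodes ∧ η.IsStrong f ∧ {ν | V ν} ∈ S.D η}, ?_, ?_, ?_⟩
  · have hFV : ∀ η ∈ T.nodes, {ν | V ν} ∈ S.D η → ∀ ν ∈ T.nodes, η.TLT ν → V ν := by
      intro η hη h ν hν hην
      obtain ⟨ν', hν', hν'ν⟩ := hT.exists_succ_tle hη hν hην
      exact habove ν' (mem_of_mem_succs hν')
        ((hcV η (hTn hη) hην.α_lt_β ν' (hTc η hη ν' hν')).2 h) ν hν hν'ν
    refine hT.isFront_iff.2 ⟨fun η hη => hη.1, fun i hi => ?_⟩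
    obtain ⟨r, hr', hri⟩ := hT.exists_root hi
    rw [hTS.roots_eq hT hS] at hr'
    -- the last node outside `V` on a branch belongs to the front
    obtain ⟨x, ⟨hx, hxi, hVx⟩, hmin⟩ := Set.exists_min_image
      {x | x ∈ T.nodes ∧ x.TLE (Node.pt i) ∧ ¬ V x} Node.β
      ((hT.below_finite hi).subset fun x hx => ⟨hx.1, hx.2.1⟩)
      ⟨r, hTr hr', hri, hVstrong r (hr r hr')⟩
    have hxi' : x.TLT (Node.pt i) := hxi.tlt_of_ne (by
      rintro rfl
      exact hVx (hVpt i))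
    obtain ⟨ν, hν, hνi⟩ := hT.exists_succ_tle hx hi hxi'
    have hlt := tlt_of_mem_succs hν
    have hVν : V ν := by
      by_contra h
      exact absurd (hmin ν ⟨mem_of_mem_succs hν, hνi, h⟩) (not_le.2 hlt.β_lt)
    have hmem := (hcV x (hTn hx) hlt.α_lt_β ν (hTc x hx ν hν)).1 hVν
    have hstrong : x.IsStrong f := by
      by_contra h
      exact hVx ((hS.almostAll_iff (hTn hx) hlt.α_lt_β).2 ⟨h, hmem⟩)
    refine ⟨x, ⟨⟨hx, hstrong, hmem⟩, hxi⟩, ?_⟩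
    rintro x' ⟨⟨hx', hs', hm'⟩, hxi''⟩
    rcases hT.below_total hx' hx hi hxi'' hxi with h | h
    · by_contra hne
      exact hVx (hFV x' hx' hm' x hx (h.tlt_of_ne hne))
    · by_contra hne
      exact hVstrong x' hs' (hFV x hx hmem x' hx' (h.tlt_of_ne (Ne.symm hne)))
  · rintro η ⟨hη, hs, -⟩
    exact hT.strong_iff.2 ⟨hη, hs⟩
  · rintro η ⟨hη, hs, hm⟩ ν hν hην
    obtain ⟨ν', hν', hν'ν⟩ := hT.exists_succ_tle hη hν hην
    exact hweak ν hν (habove ν' (mem_of_mem_succs hν')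
      ((hcV η (hTn hη) hην.α_lt_β ν' (hTc η hη ν' hν')).2 hm) ν hν hν'ν)

omit [WellFoundedLT X] in
theorem Thin.le (hT : T.IsCreature) (hS : S.IsCreature) (h : T.Thin S) : T.LE S := by
  obtain ⟨h1, -, h3⟩ := (thin_iff hT hS).1 h
  exact le_of_sub hT hS (h.roots_eq hT hS).subset h1 h3

/-- Keeping an unbounded set of roots, together with all nodes above them. -/
theorem IsCreature.exists_le_of_roots (hX : IsRegularOrder X) (hS : S.IsCreature)
    {K : Set (Node X)} (hK : K ⊆ S.roots) (hL : ∀ x, ∃ r ∈ K, x ≤ r.α) :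
    ∃ T : PreCreature X, (T.IsCreature ∧ T.IsLarge) ∧ T.LE S ∧
      ∀ η ∈ T.nodes, η ∈ S.nodes ∧ ∃ r ∈ K, r.TLE η := by
  have hN : S.IsThinning {η | ∃ r ∈ K, r.TLE η} := by
    refine ⟨?_, ?_, ?_⟩
    · obtain ⟨r, hr, -⟩ := hL hX.nonempty.some
      exact ⟨r, (hK hr).1, r, hr, Node.TLE.refl _⟩
    · rintro x hx ν hν ⟨r, hr, hrν⟩ hxν
      exact ⟨r, hr, hS.root_tle_of_tle (hK hr) hx hν hrν hxν⟩
    · rintro η hη ⟨r, hr, hrη⟩ hlt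
      exact Filter.mem_of_superset (hS.succs_mem η (hS.mem_internal_iff.2 ⟨hη, hlt⟩)) fun ν hν =>
        ⟨hν, r, hr, hrη.trans (tlt_of_mem_succs hν).tle⟩
  have hC := hN.isCreature hS
  refine ⟨_, ⟨hC, (hC.isLarge_iff hX).2 fun x => ?_⟩, hN.le hS, fun η hη => hη⟩
  obtain ⟨r, hr, hxr⟩ := hL x
  refine ⟨r, ?_, hxr⟩
  rw [hN.roots_restrict]
  exact ⟨hK hr, r, hr, Node.TLE.refl _⟩

/-- If fronts gauge `f` and `g` in a large creature, then some creature below it decides how `f`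
and `g` compare. -/
theorem Gauges.exists_le_decides (hX : IsRegularOrder X) (hS : S.IsCreature) (hL : S.IsLarge)
    (hF : S.Gauges F f) (hG : S.Gauges G g) :
    ∃ T : PreCreature X, (T.IsCreature ∧ T.IsLarge) ∧ T.LE S ∧
      (T.Lt f g ∨ T.Sim f g ∨ T.Lt g f) := by
  let p (r : Node X → Node X → Prop) (i : X) : Prop :=
    ∃ η ∈ F, ∃ μ ∈ G, η.TLE (Node.pt i) ∧ μ.TLE (Node.pt i) ∧ r μ η
  -- Make the comparison constant on each tree, and keep only the trees with one of the three
  -- outcomes, which has to occur at unboundedly many roots.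
  obtain ⟨T₁, hT₁, h1, hc1⟩ := hS.exists_thin_const (p fun μ η => μ.TLT η)
  obtain ⟨T₂, hT₂, h2, hc2⟩ := hT₁.exists_thin_const (p fun μ η => η = μ)
  have hle1 := h1.le hT₁ hS
  have hle2 := (h2.le hT₂ hT₁).trans hT₂ hT₁ hS hle1
  have hn2 := ((thin_iff hT₂ hT₁).1 h2).1
  have hroots : T₂.roots = S.roots := (h2.roots_eq hT₂ hT₁).trans (h1.roots_eq hT₁ hS)
  let K (r : Node X → Node X → Prop) : Set (Node X) :=
    {γ | γ ∈ T₂.roots ∧ ∀ i, Node.pt i ∈ T₂.nodes → γ.TLE (Node.pt i) → p r i}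
  have hcover : ∀ γ ∈ T₂.roots, γ ∈ K (fun μ η => μ.TLT η) ∨ γ ∈ K (fun μ η => η = μ) ∨
      γ ∈ K (fun μ η => η.TLT μ) := by
    intro γ hγ
    rcases hc2 γ hγ with h3 | h3
    · exact Or.inr (Or.inl ⟨hγ, h3⟩)
    have hγ1 : γ ∈ T₁.roots := h2.roots_eq hT₂ hT₁ ▸ hγ
    rcases hc1 γ hγ1 with h4 | h4
    · exact Or.inl ⟨hγ, fun i hi => h4 i (hn2 hi)⟩
    refine Or.inr (Or.inr ⟨hγ, fun i hi hγi => ?_⟩)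
    have hiS := (hF.1.restrict hT₂ hS hle2).2.2 i hi
    obtain ⟨η, hη, hηi⟩ := hF.1.exists_tle hS hiS
    obtain ⟨μ, hμ, hμi⟩ := hG.1.exists_tle hS hiS
    refine ⟨η, hη, μ, hμ, hηi, hμi, ?_⟩
    have hne : η ≠ μ := fun e => h3 i hi hγi ⟨η, hη, μ, hμ, hηi, hμi, e⟩
    rcases hS.below_total (hF.1.1 hη) (hG.1.1 hμ) hiS hηi hμi with h5 | h5
    · exact h5.tlt_of_ne hne
    · exact absurd ⟨η, hη, μ, hμ, hηi, hμi, h5.tlt_of_ne hne.symm⟩ (h4 i (hn2 hi) hγi)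
  have key : ∀ r : Node X → Node X → Prop, (∀ x, ∃ γ ∈ K r, x ≤ γ.α) →
      ∃ T : PreCreature X, (T.IsCreature ∧ T.IsLarge) ∧ T.LE S ∧
        ∃ F G, T.Gauges F f ∧ T.Gauges G g ∧
          ∀ ν ∈ T.leaves, ∃ η ∈ F, ∃ μ ∈ G, η.TLE ν ∧ μ.TLE ν ∧ r μ η := by
    intro r hr
    obtain ⟨T, hT, hTle, hTn⟩ := hT₂.exists_le_of_roots hX (fun γ hγ => hγ.1) hr
    have hTS := hTle.trans hT.1 hT₂ hS hle2
    refine ⟨T, hT, hTS, restrict_rel hT.1 hS hTS hF hG fun i hi => ?_⟩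
    obtain ⟨h3, γ, hγ, hγi⟩ := hTn _ hi
    exact hγ.2 i h3 hγi
  by_cases h3 : ∀ x, ∃ γ ∈ K (fun μ η => μ.TLT η), x ≤ γ.α
  · obtain ⟨T, hT, hTS, h⟩ := key _ h3
    exact ⟨T, hT, hTS, Or.inl h⟩
  by_cases h4 : ∀ x, ∃ γ ∈ K (fun μ η => η = μ), x ≤ γ.α
  · obtain ⟨T, hT, hTS, h⟩ := key _ h4
    exact ⟨T, hT, hTS, Or.inr (Or.inl h)⟩
  by_cases h5 : ∀ x, ∃ γ ∈ K (fun μ η => η.TLT μ), x ≤ γ.α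
  · obtain ⟨T, hT, hTS, F', G', hF', hG', h⟩ := key _ h5
    refine ⟨T, hT, hTS, Or.inr (Or.inr ⟨G', F', hG', hF', fun ν hν => ?_⟩)⟩
    obtain ⟨η, hη, μ, hμ, h6, h7, h8⟩ := h ν hν
    exact ⟨μ, hμ, η, hη, h7, h6, h8⟩
  push Not at h3 h4 h5
  obtain ⟨x, hx⟩ := h3
  obtain ⟨y, hy⟩ := h4
  obtain ⟨z, hz⟩ := h5
  obtain ⟨r, hr, hlt⟩ := hS.exists_root_gt hX hL (max x (max y z))
  rw [← hroots] at hr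
  rcases hcover r hr with h | h | h
  · exact absurd ((le_max_left _ _).trans_lt hlt) (hx r h).not_gt
  · exact absurd (((le_max_left _ _).trans (le_max_right _ _)).trans_lt hlt) (hy r h).not_gt
  · exact absurd (((le_max_right _ _).trans (le_max_right _ _)).trans_lt hlt) (hz r h).not_gt

end PreCreature

/-! ### Gluing the trees of a creature into blocks -/

namespace PreCreature
variable {X : Type u} [LinearOrder X] {S T R : PreCreature X}
  {η ν μ x y z γ b b' r : Node X} {i : X} {f g : Operation X} {F G : Set (Node X)} {E : Set X}

/-- `b = (i, j)` where `i < j` are consecutive elements of `E`. -/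
def IsBlock (E : Set X) (b : Node X) : Prop :=
  b.α ∈ E ∧ b.β ∈ E ∧ b.α < b.β ∧ ∀ k ∈ E, b.α < k → b.β ≤ k

/-- The roots of `S` strictly inside the interval given by `b`. -/
def blockRoots (S : PreCreature X) (b : Node X) : Set (Node X) :=
  {r | r ∈ S.roots ∧ b.α < r.α ∧ r.β < b.β}

theorem IsBlock.eq_or_lt (hb : IsBlock E b) (hb' : IsBlock E b') :
    b = b' ∨ b.β ≤ b'.α ∨ b'.β ≤ b.α := by
  rcases lt_trichotomy b.α b'.α with h | h | h
  · exact Or.inr (Or.inl (hb.2.2.2 _ hb'.1 h))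
  · refine Or.inl (Node.ext_αβ h (le_antisymm ?_ ?_))
    · exact hb.2.2.2 _ hb'.2.1 (h ▸ hb'.2.2.1)
    · exact hb'.2.2.2 _ hb.2.1 (h ▸ hb.2.2.1)
  · exact Or.inr (Or.inr (hb'.2.2.2 _ hb.1 h))

theorem IsBlock.lex_or_lex (hb : IsBlock E b) (hb' : IsBlock E b') (hne : b ≠ b') :
    b.Lex b' ∨ b'.Lex b := by
  rcases hb.eq_or_lt hb' with h | h | h
  · exact absurd h hne
  · exact Or.inl ⟨hne, h⟩
  · exact Or.inr ⟨hne.symm, h⟩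

theorem IsBlock.not_tlt (hb : IsBlock E b) (hb' : IsBlock E b') : ¬ b.TLT b' := by
  intro h
  rcases hb.eq_or_lt hb' with h' | h' | h'
  · exact h.1 h'
  · exact absurd (h'.trans (b'.α_le_β)) (not_le.2 h.β_lt)
  · exact absurd (h'.trans h.α_le) (not_le.2 hb'.2.2.1)

/-- If a node inside the block `b` meets the block `b'` then `b = b'`. -/
theorem IsBlock.eq_of_inside (hb : IsBlock E b) (hb' : IsBlock E b') (h1 : b.α < η.α)
    (h2 : η.β < b.β) (h3 : b'.α ≤ η.α) (h4 : η.β ≤ b'.β) : b = b' := by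
  rcases hb.eq_or_lt hb' with h | h | h
  · exact h
  · exact absurd (η.α_le_β.trans_lt h2) (not_lt.2 (h.trans h3))
  · exact absurd (h1.trans_le η.α_le_β) (not_lt.2 (h4.trans h))

theorem tlt_of_mem_blockRoots (hr : r ∈ S.blockRoots b) (h : r.TLE η) :
    b.α < η.α ∧ η.β < b.β ∧ b.TLT η := by
  have h1 := hr.2.1.trans_le h.α_le
  have h2 := h.β_le.trans_lt hr.2.2
  exact ⟨h1, h2, Node.tlt_iff.2 ⟨h1.le, h2⟩⟩

open Classical in
/-- The creature obtained from `S` by putting a new root `(i, j)` below all trees of `S` which lie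
strictly inside the interval `(i, j)`, for any consecutive elements `i < j` of `E`; the remaining
trees are dropped. The ultrafilters at the new roots are given by `U`. -/
noncomputable def glue (S : PreCreature X) (E : Set X) (U : Node X → Ultrafilter (Node X)) :
    PreCreature X where
  nodes := {η | IsBlock E η ∨ (η ∈ S.nodes ∧ ∃ b, IsBlock E b ∧ ∃ r ∈ S.blockRoots b, r.TLE η)}
  D η := if IsBlock E η then U η else S.D η

/-- The roots of `S` are cofinal below all elements of `E`. -/
def RootsCofinal (S : PreCreature X) (E : Set X) : Prop :=
  ∀ j ∈ E, ∀ z < j, ∃ r ∈ S.roots, z < r.α ∧ r.β < j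

variable {U : Node X → Ultrafilter (Node X)}

theorem IsBlock.notMem (hE : S.RootsCofinal E) (hb : IsBlock E b) :
    b ∉ S.nodes := by
  intro h
  obtain ⟨r, hr, h1, h2⟩ := hE b.β hb.2.1 b.α hb.2.2.1
  have h3 : b.TLT r := Node.tlt_iff.2 ⟨h1.le, h2⟩
  exact hr.2 b h h3

theorem mem_glue_succs (hb : IsBlock E b)
    (hr : r ∈ S.blockRoots b) : r ∈ (S.glue E U).succs b := by
  obtain ⟨h1, h2, h3⟩ := tlt_of_mem_blockRoots hr (Node.TLE.refl _)
  refine ⟨Or.inr ⟨hr.1.1, b, hb, r, hr, Node.TLE.refl _⟩, ⟨Or.inl hb, h3⟩, ?_⟩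
  rintro x (hx | ⟨hx, -⟩) hxr
  · exact Or.inl (hb.eq_of_inside hx h1 h2 hxr.α_le hxr.β_lt.le).symm
  · exact absurd hxr (hr.1.2 x hx)

theorem glue_succs_eq (hS : S.IsCreature) (hb : IsBlock E b)
    (hr : r ∈ S.blockRoots b) (hη : η ∈ S.nodes) (hrη : r.TLE η) :
    (S.glue E U).succs η = S.succs η := by
  obtain ⟨h1, h2, h3⟩ := tlt_of_mem_blockRoots hr hrη
  ext ν
  constructor
  · rintro ⟨hν | ⟨hν, -⟩, ⟨-, hην⟩, hmax⟩
    · exact absurd (h3.tle.trans_tlt hην) (hb.not_tlt hν)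
    · refine ⟨hν, ⟨hη, hην⟩, fun x hx hxν => hmax x (Or.inr ⟨hx, b, hb, r, hr, ?_⟩) hxν⟩
      exact hS.root_tle_of_tle hr.1 hx hν (hrη.trans hην.tle) hxν.tle
  · rintro ⟨hν, ⟨-, hην⟩, hmax⟩
    refine ⟨Or.inr ⟨hν, b, hb, r, hr, hrη.trans hην.tle⟩,
      ⟨Or.inr ⟨hη, b, hb, r, hr, hrη⟩, hην⟩, ?_⟩
    rintro x (hx | ⟨hx, -⟩) hxν
    · obtain ⟨h4, h5, -⟩ := tlt_of_mem_blockRoots hr (hrη.trans hην.tle)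
      rw [← hb.eq_of_inside hx h4 h5 hxν.α_le hxν.β_lt.le]
      exact h3.tle
    · exact hmax x hx hxν

/-- An ultrafilter on the roots of `S` inside the block `b` which converges to `β b`. -/
theorem exists_blockUltrafilter [WellFoundedLT X] (hE : S.RootsCofinal E) (hb : IsBlock E b) :
    ∃ U : Ultrafilter (Node X), ∀ z < b.β, {r | r ∈ S.blockRoots b ∧ z < r.α} ∈ U := by
  have : Nonempty (Set.Iio b.β) := ⟨⟨b.α, hb.2.2.1⟩⟩
  choose r hr h1 h2 using fun z : Set.Iio b.β =>
    hE b.β hb.2.1 (max b.α z.1) (max_lt hb.2.2.1 z.2)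
  refine ⟨Ultrafilter.of (Filter.map r Filter.atTop), fun z hz => Ultrafilter.of_le _ ?_⟩
  rw [Filter.mem_map]
  filter_upwards [Filter.eventually_ge_atTop (⟨z, hz⟩ : Set.Iio b.β)] with w hw
  exact ⟨⟨hr w, (le_max_left _ _).trans_lt (h1 w), h2 w⟩,
    lt_of_le_of_lt (show z ≤ w.1 from hw) ((le_max_right _ _).trans_lt (h1 w))⟩

theorem glue_isCreature [WellFoundedLT X] (hS : S.IsCreature) (hE : S.RootsCofinal E)
    (hne : ∃ b, IsBlock E b)
    (hU : ∀ b, IsBlock E b → ∀ z < b.β, {r | r ∈ S.blockRoots b ∧ z < r.α} ∈ U b) :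
    (S.glue E U).IsCreature := by
  have hmixed : ∀ b, IsBlock E b → ∀ η ∈ S.nodes, ∀ b', IsBlock E b' → ∀ r ∈ S.blockRoots b',
      r.TLE η → b.TLT η ∨ b.Lex η ∨ η.Lex b := by
    intro b hb η hη b' hb' r hr hrη
    obtain ⟨h1, h2, h3⟩ := tlt_of_mem_blockRoots hr hrη
    have hne : b ≠ η := by
      rintro rfl
      exact hb.notMem hE hη
    rcases hb.eq_or_lt hb' with h | h | h
    · exact Or.inl (h ▸ h3)
    · exact Or.inr (Or.inl ⟨hne, h.trans h1.le⟩)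
    · exact Or.inr (Or.inr ⟨hne.symm, h2.le.trans h⟩)
  refine isCreature_of ?_ ?_ ?_ ?_ ?_
  · obtain ⟨b, hb⟩ := hne
    exact ⟨b, Or.inl hb⟩
  · rintro x (hx | ⟨hx, b, hb, r, hr, hrx⟩) y (hy | ⟨hy, b', hb', r', hr', hry⟩)
    · by_cases h : x = y
      · exact Or.inl (Or.inl h)
      · exact Or.inr (Or.inr (hx.lex_or_lex hy h))
    · rcases hmixed x hx y hy b' hb' r' hr' hry with h | h
      · exact Or.inl h.tle
      · exact Or.inr (Or.inr h)
    · rcases hmixed y hy x hx b hb r hr hrx with h | h | h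
      · exact Or.inr (Or.inl h.tle)
      · exact Or.inr (Or.inr (Or.inr h))
      · exact Or.inr (Or.inr (Or.inl h))
    · exact hS.total hx hy
  · rintro i j h (hi | ⟨hi, b, hb, r, hr, hri⟩) (hj | ⟨hj, -⟩)
    · exact lt_irrefl _ hi.2.2.1
    · exact lt_irrefl _ hi.2.2.1
    · obtain ⟨h1, h2, -⟩ := tlt_of_mem_blockRoots hr hri
      exact absurd (hb.2.2.2 i hj.1 h1) (not_le.2 h2)
    · exact hS.pair_notMem i j h hi hj
  · intro c hc hch
    have h1 : (c ∩ S.nodes).Finite := hS.wellFounded _ Set.inter_subset_right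
      (hch.mono Set.inter_subset_left)
    have h2 : (c ∩ {b | IsBlock E b}).Finite := by
      refine Set.Subsingleton.finite ?_
      rintro b ⟨hbc, hb⟩ b' ⟨hbc', hb'⟩
      by_contra hne
      rcases hch hbc hbc' hne with h | h
      · exact hb.not_tlt hb' (h.tlt_of_ne hne)
      · exact hb'.not_tlt hb (h.tlt_of_ne (Ne.symm hne))
    refine (h1.union h2).subset fun x hx => ?_
    rcases hc hx with h | h
    · exact Or.inr ⟨hx, h⟩
    · exact Or.inl ⟨hx, h.1⟩
  · rintro η hη hlt z hz
    by_cases hb : IsBlock E η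
    · have hD : (S.glue E U).D η = U η := if_pos hb
      rw [hD]
      exact Filter.mem_of_superset (hU η hb z hz) fun r hr =>
        ⟨mem_glue_succs hb hr.1, hr.2⟩
    · have hD : (S.glue E U).D η = S.D η := if_neg hb
      obtain ⟨hη, b, hb, r, hr, hrη⟩ := hη.resolve_left hb
      rw [hD, glue_succs_eq hS hb hr hη hrη]
      exact hS.converges_to hη hlt hz

theorem root_of_glue (hr : η ∈ (S.glue E U).roots) : IsBlock E η := by
  rcases hr.1 with h | ⟨hη, b, hb, r, hr', hrη⟩
  · exact h
  · exact absurd (tlt_of_mem_blockRoots hr' hrη).2.2 (hr.2 b (Or.inl hb))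

theorem IsBlock.mem_glue_roots (hb : IsBlock E b) : b ∈ (S.glue E U).roots := by
  refine ⟨Or.inl hb, ?_⟩
  rintro x (hx | ⟨hx, b', hb', r, hr, hrx⟩) hxb
  · exact hx.not_tlt hb hxb
  · exact hb'.not_tlt hb ((tlt_of_mem_blockRoots hr hrx).2.2.tle.trans_tlt hxb)

theorem exists_isBlock [WellFoundedLT X] (hE : ∀ x, ∃ j ∈ E, x < j) (x : X) :
    ∃ b, IsBlock E b ∧ x < b.α := by
  obtain ⟨i, hi, hxi⟩ := hE x
  obtain ⟨h1, h2⟩ := nextIn_mem (hE i)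
  exact ⟨Node.pair i (nextIn E i) h2, ⟨hi, h1, h2, fun k hk hik => nextIn_le hk hik⟩, hxi⟩

/-- Gluing: there is a large creature whose roots are blocks, which contains the trees of `S` inside
the blocks, and whose ultrafilters at the roots converge to the ends of the blocks. -/
theorem IsCreature.exists_glue [WellFoundedLT X] (hX : IsRegularOrder X) (hS : S.IsCreature)
    (hE : S.RootsCofinal E) (hE' : ∀ x, ∃ j ∈ E, x < j) :
    ∃ T : PreCreature X, (T.IsCreature ∧ T.IsLarge) ∧ (∀ r ∈ T.roots, IsBlock E r) ∧
      T.IsFront {r | ∃ b, IsBlock E b ∧ r ∈ S.blockRoots b} ∧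
      (∀ b r, IsBlock E b → r ∈ S.blockRoots b → SubAbove T S r) ∧
      (∀ b, IsBlock E b → ∀ z < b.β, {r | r ∈ S.blockRoots b ∧ z < r.α} ∈ T.D b) ∧
      ∀ η ∈ T.nodes, IsBlock E η ∨ η ∈ S.nodes := by
  have hex : ∀ b, IsBlock E b → ∃ U : Ultrafilter (Node X),
    ∀ z < b.β, {r | r ∈ S.blockRoots b ∧ z < r.α} ∈ U := fun b hb => exists_blockUltrafilter hE hb
  have hnode : Nonempty (Ultrafilter (Node X)) := ⟨S.D (Node.pt hX.nonempty.some)⟩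
  choose! U hU using hex
  obtain ⟨b₀, hb₀, -⟩ := exists_isBlock hE' hX.nonempty.some
  have hT := glue_isCreature hS hE ⟨b₀, hb₀⟩ hU
  refine ⟨S.glue E U, ⟨hT, (hT.isLarge_iff hX).2 fun x => ?_⟩, fun r hr => root_of_glue hr,
    ?_, ?_, ?_, ?_⟩
  · obtain ⟨b, hb, h⟩ := exists_isBlock hE' x
    exact ⟨b, hb.mem_glue_roots, h.le⟩
  · refine hT.isFront_iff.2 ⟨?_, fun i hi => ?_⟩
    · rintro r ⟨b, hb, hr⟩
      exact Or.inr ⟨hr.1.1, b, hb, r, hr, Node.TLE.refl _⟩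
    · rcases hi with hi | ⟨hi, b, hb, r, hr, hri⟩
      · exact absurd hi.2.2.1 (lt_irrefl _)
      · refine ⟨r, ⟨⟨b, hb, hr⟩, hri⟩, ?_⟩
        rintro r' ⟨⟨b', hb', hr'⟩, hri'⟩
        exact hS.root_eq hr'.1 hr.1 hi hri' hri
  · rintro b r hb hr η (hη | ⟨hη, -⟩) hrη
    · exact absurd (tlt_of_mem_blockRoots hr hrη).2.2 (hb.not_tlt hη)
    · refine ⟨hη, fun _ => ⟨(glue_succs_eq hS hb hr hη hrη).subset, if_neg fun h => ?_⟩⟩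
      exact h.notMem hE hη
  · intro b hb z hz
    have hD : (S.glue E U).D b = U b := if_pos hb
    rw [hD]
    exact hU b hb z hz
  · rintro η (h | h)
    · exact Or.inl h
    · exact Or.inr h.1

/-- Every operation is dominated by a function of a bound of its arguments. -/
theorem exists_bound (hX : IsRegularOrder X) (f : Operation X) (x : X) :
    ∃ b, ∀ y, (∀ i, y i ≤ x) → f.2 y < b := by
  obtain ⟨b, hb⟩ := hX.exists_gt_range (fun y : Fin (f.1 + 1) → Set.Iic x => f.2 fun i => y i) (by
    rw [mk_arrow, lift_id', mk_fin, lift_natCast]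
    rcases lt_or_ge #(Set.Iic x) ℵ₀ with h | h
    · exact (power_lt_aleph0 h (natCast_lt_aleph0)).trans hX.uncountable
    · exact (power_nat_le h).trans_lt (hX.mk_Iic_lt x))
  exact ⟨b, fun y hy => hb fun i => ⟨y i, hy i⟩⟩

/-- The limits of the iterates of a function form an unbounded set of closure points. -/
theorem exists_closure_point [WellFoundedLT X] (hX : IsRegularOrder X) (φ : X → X) (x : X) :
    ∃ j, x < j ∧ ∀ z < j, ∃ w, z ≤ w ∧ φ w < j := by
  have hne : {b | ∀ n, φ^[n] x < b}.Nonempty := by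
    obtain ⟨b, hb⟩ := hX.exists_gt (Set.range fun n => φ^[n] x)
      ((Set.countable_range _).le_aleph0.trans_lt hX.uncountable)
    exact ⟨b, fun n => hb _ ⟨n, rfl⟩⟩
  obtain ⟨j, hj, hmin⟩ : ∃ j, (∀ n, φ^[n] x < j) ∧ ∀ z < j, ∃ n, z ≤ φ^[n] x := by
    refine ⟨_, wellFounded_lt.min_mem _ hne, fun z hz => ?_⟩
    by_contra! h
    exact absurd (wellFounded_lt.min_le (show z ∈ {b | ∀ n, φ^[n] x < b} from h)) (not_le.2 hz)
  refine ⟨j, hj 0, fun z hz => ?_⟩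
  obtain ⟨n, hn⟩ := hmin z hz
  exact ⟨_, hn, by simpa only [Function.iterate_succ_apply'] using hj (n + 1)⟩

/-- A creature glued from trees of `S` refines `S`. -/
theorem LE.of_front [WellFoundedLT X] (hT : T.IsCreature) (hS : S.IsCreature)
    {P : Node X → Prop} (hF : T.IsFront {r | ∃ b, P b ∧ r ∈ S.blockRoots b})
    (h : ∀ b r, P b → r ∈ S.blockRoots b → SubAbove T S r) : T.LE S :=
  (le_iff hT hS).2 ⟨_, hF, fun _ ⟨_, _, hr⟩ => hr.1, fun r ⟨b, hb, hr⟩ => h b r hb hr⟩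

/-- Below any large creature there is one which decides how `f` and `g` compare. -/
theorem IsCreature.exists_le_decides [WellFoundedLT X] (hX : IsRegularOrder X) (hS : S.IsCreature)
    (hL : S.IsLarge) (f g : Operation X) :
    ∃ T : PreCreature X, (T.IsCreature ∧ T.IsLarge) ∧ T.LE S ∧
      (T.Lt f g ∨ T.Sim f g ∨ T.Lt g f) := by
  -- glue the trees of `S` into blocks bounded by closure points of `f` and `g`
  have hφ : ∀ x, ∃ b, (∀ y, (∀ i, y i ≤ x) → f.2 y < b) ∧ (∀ y, (∀ i, y i ≤ x) → g.2 y < b) ∧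
      ∃ r ∈ S.roots, x < r.α ∧ r.β < b := by
    intro x
    obtain ⟨b₁, h1⟩ := exists_bound hX f x
    obtain ⟨b₂, h2⟩ := exists_bound hX g x
    obtain ⟨r, hr, h3⟩ := hS.exists_root_gt hX hL x
    obtain ⟨b₃, h4⟩ := hX.exists_gt' r.β
    exact ⟨max b₁ (max b₂ b₃), fun y hy => (h1 y hy).trans_le (le_max_left _ _),
      fun y hy => (h2 y hy).trans_le ((le_max_left _ _).trans (le_max_right _ _)), r, hr, h3,
      h4.trans_le ((le_max_right _ _).trans (le_max_right _ _))⟩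
  choose φ hφf hφg hφr using hφ
  set E : Set X := {j | ∀ z < j, ∃ w, z ≤ w ∧ φ w < j} with hE
  have hcof : S.RootsCofinal E := by
    intro j hj z hz
    obtain ⟨w, hzw, hw⟩ := hj z hz
    obtain ⟨r, hr, h1, h2⟩ := hφr w
    exact ⟨r, hr, hzw.trans_lt h1, h2.trans hw⟩
  obtain ⟨T, ⟨hT, hTL⟩, hTr, hfr, hsub, -⟩ := hS.exists_glue hX hcof fun x => by
    obtain ⟨j, hxj, hj⟩ := exists_closure_point hX φ x
    exact ⟨j, hj, hxj⟩
  have hTS := LE.of_front hT hS hfr hsub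
  have hstrong : ∀ h : Operation X, (∀ x y, (∀ i, y i ≤ x) → h.2 y < φ x) →
      ∀ r, IsBlock E r → r.IsStrong h := by
    intro h hh r hr
    refine ⟨hr.2.2.1, fun y hy => ?_⟩
    obtain ⟨j, hj⟩ := Finite.exists_max y
    obtain ⟨w, hw1, hw2⟩ := hr.2.1 (y j) (hy j)
    exact (hh w y fun i => (hj i).trans hw1).trans hw2
  -- thin out twice to obtain fronts which gauge `f` and `g`
  obtain ⟨T₁, hT₁, hT₁T, F, hF⟩ := hT.exists_thin_gauges f fun r hr =>
    hstrong f hφf r (hTr r hr)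
  have hroots := hT₁T.roots_eq hT₁ hT
  obtain ⟨T₂, hT₂, hT₂T, G, hG⟩ := hT₁.exists_thin_gauges g fun r hr =>
    hstrong g hφg r (hTr r (hroots ▸ hr))
  have hle := hT₂T.le hT₂ hT₁
  have hL₂ : T₂.IsLarge := by
    rw [IsLarge, hT₂T.roots_eq hT₂ hT₁, hroots]
    exact hTL
  obtain ⟨R, hR, hRT, h⟩ :=
    (hF.restrict hT₂ hT₁ hle).exists_le_decides hX hT₂ hL₂ hG
  exact ⟨R, hR, hRT.trans hR.1 hT₂ hS (hle.trans hT₂ hT₁ hS ((hT₁T.le hT₁ hT).trans hT₁ hT hS hTS)),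
    h⟩

/-! ### Assembling trees of different creatures -/

section Assemble
variable {Y : Type u} [LinearOrder Y] (Q : Y → PreCreature X) (ρ : Y → Node X)

/-- The node `η` lies in the tree of `Q y` with root `ρ y`. -/
def InPiece (y : Y) (η : Node X) : Prop := η ∈ (Q y).nodes ∧ (ρ y).TLE η

open Classical in
/-- The union of the trees of `Q y` with root `ρ y`. -/
noncomputable def assemble : PreCreature X where
  nodes := {η | ∃ y, InPiece Q ρ y η}
  D η := if h : ∃ y, InPiece Q ρ y η then (Q h.choose).D η else pure η

variable {Q ρ}

theorem InPiece.unique (hρ : ∀ y y', y < y' → (ρ y).β < (ρ y').α) {y y' : Y}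
    (h : InPiece Q ρ y η) (h' : InPiece Q ρ y' ν) (h1 : η.α ≤ ν.α) (h2 : ν.β ≤ η.β) : y = y' := by
  rcases lt_trichotomy y y' with hlt | hlt | hlt
  · exact absurd ((ν.α_le_β.trans h2).trans (h.2.β_le)) (not_le.2 ((hρ _ _ hlt).trans_le h'.2.α_le))
  · exact hlt
  · exact absurd ((h.2.α_le.trans h1).trans (ν.α_le_β.trans h'.2.β_le)) (not_le.2 (hρ _ _ hlt))

theorem InPiece.eq (hρ : ∀ y y', y < y' → (ρ y).β < (ρ y').α) {y y' : Y}
    (h : InPiece Q ρ y η) (h' : InPiece Q ρ y' η) : y = y' := h.unique hρ h' le_rfl le_rfl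

theorem InPiece.D_eq (hρ : ∀ y y', y < y' → (ρ y).β < (ρ y').α) {y : Y}
    (h : InPiece Q ρ y η) : (assemble Q ρ).D η = (Q y).D η := by
  have hex : ∃ y, InPiece Q ρ y η := ⟨y, h⟩
  have : (assemble Q ρ).D η = (Q hex.choose).D η := dif_pos hex
  rw [this, hex.choose_spec.eq hρ h]

theorem InPiece.succs_eq (hQ : ∀ y, (Q y).IsCreature) (hr : ∀ y, ρ y ∈ (Q y).roots)
    (hρ : ∀ y y', y < y' → (ρ y).β < (ρ y').α) {y : Y} (h : InPiece Q ρ y η) :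
    (assemble Q ρ).succs η = (Q y).succs η := by
  ext ν
  constructor
  · rintro ⟨⟨y', hν⟩, ⟨-, hην⟩, hmax⟩
    obtain rfl := h.unique hρ hν hην.α_le hην.β_lt.le
    exact ⟨hν.1, ⟨h.1, hην⟩, fun x hx hxν =>
      hmax x ⟨y, hx, (hQ y).root_tle_of_tle (hr y) hx hν.1 hν.2 hxν.tle⟩ hxν⟩
  · rintro ⟨hν, ⟨-, hην⟩, hmax⟩
    have hνy : InPiece Q ρ y ν := ⟨hν, h.2.trans hην.tle⟩
    refine ⟨⟨y, hνy⟩, ⟨⟨y, h⟩, hην⟩, ?_⟩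
    rintro x ⟨y', hx⟩ hxν
    obtain rfl := hx.unique hρ hνy hxν.α_le hxν.β_lt.le
    exact hmax x hx.1 hxν

theorem assemble_isCreature [WellFoundedLT X] [Nonempty Y] (hQ : ∀ y, (Q y).IsCreature)
    (hr : ∀ y, ρ y ∈ (Q y).roots) (hρ : ∀ y y', y < y' → (ρ y).β < (ρ y').α) :
    (assemble Q ρ).IsCreature := by
  refine isCreature_of ?_ ?_ ?_ ?_ ?_
  · exact ⟨ρ (Classical.arbitrary Y), _, (hr _).1, Node.TLE.refl _⟩
  · rintro η ⟨y, h⟩ ν ⟨y', h'⟩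
    have key : ∀ {y y' η ν}, y < y' → InPiece Q ρ y η → InPiece Q ρ y' ν → η.Lex ν := by
      intro y y' η ν hlt h h'
      have : η.β < ν.α := (h.2.β_le.trans_lt (hρ _ _ hlt)).trans_le h'.2.α_le
      exact ⟨fun e => absurd (e ▸ this) (not_lt.2 ν.α_le_β), this.le⟩
    rcases lt_trichotomy y y' with hlt | rfl | hlt
    · exact Or.inr (Or.inr (Or.inl (key hlt h h')))
    · exact (hQ y).total h.1 h'.1
    · exact Or.inr (Or.inr (Or.inr (key hlt h' h)))
  · rintro i j hij ⟨y, h⟩ ⟨y', h'⟩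
    obtain rfl := h'.unique hρ h le_rfl hij.le
    exact (hQ _).pair_notMem i j hij h.1 h'.1
  · intro c hc hch
    rcases c.eq_empty_or_nonempty with rfl | ⟨x, hx⟩
    · exact Set.finite_empty
    obtain ⟨y, hy⟩ := hc hx
    refine (hQ y).wellFounded c (fun z hz => ?_) hch
    obtain ⟨y', hy'⟩ := hc hz
    by_cases e : x = z
    · exact e ▸ hy.1
    rcases hch hx hz e with h | h
    · obtain rfl := hy.unique hρ hy' h.α_le h.β_le
      exact hy'.1
    · obtain rfl := hy'.unique hρ hy h.α_le h.β_le
      exact hy'.1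
  · rintro η ⟨y, hy⟩ hlt z hz
    rw [hy.D_eq hρ, hy.succs_eq hQ hr hρ]
    exact (hQ y).converges_to hy.1 hlt hz

theorem assemble_roots
    (hr : ∀ y, ρ y ∈ (Q y).roots) (hρ : ∀ y y', y < y' → (ρ y).β < (ρ y').α) :
    (assemble Q ρ).roots = Set.range ρ := by
  ext r
  constructor
  · rintro ⟨⟨y, hy⟩, h⟩
    exact ⟨y, hy.2.resolve_right (h _ ⟨y, (hr y).1, Node.TLE.refl _⟩)⟩
  · rintro ⟨y, rfl⟩
    have hy : InPiece Q ρ y (ρ y) := ⟨(hr y).1, Node.TLE.refl _⟩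
    refine ⟨⟨y, hy⟩, ?_⟩
    rintro x ⟨y', hx⟩ hlt
    obtain rfl := hx.unique hρ hy hlt.α_le hlt.β_lt.le
    exact (hr _).2 x hx.1 hlt

theorem assemble_subAbove (hQ : ∀ y, (Q y).IsCreature)
    (hr : ∀ y, ρ y ∈ (Q y).roots) (hρ : ∀ y y', y < y' → (ρ y).β < (ρ y').α) (y : Y) :
    SubAbove (assemble Q ρ) (Q y) (ρ y) := by
  rintro η ⟨y', h⟩ hη
  have hy : InPiece Q ρ y (ρ y) := ⟨(hr y).1, Node.TLE.refl _⟩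
  obtain rfl := hy.unique hρ h hη.α_le hη.β_le
  exact ⟨h.1, fun _ => ⟨(h.succs_eq hQ hr hρ).subset, h.D_eq hρ⟩⟩

/-- Roots of given large creatures can be chosen in strictly increasing position, and to the right
of given bounds. -/
theorem exists_separated_roots (hX : IsRegularOrder X) [WellFoundedLT Y]
    (hY : ∀ y : Y, #(Set.Iio y) < #X) (hQ : ∀ y, (Q y).IsCreature) (hL : ∀ y, (Q y).IsLarge)
    (b : Y → X) : ∃ ρ : Y → Node X, (∀ y, ρ y ∈ (Q y).roots) ∧ (∀ y, b y < (ρ y).α) ∧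
      ∀ y y', y < y' → (ρ y).β < (ρ y').α := by
  have hstep : ∀ (y : Y) (prev : ∀ y' : Y, y' < y → Node X), ∃ r ∈ (Q y).roots, b y < r.α ∧
      ∀ y' h, (prev y' h).β < r.α := by
    intro y prev
    obtain ⟨c, hc⟩ := hX.exists_gt_range (fun y' : Set.Iio y => (prev y'.1 y'.2).β) (hY y)
    obtain ⟨r, hr, h⟩ := (hQ y).exists_root_gt hX (hL y) (max (b y) c)
    exact ⟨r, hr, (le_max_left _ _).trans_lt h, fun y' h' =>
      (hc ⟨y', h'⟩).trans ((le_max_right _ _).trans_lt h)⟩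
  choose r hr hb hlt using hstep
  let ρ : Y → Node X := (wellFounded_lt (α := Y)).fix r
  have hρ : ∀ y, ρ y = r y fun y' _ => ρ y' := fun y => WellFounded.fix_eq _ _ _
  refine ⟨ρ, fun y => ?_, fun y => ?_, fun y y' h => ?_⟩
  · rw [hρ]
    exact hr _ _
  · rw [hρ]
    exact hb _ _
  · rw [hρ y']
    exact hlt y' (fun y' _ => ρ y') y h

end Assemble
end PreCreature

/-! ### Lower bounds of decreasing sequences -/

section LowerBound

variable {X : Type u} [LinearOrder X] [WellFoundedLT X]

omit [WellFoundedLT X] in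
theorem PreCreature.SubAbove.trans {T S R : PreCreature X} {γ : Node X} (h : T.SubAbove S γ)
    (h' : S.SubAbove R γ) : T.SubAbove R γ := fun η hη hγ =>
  ⟨(h' η (h η hη hγ).1 hγ).1, fun hlt =>
    ((h η hη hγ).2 hlt).trans ((h' η (h η hη hγ).1 hγ).2 hlt)⟩

omit [WellFoundedLT X] in
theorem PreCreature.SubRight.subAbove {T S : PreCreature X} (h : T.SubRight S) (γ : Node X) :
    T.SubAbove S γ := fun η hη _ => ⟨h.1 hη, h.2.2 η hη⟩

/-- A criterion for `T ≤* R`: almost all nodes of a front of `T` are `good`, which means that above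
them `T` is a part of a creature with a final part below `R`. -/
theorem LargeCreature.leStar_of_front (hX : IsRegularOrder X) {T R : LargeCreature X}
    {Φ good : Set (Node X)} (hΦ : T.1.IsFront Φ) (x₀ : X)
    (hroots : ∀ r ∈ T.1.roots, r ∈ Φ → x₀ < r.α → r ∈ good)
    (hD : ∀ η ∈ T.1.nodes, η.α < η.β → {ν | ν ∈ T.1.succs η → ν ∈ Φ → ν ∈ good} ∈ T.1.D η)
    (hgood : ∀ γ ∈ Φ, γ ∈ good → ∃ Q Z : LargeCreature X, γ ∈ Z.1.roots ∧ T.1.SubAbove Q.1 γ ∧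
      Z.1.SubRight Q.1 ∧ Z.1.LE R.1) :
    T.LEStar R := by
  have hT := T.2.1
  have hL := T.2.2
  obtain ⟨γ₀, hγ₀, hx₀⟩ := hT.exists_root_gt hX hL x₀
  have hrel : ∀ r ∈ T.1.roots, ∀ γ ∈ Φ, γ.TLE r → γ = r := fun r hr γ hγ h =>
    h.resolve_right (hr.2 γ (hΦ.1 hγ))
  have hright : ∀ r ∈ T.1.roots, γ₀.Lex r → ∀ γ ∈ Φ, γ.TLE r → γ ∈ good := by
    intro r hr hlex γ hγ h
    obtain rfl := hrel r hr γ hγ h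
    exact hroots γ hr hγ (hx₀.trans_le (γ₀.α_le_β.trans hlex.2))
  -- Drop an initial part of `T` and everything above bad nodes of `Φ`; then thin out above the good
  -- ones.
  set N : Set (Node X) := {η | (∀ γ ∈ Φ, γ.TLE η → γ ∈ good) ∧ γ₀.Lex η} with hNdef
  have hN : T.1.IsThinning N := by
    refine ⟨?_, ?_, ?_⟩
    · obtain ⟨r, hr, h⟩ := hT.exists_root_gt hX hL γ₀.α
      have hlex := hT.roots_lex_of_α_lt hγ₀ hr h
      exact ⟨r, hr.1, hright r hr hlex, hlex⟩
    · rintro x hx ν hν ⟨h1, h2⟩ hxν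
      exact ⟨fun γ hγ h => h1 γ hγ (h.trans hxν), (hT.root_lex_iff hγ₀ hx hν hxν).1 h2⟩
    · rintro η hη ⟨h1, h2⟩ hlt
      filter_upwards [hT.succs_mem η (hT.mem_internal_iff.2 ⟨hη, hlt⟩), hD η hη hlt] with ν hν hν'
      have hην := tlt_of_mem_succs hν
      refine ⟨hν, fun γ hγ h => ?_,
        (hT.root_lex_iff hγ₀ hη (mem_of_mem_succs hν) hην.tle).2 h2⟩
      rcases h with rfl | h
      · exact hν' hν hγ
      · exact h1 γ hγ (tle_of_mem_succs hν (hΦ.1 hγ) h)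
  have h1 : (T.1.restrict N).SubRight T.1 := hN.subRight hγ₀ fun r hr =>
    ⟨fun h => h.2, fun h => ⟨hright r hr h, h⟩⟩
  have hT₁ := hN.isCreature hT
  let T₁ : LargeCreature X := ⟨T.1.restrict N, hT₁, h1.isLarge hX hT₁ hT hL⟩
  obtain ⟨hF, hsub, -⟩ := IsFront.restrict hT₁ hT (h1.le hT₁ hT) hΦ
  have hgood' : ∀ γ ∈ {x | x ∈ Φ ∧ x ∈ T₁.1.nodes}, ∃ Q Z : LargeCreature X, γ ∈ Z.1.roots ∧
      T₁.1.SubAbove Q.1 γ ∧ Z.1.SubRight Q.1 ∧ Z.1.LE R.1 := by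
    rintro γ ⟨hγ, hγ'⟩
    obtain ⟨Q, Z, h2, h3, h4⟩ := hgood γ hγ (hγ'.2.1 γ hγ (Node.TLE.refl _))
    exact ⟨Q, Z, h2, (hsub γ hγ hγ').trans h3, h4⟩
  have : Nonempty (LargeCreature X) := ⟨T⟩
  choose! Q Z hZ hQ hZQ hZR using hgood'
  obtain ⟨T₂, hT₂, hthin, hF₂, hsub₂⟩ := exists_thin_local hT₁ hF (fun γ => (Q γ).1)
    (fun γ => (Z γ).1) (fun γ _ => (Q γ).2.1) (fun γ _ => (Z γ).2.1) hQ
    (fun γ hγ => (hZQ γ hγ).subAbove γ) (fun γ hγ => (hZ γ hγ).1)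
  have hL₂ : T₂.IsLarge := by
    rw [IsLarge, hthin.roots_eq hT₂ hT₁]
    exact T₁.2.2
  let T' : LargeCreature X := ⟨T₂, hT₂, hL₂⟩
  have ha : T'.Approx T := (approx_of_thin (S := T₁) hX hthin).trans hX
    (approx_of_subRight (T := T₁) hX h1)
  exact ⟨T', ha.symm, le_of_local hT₂ R.2.1 hF₂ fun γ hγ =>
    ⟨(Z γ).1, (Z γ).2.1, hZ γ hγ, hsub₂ γ hγ, hZR γ hγ⟩⟩

/-- If `T ≤* S`, then some `Z ≤ S` is a thinned-out right part of `T` which contains all roots of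
`T` to the right of a bound `d`. -/
theorem LargeCreature.LEStar.exists_bound {T S : LargeCreature X} (h : T.LEStar S) :
    ∃ (Z : LargeCreature X) (d : X), Z.1.SubRight T.1 ∧ Z.1.LE S.1 ∧
      ∀ γ ∈ T.1.roots, d < γ.α → γ ∈ Z.1.roots := by
  obtain ⟨Z, hZ, hle⟩ := h.exists_subRight
  obtain ⟨γ, hγ, hr⟩ := hZ.2.1
  refine ⟨Z, γ.α, hZ, hle, fun r hr' hlt => ?_⟩
  rw [hr]
  exact ⟨hr', T.2.1.roots_lex_of_α_lt hγ hr' hlt⟩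

/-- The creature without internal nodes which has all points as its leaves. -/
theorem LargeCreature.nonempty (hX : IsRegularOrder X) : Nonempty (LargeCreature X) := by
  let S : PreCreature X := ⟨Set.range Node.pt, pure⟩
  have hr : ∀ x : X, Node.pt x ∈ S.roots := by
    refine fun x => ⟨⟨x, rfl⟩, ?_⟩
    rintro _ ⟨y, rfl⟩
    exact Node.not_pt_tlt _
  have hS : S.IsCreature := by
    obtain ⟨x₀⟩ := hX.nonempty
    refine isCreature_of ⟨_, x₀, rfl⟩ ?_ ?_ ?_ ?_
    · rintro _ ⟨x, rfl⟩ _ ⟨y, rfl⟩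
      rcases lt_trichotomy x y with h | rfl | h
      · exact Or.inr (Or.inr (Or.inl ⟨fun e => h.ne (Node.pt.inj e), h.le⟩))
      · exact Or.inl (Node.TLE.refl _)
      · exact Or.inr (Or.inr (Or.inr ⟨fun e => h.ne (Node.pt.inj e), h.le⟩))
    · rintro i j h - ⟨x, hx⟩
      cases hx
    · intro c hc hch
      refine Set.Subsingleton.finite fun x hx y hy => ?_
      by_contra hne
      obtain ⟨i, rfl⟩ := hc hx
      obtain ⟨j, rfl⟩ := hc hy
      rcases hch hx hy hne with (h | h) | (h | h)
      · exact hne h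
      · exact Node.not_pt_tlt _ h
      · exact hne h.symm
      · exact Node.not_pt_tlt _ h
    · rintro _ ⟨x, rfl⟩ h
      exact absurd h (lt_irrefl _)
  exact ⟨⟨S, hS, (hS.isLarge_iff hX).2 fun x => ⟨_, hr x, le_rfl⟩⟩⟩

variable {J : Type u} [LinearOrder J] {S : J → LargeCreature X}

/-- The diagonal lower bound: if sets of fewer than `#X` indices are bounded, then the roots of a
lower bound are taken from members of the sequence which lie below more and more other members. -/
theorem LargeCreature.exists_lowerBound_diagonal (hX : IsRegularOrder X)
    (hS : ∀ i j, i < j → (S j).LEStar (S i)) (e : X → J) (he : Function.Surjective e)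
    (hJ : ∀ C : Set J, #C < #X → ∃ k, ∀ c ∈ C, c < k) :
    ∃ T : LargeCreature X, ∀ j, T.LEStar (S j) := by
  -- the root with number `ξ` comes from `S (k ξ)`, whose index is above the first `ξ` indices
  have hk : ∀ ξ, ∃ k, ∀ ζ ≤ ξ, e ζ < k := by
    intro ξ
    obtain ⟨k, hk⟩ := hJ (e '' Set.Iic ξ) (mk_image_le.trans_lt (hX.mk_Iic_lt ξ))
    exact ⟨k, fun ζ hζ => hk _ ⟨ζ, hζ, rfl⟩⟩
  choose k hk using hk
  choose Z d hZ hZS hd using fun i j h => (hS i j h).exists_bound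
  have hb : ∀ ξ, ∃ b, ξ ≤ b ∧ ∀ ζ (h : ζ ≤ ξ), d _ _ (hk ξ ζ h) ≤ b := by
    intro ξ
    obtain ⟨c, hc⟩ := hX.exists_gt_range (fun ζ : Set.Iic ξ => d _ _ (hk ξ ζ.1 ζ.2))
      (hX.mk_Iic_lt ξ)
    exact ⟨max ξ c, le_max_left _ _, fun ζ h => (hc ⟨ζ, h⟩).le.trans (le_max_right _ _)⟩
  choose b hb hdb using hb
  obtain ⟨ρ, hρr, hρb, hρ⟩ := exists_separated_roots (Q := fun ξ => (S (k ξ)).1) hX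
    (fun y => (mk_le_mk_of_subset Set.Iio_subset_Iic_self).trans_lt (hX.mk_Iic_lt y))
    (fun ξ => (S (k ξ)).2.1) (fun ξ => (S (k ξ)).2.2) b
  have := hX.nonempty
  have hT := assemble_isCreature (fun ξ => (S (k ξ)).2.1) hρr hρ
  have hTr := assemble_roots hρr hρ
  have hL := (hT.isLarge_iff hX).2 fun x =>
    ⟨ρ x, by rw [hTr]; exact ⟨x, rfl⟩, (hb x).trans (hρb x).le⟩
  refine ⟨⟨_, hT, hL⟩, fun j => ?_⟩
  obtain ⟨ζ, rfl⟩ := he j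
  refine leStar_of_front hX (good := {r | ∃ ξ, ζ ≤ ξ ∧ r = ρ ξ}) hT.isFront_roots (ρ ζ).β ?_ ?_ ?_
  · rintro r hr - hlt
    dsimp only at hr
    rw [hTr] at hr
    obtain ⟨ξ, rfl⟩ := hr
    refine ⟨ξ, not_lt.1 fun h => ?_, rfl⟩
    exact (((hρ ξ ζ h).trans_le (ρ ζ).α_le_β).trans hlt).not_ge (ρ ξ).α_le_β
  · exact fun η hη _ => Filter.univ_mem' fun ν hν hr =>
      absurd (tlt_of_mem_succs hν) (hr.2 η hη)
  · rintro _ - ⟨ξ, hξ, rfl⟩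
    exact ⟨S (k ξ), Z _ _ (hk ξ ζ hξ), hd _ _ _ _ (hρr ξ) ((hdb ξ ζ hξ).trans_lt (hρb ξ)),
      assemble_subAbove (fun ξ => (S (k ξ)).2.1) hρr hρ ξ, hZ _ _ _, hZS _ _ _⟩

/-- The lower bound of a sequence of small cofinality: below a new root there are nodes taken from
all members of a cofinal subsequence, and the ultrafilter at this root concentrates on the late
members. -/
theorem LargeCreature.exists_lowerBound_cofinal [WellFoundedLT J] [Nonempty J]
    (hX : IsRegularOrder X) (hS : ∀ i j, i < j → (S j).LEStar (S i)) (C : Set J) (hC : #C < #X)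
    (hJ : ∀ j, ∃ c ∈ C, j < c) : ∃ T : LargeCreature X, ∀ j, T.LEStar (S j) := by
  have hCn : Nonempty C := by
    obtain ⟨c, hc, -⟩ := hJ (Classical.arbitrary J)
    exact ⟨⟨c, hc⟩⟩
  have hXn := hX.nonempty
  choose Z d hZ hZS hd using fun i j h => (hS i j h).exists_bound
  -- For each `x` and `c ∈ C`, a tree with root `ρ (x, c)` is taken from `S c`, far enough to the
  -- right to belong to the creatures which witness `S c ≤* S i` for all `i < c` in `C`.
  have hb : ∀ y : X ×ₗ C, ∃ b, (ofLex y).1 ≤ b ∧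
      ∀ i (_ : i ∈ C) (h : i < ((ofLex y).2 : J)), d i _ h ≤ b := by
    intro y
    obtain ⟨c, hc⟩ := hX.exists_gt_range
      (fun i : {i : C // (i : J) < ((ofLex y).2 : J)} => d _ _ i.2) ((mk_subtype_le _).trans_lt hC)
    exact ⟨max (ofLex y).1 c, le_max_left _ _, fun i hi h =>
      (hc ⟨⟨i, hi⟩, h⟩).le.trans (le_max_right _ _)⟩
  choose b hb hdb using hb
  have hY : ∀ y : X ×ₗ C, #(Set.Iio y) < #X := by
    intro y
    have hle : #(Set.Iio y) ≤ #(Set.Iic (ofLex y).1 × C) := by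
      refine mk_le_of_injective (f := fun z =>
        (⟨(ofLex z.1).1, ?_⟩, (ofLex z.1).2)) ?_
      · rcases Prod.Lex.lt_iff.1 z.2 with h | h
        · exact h.le
        · exact h.1.le
      · intro z z' h
        simp only [Prod.mk.injEq, Subtype.mk.injEq] at h
        exact Subtype.ext (ofLex.injective (Prod.ext h.1 h.2))
    refine hle.trans_lt ?_
    rw [mk_prod, lift_id, lift_id]
    exact mul_lt_of_lt hX.uncountable.le (hX.mk_Iic_lt _) hC
  obtain ⟨ρ, hρr, hρb, hρ⟩ := exists_separated_roots
    (Q := fun y : X ×ₗ C => (S ((ofLex y).2 : J)).1) hX hY (fun y => (S _).2.1)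
    (fun y => (S _).2.2) b
  have hU := assemble_isCreature (fun y : X ×ₗ C => (S ((ofLex y).2 : J)).2.1) hρr hρ
  have hUr := assemble_roots hρr hρ
  have hUs := assemble_subAbove (fun y : X ×ₗ C => (S ((ofLex y).2 : J)).2.1) hρr hρ
  set U := assemble (fun y : X ×ₗ C => (S ((ofLex y).2 : J)).1) ρ with hUdef
  have hlexc : ∀ (x : X) (c c' : C), c < c' →
      (ρ (toLex (x, c))).β < (ρ (toLex (x, c'))).α := fun x c c' h =>
    hρ _ _ (Prod.Lex.lt_iff.2 (Or.inr ⟨rfl, h⟩))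
  have hCj : ∀ c : C, ∃ c' : C, c < c' := fun c => by
    obtain ⟨c', hc', h⟩ := hJ c
    exact ⟨⟨c', hc'⟩, h⟩
  -- The ends of the blocks are the suprema `e x` of the positions of the nodes `ρ (x, c)`.
  have he : ∀ x, ∃ s, IsLUB (Set.range fun c : C => (ρ (toLex (x, c))).β) s := by
    intro x
    obtain ⟨s, hs⟩ := hX.exists_gt_range (fun c : C => (ρ (toLex (x, c))).β) hC
    have hne : (upperBounds (Set.range fun c : C => (ρ (toLex (x, c))).β)).Nonempty := by
      refine ⟨s, ?_⟩
      rintro _ ⟨c, rfl⟩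
      exact (hs c).le
    exact ⟨wellFounded_lt.min _ hne, WellFounded.min_mem _ _ _, fun a ha =>
      not_lt.1 (wellFounded_lt.not_lt_min _ ha)⟩
  choose e he using he
  have hlt : ∀ x c, (ρ (toLex (x, c))).β < e x := by
    intro x c
    obtain ⟨c', hc'⟩ := hCj c
    exact (hlexc x c c' hc').trans_le ((Node.α_le_β _).trans ((he x).1 ⟨c', rfl⟩))
  have hcof : U.RootsCofinal (Set.range e) := by
    rintro _ ⟨x, rfl⟩ z hz
    obtain ⟨_, ⟨c, rfl⟩, hc⟩ := (lt_isLUB_iff (he x)).1 hz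
    obtain ⟨c', hc'⟩ := hCj c
    exact ⟨ρ (toLex (x, c')), by rw [hUr]; exact ⟨_, rfl⟩, hc.trans (hlexc x c c' hc'), hlt x c'⟩
  obtain ⟨T, hT, hTr, hTF, hTs, hTD, hTn⟩ := hU.exists_glue hX hcof fun x => by
    let c : C := Classical.arbitrary C
    exact ⟨e x, ⟨x, rfl⟩, ((hb (toLex (x, c))).trans_lt (hρb _)).trans_le
      ((Node.α_le_β _).trans (hlt x c).le)⟩
  have key : ∀ c ∈ C, LEStar (⟨T, hT⟩ : LargeCreature X) (S c) := by
    intro c hc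
    refine leStar_of_front hX
      (good := {r | ∃ y : X ×ₗ C, c < ((ofLex y).2 : J) ∧ r = ρ y}) hTF
      (Classical.arbitrary X) ?_ ?_ ?_
    · rintro r hr ⟨b, -, hrb⟩ -
      exact absurd hrb.1.1 ((hTr r hr).notMem hcof)
    · intro η hη hηlt
      -- at a block which ends in `e x`, almost all successors are of the form `ρ (x, c')`, `c < c'`
      rcases hTn η hη with hblock | hηU
      · obtain ⟨x, hx⟩ := hblock.2.1
        have hz : (ρ (toLex (x, ⟨c, hc⟩))).β < η.β := hx ▸ hlt x ⟨c, hc⟩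
        filter_upwards [hTD η hblock _ hz]
        rintro r ⟨⟨hr, -, hrη⟩, hlt'⟩ - -
        rw [hUr] at hr
        obtain ⟨y, rfl⟩ := hr
        have hy : toLex (x, (⟨c, hc⟩ : C)) < y := by
          by_contra h
          rcases (not_lt.1 h).lt_or_eq with h | rfl
          · exact (((hρ _ _ h).trans_le (Node.α_le_β _)).trans hlt').not_ge (Node.α_le_β _)
          · exact hlt'.not_ge (Node.α_le_β _)
        refine ⟨y, ?_, rfl⟩
        rcases Prod.Lex.lt_iff.1 hy with h | h
        · refine absurd hrη (not_lt.2 ?_)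
          rw [← hx]
          refine (he x).2 ?_
          rintro _ ⟨c', rfl⟩
          exact (hρ (toLex (x, c')) y (Prod.Lex.lt_iff.2 (Or.inl h))).le.trans (Node.α_le_β _)
        · exact h.2
      · refine Filter.univ_mem' fun ν hν => ?_
        rintro ⟨b, -, hr⟩
        exact absurd (tlt_of_mem_succs hν) (hr.1.2 η hηU)
    · rintro _ ⟨b, hblock, hr⟩ ⟨y, hy, rfl⟩
      exact ⟨S _, Z _ _ hy, hd _ _ _ _ (hρr y) ((hdb y c hc hy).trans_lt (hρb y)),
        (hTs b _ hblock hr).trans (hUs y), hZ _ _ _, hZS _ _ _⟩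
  refine ⟨⟨T, hT⟩, fun j => ?_⟩
  obtain ⟨c, hc, hjc⟩ := hJ j
  exact (key c hc).trans hX (hS j c hjc)

/-- Decreasing sequences of length less than `(#X)⁺` have lower bounds. -/
theorem LargeCreature.exists_lowerBound [WellFoundedLT J] (hX : IsRegularOrder X) (hJ : #J ≤ #X)
    (hS : ∀ i j, i < j → (S j).LEStar (S i)) : ∃ T : LargeCreature X, ∀ j, T.LEStar (S j) := by
  rcases isEmpty_or_nonempty J with h | h
  · obtain ⟨T⟩ := LargeCreature.nonempty hX
    exact ⟨T, fun j => isEmptyElim j⟩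
  by_cases hmax : ∃ m : J, ∀ j, j ≤ m
  · obtain ⟨m, hm⟩ := hmax
    refine ⟨S m, fun j => ?_⟩
    rcases (hm j).lt_or_eq with h | rfl
    · exact hS j m h
    · exact LEStar.refl hX _
  push Not at hmax
  by_cases hC : ∀ C : Set J, #C < #X → ∃ k, ∀ c ∈ C, c < k
  · obtain ⟨f⟩ := hJ
    exact exists_lowerBound_diagonal hX hS _ (Function.invFun_surjective f.injective) hC
  · push Not at hC
    obtain ⟨C, hC, h⟩ := hC
    refine exists_lowerBound_cofinal hX hS C hC fun j => ?_
    obtain ⟨j', hj'⟩ := hmax j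
    obtain ⟨c, hc, h⟩ := h j'
    exact ⟨c, hc, hj'.trans_le h⟩

end LowerBound

/-! ### Existence of sufficiently generic sequences -/

/-- By recursion on `i`, the creature `S i` is chosen below all earlier ones, so that it decides the
`i`-th pair of operations. -/
theorem exists_sufficientlyGeneric {X : Type u} [LinearOrder X] [WellFoundedLT X]
    (hX : IsRegularOrder X) {I : Type u} [LinearOrder I] [WellFoundedLT I]
    (hI : ∀ i : I, #(Set.Iio i) ≤ #X) (e : I → Operation X × Operation X)
    (he : Function.Surjective e) : ∃ S : I → LargeCreature X, SufficientlyGeneric S := by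
  have := LargeCreature.nonempty hX
  let decides (i : I) (T : LargeCreature X) : Prop :=
    T.1.Lt (e i).1 (e i).2 ∨ T.1.Sim (e i).1 (e i).2 ∨ T.1.Lt (e i).2 (e i).1
  let S : I → LargeCreature X := (wellFounded_lt (α := I)).fix fun i prev =>
    Classical.epsilon fun T => (∀ j h, T.LEStar (prev j h)) ∧ decides i T
  have hS : ∀ i, S i = Classical.epsilon fun T => (∀ j < i, T.LEStar (S j)) ∧ decides i T :=
    fun i => WellFounded.fix_eq _ _ _
  have key : ∀ i, (∀ j < i, (S i).LEStar (S j)) ∧ decides i (S i) := by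
    intro i
    induction i using WellFoundedLT.induction with
    | ind i ih =>
      rw [hS]
      refine Classical.epsilon_spec (p := fun T => (∀ j < i, T.LEStar (S j)) ∧ decides i T) ?_
      obtain ⟨R, hR⟩ := exists_lowerBound (J := Set.Iio i) (S := fun j => S j) hX (hI i)
        fun j k h => (ih k k.2).1 j h
      obtain ⟨T, hT, hTR, h⟩ := R.2.1.exists_le_decides hX R.2.2 (e i).1 (e i).2
      exact ⟨⟨T, hT⟩, fun j hj => (LEStar.of_le (T := ⟨T, hT⟩) hX hTR).trans hX (hR ⟨j, hj⟩), h⟩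
  refine ⟨S, fun i j h => (key j).1 i h, fun f g => ?_⟩
  obtain ⟨i, hi⟩ := he (f, g)
  have := (key i).2
  simp only [decides, hi] at this
  exact ⟨i, this⟩

theorem mk_Iio_ord_lt (κ : Cardinal.{u}) (i : κ.ord.ToType) : #(Set.Iio i) < κ := by
  simpa using mk_Iio_lt i

theorem isRegularOrder_toType {κ : Cardinal.{u}} (hreg : κ.IsRegular) (hunc : ℵ₀ < κ) :
    IsRegularOrder κ.ord.ToType := by
  refine ⟨by rwa [mk_ord_toType], fun x => ?_, fun s hs => ?_⟩
  · rw [mk_ord_toType, ← Set.Iio_insert]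
    exact mk_insert_le.trans_lt
      (add_lt_of_lt hunc.le (mk_Iio_ord_lt κ x) (one_lt_aleph0.trans hunc))
  · rw [mk_ord_toType] at hs
    by_contra! h
    have := Order.cof_le (s := s) h
    rw [Ordinal.cof_toType, hreg.cof_ord] at this
    exact this.not_gt hs

theorem mk_operation_le {X : Type u} (hX : ℵ₀ ≤ #X) : #(Operation X) ≤ 2 ^ #X := by
  have h : ∀ n : ℕ, #((Fin (n + 1) → X) → X) ≤ 2 ^ #X := by
    intro n
    rw [← power_self_eq hX, ← power_def]
    refine power_le_power_left (aleph0_pos.trans_le hX).ne' ?_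
    rw [mk_arrow, mk_fin, lift_natCast, power_natCast, lift_uzero]
    exact power_nat_le hX
  have h2 : ℵ₀ ≤ 2 ^ #X := hX.trans (cantor _).le
  rw [mk_sigma]
  refine (sum_le_sum.{0, u} _ _ h).trans ?_
  rw [sum_const, mk_nat, lift_aleph0, lift_uzero]
  exact mul_le_of_le h2 h2 le_rfl

end CreatureClone

open CreatureClone

theorem mainTheorem2 (κ : Cardinal.{u}) (hreg : κ.IsRegular) (hunc : Cardinal.aleph0 < κ) :
    -- existence of sufficiently generic sequences
    ((2 : Cardinal.{u}) ^ κ = Order.succ κ →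
      ∃ S : (Order.succ κ).ord.ToType → LargeCreature κ.ord.ToType, SufficientlyGeneric S) ∧
    ∀ S : (Order.succ κ).ord.ToType → LargeCreature κ.ord.ToType, SufficientlyGeneric S →
      -- the union of the filters is a filter of unbounded sets, and it determines the clone
      (∃ U : Filter κ.ord.ToType, U.sets = ⋃ i, (S i).filterSets ∧ ∀ A ∈ U, ¬ BddAbove A) ∧
      (∀ i, IsClone (S i).clone) ∧
      (∀ i j, i ≤ j → (S i).clone ⊆ (S j).clone) ∧
      IsClone (cInf S) ∧
      cInf S = filterClone (⋃ i, (S i).filterSets) ∧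
      -- equivalent descriptions of the two relations
      (∀ f g, LtInf S f g ↔ ∃ i, (S i).LtStar f g) ∧
      (∀ f g, SimInf S f g ↔ ∃ i, (S i).SimStar f g) ∧
      -- (a), (b'), (c')
      (∀ f g, LtInf S f g → f ∈ cloneGen (cInf S ∪ {g})) ∧
      (∀ f g, LtInf S f g → g ∉ cloneGen (cInf S ∪ {f})) ∧
      (∀ f g (k : ℕ) (hf : f.1 ≤ k) (hg : g.1 ≤ k), LtInf S f g ∨ SimInf S f g →
        SimInf S (maxOp f g k hf hg) g) ∧
      -- the relations come from a map into a complete linear order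
      (∃ (Q : Type u) (_ : CompleteLinearOrder Q) (ρ : Operation κ.ord.ToType → Q),
        Represents S ρ) ∧
      -- (1), (2)
      (∀ (Q : Type v) [ConditionallyCompleteLinearOrder Q] (ρ : Operation κ.ord.ToType → Q),
        Represents S ρ →
          (∀ d : Q, ({f | ρ f < d}.Nonempty → IsClone {f | ρ f < d}) ∧
            ({f | ρ f ≤ d}.Nonempty → IsClone {f | ρ f ≤ d})) ∧
          ∀ D ∈ cloneInterval (cInf S), D ≠ Set.univ →
            ∃ d : Q, {f | ρ f < d} ⊆ D ∧ D ⊆ {f | ρ f ≤ d}) ∧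
      -- there is no last element
      (∀ f, ∃ g, LtInf S f g) ∧
      -- the clones `{h | h ≤_∞ f}` form a cofinal chain of proper clones without last element
      (∀ f, {h | LtInf S h f ∨ SimInf S h f} ∈ cloneInterval (cInf S) ∧
        {h | LtInf S h f ∨ SimInf S h f} ≠ Set.univ) ∧
      IsChain (· ⊆ ·) (Set.range fun f => {h | LtInf S h f ∨ SimInf S h f}) ∧
      (∀ D ∈ cloneInterval (cInf S), D ≠ Set.univ →
        ∃ f, D ⊆ {h | LtInf S h f ∨ SimInf S h f}) ∧
      (∀ f, ∃ g, {h | LtInf S h f ∨ SimInf S h f} ⊂ {h | LtInf S h g ∨ SimInf S h g}) ∧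
      -- there is no coatom
      cInf S ≠ Set.univ ∧
      ¬ ∃ M ∈ cloneInterval (cInf S), M ≠ Set.univ ∧
        ∀ D ∈ cloneInterval (cInf S), M ⊂ D → D = Set.univ := by
  have hX := isRegularOrder_toType hreg hunc
  have hI : Cardinal.mk (Order.succ κ).ord.ToType = Order.succ κ := Cardinal.mk_ord_toType _
  have hne : Nonempty (Order.succ κ).ord.ToType := by
    rw [← Cardinal.mk_ne_zero_iff, hI]
    exact (Order.bot_lt_succ κ).ne'
  refine ⟨fun h2 => ?_, fun S hS => ?_⟩
  · have hop := mk_operation_le hX.uncountable.le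
    rw [Cardinal.mk_ord_toType, h2] at hop
    have hop2 : Cardinal.mk (Operation κ.ord.ToType × Operation κ.ord.ToType) ≤
        Cardinal.mk (Order.succ κ).ord.ToType := by
      rw [Cardinal.mk_prod, Cardinal.lift_id, hI]
      exact Cardinal.mul_le_of_le (hunc.le.trans (Order.le_succ κ)) hop hop
    obtain ⟨e⟩ := hop2
    have : Nonempty (Operation κ.ord.ToType × Operation κ.ord.ToType) :=
      ⟨⟨0, fun x => x 0⟩, ⟨0, fun x => x 0⟩⟩
    refine exists_sufficientlyGeneric hX (fun i => ?_) _ (Function.invFun_surjective e.injective)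
    rw [Cardinal.mk_ord_toType]
    exact Order.lt_succ_iff.1 (mk_Iio_ord_lt _ i)
  · refine ⟨exists_filter hX hS, fun i => isClone_clone _, fun i j h => clone_mono hX hS h,
      isClone_cInf hX hS, cInf_eq hX hS, fun f g => ltInf_iff_ltStar hX hS,
      fun f g => simInf_iff_simStar hX hS, fun f g h => h.mem_cloneGen hX,
      fun f g h => h.notMem_cloneGen hX hS, ?_, exists_represents hX hS,
      fun Q _ ρ hρ => ⟨fun d => ⟨hρ.isClone_of_down hX hS (isLowerSet_Iio d),
        hρ.isClone_of_down hX hS (isLowerSet_Iic d)⟩,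
        fun D hD hne => hρ.exists_between hX hD hne⟩,
      exists_ltInf hX hS, initialSegment_mem hX hS, isChain_initialSegments hX hS,
      fun D hD hne => subset_initialSegment hX hS hD hne, fun f => ?_, cInf_ne_univ hX hS,
      no_coatom hX hS⟩
    · rintro f g k hf hg (⟨i, h⟩ | ⟨i, h⟩)
      · exact ⟨i, sim_maxOp hf hg (Or.inl h)⟩
      · exact ⟨i, sim_maxOp hf hg (Or.inr h)⟩
    · obtain ⟨g, hg⟩ := exists_ltInf hX hS f
      exact ⟨g, initialSegment_ssubset hX hS hg⟩
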